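/- Let $k$ be an algebraically closed field of arbitrary characteristic and let $\mathcal C$ be a spherical fusion category over $k$. Write $V^*$ for the left dual of an object $V$, with $\mathrm{ev}_V:V^*\otimes V\to\mathbf 1$ and $\mathrm{coev}_V:\mathbf 1\to V\otimes V^*$, and let $\{V_i\}_{i\in I}$ be representatives of the isomorphism classes of simple objects of $\mathcal C$. For a fusion subcategory $\mathcal D$ (a full subcategory containing $\mathbf 1$ and closed under tensor products, finite direct sums, subobjects and duals) let $\mathrm{Irr}(\mathcal D)=\{i: V_i\in\mathcal D\}$ and $\dim\mathcal D=\sum_{i\in\mathrm{Irr}(\mathcal D)}\dim(V_i)\dim(V_i^*)\in k$, where $\dim$ is the pivotal dimension. Assume that $\mathcal C$ is non-degenerate, i.e. $\dim\mathcal C\ne0$. Notation. Let $F:\mathcal Z(\mathcal C)\to\mathcal C$ be the forgetful functor from the Drinfeld center, $R$ a right adjoint of $F$, and $\delta,\epsilon$ the comultiplication and counit of the comonad $Z=FR$. Let $A=Z(\mathbf 1)$. For $X\in\mathcal C$ let $\rho_X:A\otimes X\to X\otimes A\to X$ be the half-braiding of $R(\mathbf 1)$ followed by $\mathrm{id}_X\otimes\epsilon_{\mathbf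 1}$, and let $\pi_X:A\to X\otimes X^*$ be the corresponding morphism. Let $u:\mathbf 1\to A$ and $m:A\otimes A\to A$ underlie the morphisms of $\mathcal Z(\mathcal C)$ with $\epsilon_{\mathbf 1}u=\mathrm{id}$ and $\epsilon_{\mathbf 1}m=\epsilon_{\mathbf 1}\otimes\epsilon_{\mathbf 1}$. Put $\mathrm{CE}(\mathcal C)=\mathrm{Hom}(\mathbf 1,A)$ and $\mathrm{CF}(\mathcal C)=\mathrm{Hom}(A,\mathbf 1)$. The space $\mathrm{CF}(\mathcal C)$ has the product $f\star g=f\circ Z(g)\circ\delta_{\mathbf 1}$, and $f\mapsto Z(f)\circ\delta_{\mathbf 1}$ is a bijection $\mathrm{CF}(\mathcal C)\to\mathrm{End}_{\mathcal Z(\mathcal C)}(R(\mathbf 1))$. Let $\psi:\mathrm{CE}(\mathcal C)\to\mathrm{End}(\mathrm{id}_{\mathcal C})$ be $\psi(a)_X=\rho_X(a\otimes\mathrm{id}_X)$, and let $S$ be the operator on $\mathrm{CE}(\mathcal C)$ with $\psi(S(a))_X=(\psi(a)_{{}^*X})^*$. Let $E_i\in\mathrm{CE}(\mathcal C)$ be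 the element with $\pi_{V_i}E_i=\mathrm{coev}_{V_i}$ and $\pi_{V_j}E_i=0$ for $j\neq i$. A cointegral is a $\lambda\in\mathrm{CF}(\mathcal C)$ with $Z(\lambda)\circ\delta_{\mathbf 1}=u\otimes\lambda$. Let $\lambda$ be the cointegral with $\lambda\circ u=\mathrm{id}_{\mathbf 1}$, and put $\mathcal F_\lambda:\mathrm{CE}(\mathcal C)\to\mathrm{CF}(\mathcal C)$, $\mathcal F_\lambda(a)=\lambda\circ m\circ(S(a)\otimes\mathrm{id}_A)$. The same constructions for $\mathcal D$ give $A_{\mathcal D}$, $\pi^{\mathcal D}_X$ and $\mathrm{CF}(\mathcal D)$. Let $q:A\to A_{\mathcal D}$ be the morphism with $\pi^{\mathcal D}_X\circ q=\pi_X$ for all $X\in\mathcal D$, and let $\lambda_{\mathcal D}\in\mathrm{CF}(\mathcal C)$ be the image, under $\mathrm{CF}(\mathcal D)\to\mathrm{CF}(\mathcal C)$, $f\mapsto f\circ q$, of the nonzero idempotent cointegral of $\mathcal D$. Let $R(\mathbf 1)=\bigoplus_j\mathfrak C^j$ be a decomposition into simple objects of $\mathcal Z(\mathcal C)$ (conjugacy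 classes), let $F_j\in\mathrm{CF}(\mathcal C)$ correspond to the projection onto $\mathfrak C^j$, and let $|\mathfrak C^j|\in k$ be the pivotal dimension of $\mathfrak C^j$. Claim. All these objects exist: $F$ and its analogue for $\mathcal D$ have right adjoints; $\psi$ is bijective; the $E_i$, $\lambda$, the nonzero idempotent cointegral of $\mathcal D$, and $q$ exist and are unique; and $R(\mathbf 1)$ has a finite decomposition as above. Moreover $\dim\mathcal D\neq0$ and $\mathcal F_\lambda$ is bijective. Set $\ell_{\mathcal D}=\mathcal F_\lambda^{-1}(\lambda_{\mathcal D})$. Then $$\ell_{\mathcal D}=\frac{\dim\mathcal C}{\dim\mathcal D}\sum_{i\in\mathrm{Irr}(\mathcal D)}E_i,\qquad \epsilon_{\mathbf 1}\circ\ell_{\mathcal D}=\frac{\dim\mathcal C}{\dim\mathcal D}\,\mathrm{id}_{\mathbf 1}.$$ If $\mathrm{CF}(\mathcal C)$ is commutative, then for every finite decomposition as above there is a unique set $\mathcal L_{\mathcal D}$ of indices with $\lambda_{\mathcal D}=\sum_{j\in\mathcal L_{\mathcal D}}F_j$. Whenever $\lambda_{\mathcal D}=\sum_{j\in\mathcal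 L_{\mathcal D}}F_j$ for a set $\mathcal L_{\mathcal D}$ of indices (whether or not $\mathrm{CF}(\mathcal C)$ is commutative), $$\frac{\dim\mathcal C}{\dim\mathcal D}=\sum_{j\in\mathcal L_{\mathcal D}}|\mathfrak C^j|.$$ -/

import Mathlib

open CategoryTheory MonoidalCategory Limits

universe w v u

namespace FusionCat

attribute [local instance] Abelian.hasFiniteBiproducts

/-! ### Fusion categories and pivotal structures -/

/-- A fusion category over `k`: a semisimple `k`-linear abelian rigid monoidal category with
`k`-bilinear tensor product, finite-dimensional morphism spaces, finitely many simple objects up to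
isomorphism, and `End(𝟙) = k`. -/
class IsFusion (k : Type w) [Field k] (C : Type u) [Category.{v} C] [Abelian C] [Linear k C]
    [MonoidalCategory C] [MonoidalPreadditive C] [MonoidalLinear k C] [RigidCategory C] :
    Prop where
  finite_hom (X Y : C) : Module.Finite k (X ⟶ Y)
  unit_bijective : Function.Bijective (LinearMap.toSpanSingleton k (𝟙_ C ⟶ 𝟙_ C) (𝟙 (𝟙_ C)))
  finite_simple : ∃ (n : ℕ) (S : Fin n → C), ∀ X : C, Simple X → ∃ i, Nonempty (X ≅ S i)
  semisimple (X : C) : ∃ (n : ℕ) (S : Fin n → C),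
    (∀ i, Simple (S i)) ∧ Nonempty (X ≅ ⨁ S)

/-- A pivotal structure: an isomorphism `id ≅ (-)**` of monoidal functors. Here `Xᘁ` is the dual
with `ev : Xᘁ ⊗ X ⟶ 𝟙` and `coev : 𝟙 ⟶ X ⊗ Xᘁ`. (Compatibility with the units follows from
compatibility with the tensor products.) -/
structure Pivotal (C : Type u) [Category.{v} C] [MonoidalCategory C] [RightRigidCategory C] where
  iso (X : C) : X ≅ (Xᘁ)ᘁ
  naturality {X Y : C} (f : X ⟶ Y) : f ≫ (iso Y).hom = (iso X).hom ≫ (fᘁ)ᘁ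
  monoidal (X Y : C) :
    (iso (X ⊗ Y)).hom ≫ ((rightDualTensorIso X Y).inv)ᘁ ≫ (rightDualTensorIso (Yᘁ) (Xᘁ)).hom =
      (iso X).hom ⊗ₘ (iso Y).hom

section Trace

variable {C : Type u} [Category.{v} C] [MonoidalCategory C] [RightRigidCategory C]

/-- The right evaluation `X ⊗ X* ⟶ X** ⊗ X* ⟶ 𝟙` of a pivotal category. -/
def Pivotal.ev (j : Pivotal C) (X : C) : X ⊗ Xᘁ ⟶ 𝟙_ C :=
  (j.iso X).hom ▷ Xᘁ ≫ ε_ (Xᘁ) ((Xᘁ)ᘁ)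

/-- The right pivotal trace of an endomorphism. -/
def Pivotal.trace (j : Pivotal C) {X : C} (f : X ⟶ X) : 𝟙_ C ⟶ 𝟙_ C :=
  η_ X (Xᘁ) ≫ f ▷ Xᘁ ≫ j.ev X

/-- A pivotal structure is spherical if every object has the same dimension as its dual. -/
def Pivotal.IsSpherical (j : Pivotal C) : Prop :=
  ∀ X : C, j.trace (𝟙 X) = j.trace (𝟙 (Xᘁ))

/-- The morphism `B ⟶ X ⊗ X*` corresponding to `r : B ⊗ X ⟶ X`. -/
def mate {B X : C} (r : B ⊗ X ⟶ X) : B ⟶ X ⊗ Xᘁ :=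
  (ρ_ B).inv ≫ B ◁ η_ X (Xᘁ) ≫ (α_ B X (Xᘁ)).inv ≫ r ▷ Xᘁ

end Trace

section Dimension

variable (k : Type w) [Field k] {C : Type u} [Category.{v} C] [Abelian C] [Linear k C]
  [MonoidalCategory C] [MonoidalPreadditive C] [MonoidalLinear k C] [RigidCategory C]
  [IsFusion k C]

/-- The identification `End(𝟙) = k`, inverse to `c ↦ c • id`. -/
noncomputable def scalar : (𝟙_ C ⟶ 𝟙_ C) ≃ₗ[k] k :=
  (LinearEquiv.ofBijective _ (IsFusion.unit_bijective (k := k) (C := C))).symm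

/-- The (right) pivotal dimension of an object. -/
noncomputable def pdim (j : Pivotal C) (X : C) : k := scalar k (j.trace (𝟙 X))

/-- `V` is a complete system of representatives of the isomorphism classes of simple objects. -/
structure IsIrr {C : Type u} [Category.{v} C] [Abelian C] {ι : Type} (V : ι → C) : Prop where
  simple (i : ι) : Simple (V i)
  existsUnique (X : C) : Simple X → ∃! i, Nonempty (X ≅ V i)

/-- The indices of the simple objects that belong to the full subcategory `P`. -/
noncomputable def irrIn {C : Type u} [Category.{v} C] {ι : Type} [Fintype ι] (V : ι → C)
    (P : ObjectProperty C) : Finset ι :=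
  letI := Classical.decPred fun i => P (V i)
  Finset.univ.filter fun i => P (V i)

/-- The global dimension of the full fusion subcategory `P`, namely the sum of
`dim (Vᵢ) dim (Vᵢ*)` over the simple objects `Vᵢ` in `P`. -/
noncomputable def globalDim (j : Pivotal C) {ι : Type} [Fintype ι] (V : ι → C)
    (P : ObjectProperty C) : k :=
  ∑ i ∈ irrIn V P, pdim k j (V i) * pdim k j ((V i)ᘁ)

end Dimension

/-- A fusion subcategory, given by the property of its objects: a full subcategory closed
under subobjects (so under isomorphisms), finite direct sums, tensor products, duals, and
containing the unit object. -/
class IsFusionSubcategory {C : Type u} [Category.{v} C] [Abelian C] [MonoidalCategory C]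
    [RigidCategory C] (P : ObjectProperty C) : Prop extends P.IsMonoidal where
  prop_of_mono {X Y : C} (f : X ⟶ Y) [Mono f] : P Y → P X
  prop_biprod {X Y : C} : P X → P Y → P (X ⊞ Y)
  prop_dual {X : C} : P X → P (Xᘁ)

/-! ### The Drinfeld center as a preadditive category -/

section Center

variable {C : Type u} [Category.{v} C] [Preadditive C] [MonoidalCategory C]
  [MonoidalPreadditive C]

instance (X Y : Center C) : Zero (X ⟶ Y) :=
  ⟨⟨0, fun U => by
    rw [MonoidalPreadditive.zero_whiskerRight, MonoidalPreadditive.whiskerLeft_zero,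
      zero_comp, comp_zero]⟩⟩

instance (X Y : Center C) : Add (X ⟶ Y) :=
  ⟨fun f g => ⟨f.f + g.f, fun U => by
    rw [MonoidalPreadditive.add_whiskerRight, MonoidalPreadditive.whiskerLeft_add,
      Preadditive.add_comp, Preadditive.comp_add, f.comm, g.comm]⟩⟩

theorem center_smul_comm {X Y : Center C} (n : ℤ) (f : X ⟶ Y) (U : C) :
    (n • f.f) ▷ U ≫ (Y.2.β U).hom = (X.2.β U).hom ≫ U ◁ (n • f.f) := by
  have h₁ : (n • f.f) ▷ U = n • (f.f ▷ U) := (tensorRight U).map_zsmul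
  have h₂ : U ◁ (n • f.f) = n • (U ◁ f.f) := (tensorLeft U).map_zsmul
  rw [h₁, h₂, Preadditive.zsmul_comp, Preadditive.comp_zsmul, f.comm]

instance (X Y : Center C) : SMul ℤ (X ⟶ Y) :=
  ⟨fun n f => ⟨n • f.f, center_smul_comm n f⟩⟩

instance (X Y : Center C) : SMul ℕ (X ⟶ Y) :=
  ⟨fun n f => ⟨n • f.f, fun U => by
    simpa only [natCast_zsmul] using center_smul_comm (n : ℤ) f U⟩⟩

instance (X Y : Center C) : Neg (X ⟶ Y) :=
  ⟨fun f => ⟨-f.f, fun U => by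
    simpa only [neg_smul, one_smul] using center_smul_comm (-1) f U⟩⟩

instance (X Y : Center C) : Sub (X ⟶ Y) :=
  ⟨fun f g => ⟨f.f - g.f, fun U => by
    rw [sub_eq_add_neg]; exact (f + -g).comm U⟩⟩

instance (X Y : Center C) : AddCommGroup (X ⟶ Y) :=
  Function.Injective.addCommGroup (fun f : X ⟶ Y => f.f) (fun _ _ h => Center.ext _ _ h)
    rfl (fun _ _ => rfl) (fun _ => rfl) (fun _ _ => rfl) (fun _ _ => rfl) (fun _ _ => rfl)

instance : Preadditive (Center C) where
  add_comp _ _ _ f f' g := Center.ext _ _ (Preadditive.add_comp _ _ _ f.f f'.f g.f)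
  comp_add _ _ _ f g g' := Center.ext _ _ (Preadditive.comp_add _ _ _ f.f g.f g'.f)

end Center

/-! ### The adjoint algebra, central elements and class functions

Throughout, `R` is a right adjoint of the forgetful functor `F` from the Drinfeld center. -/

section Adjoint

variable {C : Type u} [Category.{v} C] [MonoidalCategory C] {R : C ⥤ Center C}

/-- The object `R(𝟙)` of the Drinfeld center. -/
abbrev centralAlg (_ : Center.forget C ⊣ R) : Center C := R.obj (𝟙_ C)

/-- The adjoint algebra `A = FR(𝟙)`. -/
abbrev adjAlg (adj : Center.forget C ⊣ R) : C := (centralAlg adj).1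

variable (adj : Center.forget C ⊣ R)

/-- The space of central elements `CE(C) = Hom(𝟙, A)`. -/
abbrev CE : Type v := 𝟙_ C ⟶ adjAlg adj

/-- The space of class functions `CF(C) = Hom(A, 𝟙)`. -/
abbrev CF : Type v := adjAlg adj ⟶ 𝟙_ C

/-- The counit `ε₁ : A ⟶ 𝟙` of the comonad `FR` at the unit object. -/
def counit : CF adj := adj.counit.app (𝟙_ C)

/-- The isomorphism `CF(C) ≅ End(R(𝟙))`, which is `f ↦ FR(f) ∘ δ₁` with `δ` the comultiplication
of the comonad `FR`. -/
def toEnd : CF adj ≃ (centralAlg adj ⟶ centralAlg adj) :=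
  adj.homEquiv (centralAlg adj) (𝟙_ C)

/-- The product `f ⋆ g = f ∘ FR(g) ∘ δ₁` of class functions. -/
def classMul (f g : CF adj) : CF adj := (toEnd adj g).f ≫ f

/-- The unit `u : 𝟙 ⟶ A`: the morphism of the center with `ε₁ ∘ u = id`. -/
noncomputable def algUnit : CE adj := (adj.homEquiv (𝟙_ (Center C)) (𝟙_ C) (𝟙 (𝟙_ C))).f

/-- The multiplication `m : A ⊗ A ⟶ A`: the morphism of the center with
`ε₁ ∘ m = ε₁ ⊗ ε₁`. -/
noncomputable def algMul : adjAlg adj ⊗ adjAlg adj ⟶ adjAlg adj :=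
  (adj.homEquiv (centralAlg adj ⊗ centralAlg adj) (𝟙_ C)
    ((counit adj ⊗ₘ counit adj) ≫ (λ_ (𝟙_ C)).hom)).f

/-- The canonical action `ρ_X : A ⊗ X ⟶ X`, the composite `A ⊗ X ⟶ X ⊗ A ⟶ X` of the
half-braiding of `R(𝟙)` and `ε₁`. -/
def action (X : C) : adjAlg adj ⊗ X ⟶ X :=
  ((centralAlg adj).2.β X).hom ≫ X ◁ counit adj ≫ (ρ_ X).hom

/-- The map `ψ : CE(C) ⟶ End(id_C)`, `ψ(a)_X = ρ_X ∘ (a ⊗ id_X)`. -/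
def psi (a : CE adj) : End (𝟭 C) where
  app X := (λ_ X).inv ≫ a ▷ X ≫ action adj X
  naturality X Y f := by
    have h : adjAlg adj ◁ f ≫ action adj Y = action adj X ≫ f := by
      simp only [action, HalfBraiding.naturality_assoc, Category.assoc]
      rw [← whisker_exchange_assoc, rightUnitor_naturality]
    simp only [Functor.id_obj, Functor.id_map, Category.assoc, ← h]
    rw [← whisker_exchange_assoc, ← leftUnitor_inv_naturality_assoc]

/-- A cointegral: a class function `l` with `FR(l) ∘ δ₁ = u ⊗ l`. -/
def IsCointegral (l : CF adj) : Prop := (toEnd adj l).f = l ≫ algUnit adj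

/-- A cointegral `l` with `⟨l, u⟩ = 1`. -/
def IsNormalizedCointegral (l : CF adj) : Prop :=
  IsCointegral adj l ∧ algUnit adj ≫ l = 𝟙 (𝟙_ C)

/-- A nonzero cointegral which is idempotent for the product of class functions. -/
def IsIdempotentCointegral [HasZeroMorphisms C] (l : CF adj) : Prop :=
  IsCointegral adj l ∧ classMul adj l l = l ∧ l ≠ 0

section Rigid

variable [RigidCategory C]

/-- The universal dinatural map `π_X : A ⟶ X ⊗ X*` of the end `A = ∫ X ⊗ X*`. -/
def proj (X : C) : adjAlg adj ⟶ X ⊗ Xᘁ := mate (action adj X)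

theorem rightAdjointMate_leftAdjointMate {X Y : C} (f : X ⟶ Y) :
    @rightAdjointMate C _ _ (ᘁY : C) (ᘁX : C) hasRightDualLeftDual hasRightDualLeftDual
      (leftAdjointMate f) = f := by
  have h := coevaluation_comp_leftAdjointMate f
  change (ρ_ X).inv ≫ X ◁ η_ (ᘁY : C) Y ≫ X ◁ leftAdjointMate f ▷ Y ≫
    (α_ X (ᘁX : C) Y).inv ≫ ε_ (ᘁX : C) X ▷ Y ≫ (λ_ Y).hom = f
  rw [← MonoidalCategory.whiskerLeft_comp_assoc, h]
  rw [MonoidalCategory.whiskerLeft_comp_assoc, associator_inv_naturality_right_assoc,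
    whisker_exchange_assoc, leftUnitor_naturality, ExactPairing.coevaluation_evaluation_assoc]
  simp

/-- The operator `ξ ↦ ξ^!` on `End(id_C)`, with `(ξ^!)_X` the dual of `ξ` at the left
dual `ᘁX` of `X`. Here the dual of `ᘁX` is `X` itself. -/
def dualEnd (ξ : End (𝟭 C)) : End (𝟭 C) where
  app X := @rightAdjointMate C _ _ (ᘁX : C) (ᘁX : C) hasRightDualLeftDual hasRightDualLeftDual
    (ξ.app (ᘁX : C))
  naturality X Y f := by
    have h := congrArg (fun g : (ᘁY : C) ⟶ (ᘁX : C) =>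
      @rightAdjointMate C _ _ (ᘁY : C) (ᘁX : C) hasRightDualLeftDual hasRightDualLeftDual g)
      (ξ.naturality (leftAdjointMate f))
    dsimp only [Functor.id_obj, Functor.id_map] at h
    rw [@comp_rightAdjointMate, @comp_rightAdjointMate, rightAdjointMate_leftAdjointMate] at h
    exact h.symm

/-- The antipodal operator on `CE(C)`, which is `ξ ↦ ξ^!` transported along the bijection `ψ`. -/
noncomputable def antipode (a : CE adj) : CE adj :=
  haveI : Nonempty (CE adj) := ⟨algUnit adj⟩
  Function.invFun (psi adj) (dualEnd (psi adj a))

/-- The Fourier transform `F_l(a) = l ↼ S(a) = l ∘ m ∘ (S(a) ⊗ id_A)`. -/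
noncomputable def fourier (l : CF adj) (a : CE adj) : CF adj :=
  (λ_ (adjAlg adj)).inv ≫ antipode adj a ▷ adjAlg adj ≫ algMul adj ≫ l

/-- `e` is the central element `Eᵢ : 𝟙 ⟶ Vᵢ ⊗ Vᵢ* ⟶ A`, the composite of the coevaluation and of
the inclusion of the `i`-th summand for the decomposition `A ≅ ⨁ Vⱼ ⊗ Vⱼ*` with projections
`π_{Vⱼ}`. -/
def IsCentralIdempotent [HasZeroMorphisms C] {ι : Type} (V : ι → C) (i : ι) (e : CE adj) : Prop :=
  e ≫ proj adj (V i) = η_ (V i) ((V i)ᘁ) ∧ ∀ j, j ≠ i → e ≫ proj adj (V j) = 0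

end Rigid

end Adjoint

/-! ### Restriction to a full subcategory -/

section Restriction

variable {C : Type u} [Category.{v} C] [MonoidalCategory C] [RigidCategory C]
  {P : ObjectProperty C} [P.IsMonoidal] {R : C ⥤ Center C}
  {RD : P.FullSubcategory ⥤ Center P.FullSubcategory}

/-- The dinatural map `A_D ⟶ X ⊗ X*` in `C`, for `X` in the full subcategory `D`. -/
def projSub (adjD : Center.forget P.FullSubcategory ⊣ RD) (X : P.FullSubcategory) :
    (adjAlg adjD).obj ⟶ X.obj ⊗ X.objᘁ :=
  mate (B := (adjAlg adjD).obj) (X := X.obj) (action adjD X).hom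

/-- `q` is the canonical morphism `A_C ⟶ A_D`, determined by `π^D_X ∘ q = π_X` for `X` in `D`. -/
def IsRestriction (adj : Center.forget C ⊣ R) (adjD : Center.forget P.FullSubcategory ⊣ RD)
    (q : adjAlg adj ⟶ (adjAlg adjD).obj) : Prop :=
  ∀ X : P.FullSubcategory, q ≫ projSub adjD X = proj adj X.obj

/-- The map `q* : CF(D) ⟶ CF(C)`, `f ↦ f ∘ q`. -/
def restrict (adj : Center.forget C ⊣ R) (adjD : Center.forget P.FullSubcategory ⊣ RD)
    (q : adjAlg adj ⟶ (adjAlg adjD).obj) (f : CF adjD) : CF adj := q ≫ f.hom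

end Restriction

/-! ### Conjugacy classes -/

section Conjugacy

variable {C : Type u} [Category.{v} C] [Preadditive C] [MonoidalCategory C]
  [MonoidalPreadditive C] {R : C ⥤ Center C}

/-- A decomposition `R(𝟙) ≅ ⨁ⱼ 𝔠ⱼ` in the Drinfeld center into simple objects, which are
the conjugacy classes. -/
structure ConjugacyDecomposition (adj : Center.forget C ⊣ R) (n : ℕ) where
  cls : Fin n → Center C
  simple (j : Fin n) : Simple (cls j)
  bicone : Bicone cls
  isBilimit : bicone.IsBilimit
  iso : bicone.pt ≅ centralAlg adj

/-- The class function `Fⱼ` corresponding to the projection of `R(𝟙)` onto `𝔠ⱼ`. -/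
def ConjugacyDecomposition.idem {adj : Center.forget C ⊣ R} {n : ℕ}
    (d : ConjugacyDecomposition adj n) (j : Fin n) : CF adj :=
  (toEnd adj).symm (d.iso.inv ≫ d.bicone.π j ≫ d.bicone.ι j ≫ d.iso.hom)

end Conjugacy

end FusionCat

/-! The proof rests on the regular character χ_D = ∑ dim(V_i) χ_i of a fusion subcategory D
(`regularChar`), summed over Irr(D), where χ_i : A → V_i ⊗ V_i* → 𝟙 is π_{V_i} followed by the
pivotal evaluation. By the handle slide (`handle_slide`), where sphericality enters, χ_D can be
moved across every object of D. Consequently χ_C is a cointegral, the analogous class function of D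
is a cointegral of D restricting to χ_D, and χ_D ⋆ χ_D = dim(D) χ_D.

Let T_D be the endomorphism of A given by χ_D. Its trace is dim C, whatever D is
(`ktrace_toEnd_regularChar`): a nontrivial χ_i gives a traceless endomorphism, χ_𝟙 gives the
identity, and dim A = dim C. If dim D vanished, T_D would square to zero and so be traceless; hence
dim D ≠ 0 (`globalDim_ne_zero`), in every characteristic. Evaluating cointegrals on u then gives λ =
χ_C / dim C and λ_D = χ_D / dim D.

The Fourier transform is diagonal for the basis of characters (`fourier_sum_character`): the
coefficient of χ_i is multiplied by the scalar through which a acts on the left dual of V_i. It is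
bijective because dimensions of simple objects are nonzero. As D is closed under duals, ∑ E_i over
Irr(D) goes to χ_D / dim C, which yields ℓ_D; composing with ε reads off the action on 𝟙, which lies
in D.

The endomorphism of A given by λ_D has trace dim C / dim D, and the one given by F_j has trace
|𝔠_j|; this is the last formula. If CF(C) is commutative, λ_D gives a central idempotent of
End(R(𝟙)), which is 0 or 1 on each simple summand.

Existence of the objects: A is the sum of the V_i ⊗ V_i*, with a half-braiding from the universal
property of an end; averaging along λ (`IsNormalizedCointegral.exists_average`) is a Maschke
argument giving uniqueness of λ and semisimplicity of the center. -/

namespace FusionCat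

attribute [local instance] Abelian.hasFiniteBiproducts

/-! ### Semisimple categories with a finite family of simple objects -/

section Basis

variable {k : Type w} [Field k] {D : Type u} [Category.{v} D] [Preadditive D] [Linear k D]

/-- A finite family of pairwise non-isomorphic absolutely simple objects such that every object
is a finite direct sum of them. -/
structure SemisimpleBasis (k : Type w) [Field k] {D : Type u} [Category.{v} D] [Preadditive D]
    [Linear k D] {ι : Type} [Fintype ι] (V : ι → D) : Prop where
  id_ne_zero (i : ι) : 𝟙 (V i) ≠ 0
  exists_smul {i : ι} (f : V i ⟶ V i) : ∃ c : k, f = c • 𝟙 (V i)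
  eq_zero {i j : ι} (h : i ≠ j) (f : V i ⟶ V j) : f = 0
  decomp (X : D) : ∃ (K : ι → Type) (_ : ∀ i, Fintype (K i)) (b : ∀ i, K i → (X ⟶ V i))
    (a : ∀ i, K i → (V i ⟶ X)), ∑ i, ∑ x, b i x ≫ a i x = 𝟙 X ∧
      (∀ i x, a i x ≫ b i x = 𝟙 (V i)) ∧ ∀ i x y, x ≠ y → a i x ≫ b i y = 0

variable {ι : Type} [Fintype ι] {V : ι → D}

/-- Morphisms between the V i are scalars or zero, so any family on the simple objects is
automatically natural among them. -/
theorem SemisimpleBasis.hom_comm (hV : SemisimpleBasis k V) (G H : D ⥤ D) [G.Additive]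
    [H.Additive] [G.Linear k] [H.Linear k] (g : ∀ i, G.obj (V i) ⟶ H.obj (V i)) {i j : ι}
    (f : V i ⟶ V j) : G.map f ≫ g j = g i ≫ H.map f := by
  by_cases h : i = j
  · subst h
    obtain ⟨c, rfl⟩ := hV.exists_smul f
    simp [Functor.map_smul]
  · rw [hV.eq_zero h f]
    simp

/-- A family of morphisms between the values of two linear functors on the simple objects
extends to a natural transformation. -/
theorem SemisimpleBasis.exists_natTrans (hV : SemisimpleBasis k V) (G H : D ⥤ D) [G.Additive]
    [H.Additive] [G.Linear k] [H.Linear k] (g : ∀ i, G.obj (V i) ⟶ H.obj (V i)) :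
    ∃ τ : G ⟶ H, ∀ i, τ.app (V i) = g i := by
  choose K _ b a h1 _ using hV.decomp
  -- The family is transported along a chosen decomposition of X; `key` characterizes the result by
  -- its restrictions to simple objects, so the choice does not affect naturality.
  let app : ∀ X, G.obj X ⟶ H.obj X := fun X => ∑ i, ∑ x, G.map (b X i x) ≫ g i ≫ H.map (a X i x)
  have key : ∀ (l : ι) (X : D) (f : V l ⟶ X), G.map f ≫ app X = g l ≫ H.map f := by
    intro l X f
    calc G.map f ≫ app X = ∑ i, ∑ x, g l ≫ H.map (f ≫ b X i x ≫ a X i x) := by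
          simp only [app, Preadditive.comp_sum]
          refine Finset.sum_congr rfl fun i _ => Finset.sum_congr rfl fun x _ => ?_
          rw [← Functor.map_comp_assoc, ← Category.assoc, hV.hom_comm G H g]
          simp only [Functor.map_comp, Category.assoc]
      _ = g l ≫ H.map f := by
          simp only [← Preadditive.comp_sum, ← Functor.map_sum, h1, Category.comp_id]
  refine ⟨{ app := app, naturality := fun X Y f => ?_ }, fun j => ?_⟩
  · calc G.map f ≫ app Y = G.map (∑ i, ∑ x, b X i x ≫ a X i x) ≫ G.map f ≫ app Y := by
          rw [h1, CategoryTheory.Functor.map_id, Category.id_comp]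
      _ = ∑ i, ∑ x, G.map (b X i x) ≫ G.map (a X i x ≫ f) ≫ app Y := by
          simp only [Preadditive.sum_comp, Functor.map_sum, Functor.map_comp, Category.assoc]
      _ = app X ≫ H.map f := by
          simp only [key]
          simp only [app, Preadditive.sum_comp, Functor.map_comp, Category.assoc]
  · simpa using key j _ (𝟙 (V j))

theorem SemisimpleBasis.natTrans_ext (hV : SemisimpleBasis k V) {G H : D ⥤ D}
    [H.Additive] {τ τ' : G ⟶ H} (h : ∀ i, τ.app (V i) = τ'.app (V i)) : τ = τ' := by
  ext X
  obtain ⟨K, _, b, a, h1, _⟩ := hV.decomp X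
  have key : ∀ σ : G ⟶ H, σ.app X = ∑ i, ∑ x, G.map (b i x) ≫ σ.app (V i) ≫ H.map (a i x) := by
    intro σ
    simp only [NatTrans.naturality_assoc, ← Functor.map_comp, ← Preadditive.comp_sum,
      ← Functor.map_sum, h1, CategoryTheory.Functor.map_id, Category.comp_id]
  rw [key τ, key τ']
  simp only [h]

theorem SemisimpleBasis.hom_ext_left (hV : SemisimpleBasis k V) {X Y : D} {f g : X ⟶ Y}
    (h : ∀ i (a : V i ⟶ X), a ≫ f = a ≫ g) : f = g := by
  obtain ⟨K, _, b, a, h1, _⟩ := hV.decomp X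
  rw [← Category.id_comp f, ← Category.id_comp g, ← h1]
  simp only [Preadditive.sum_comp, Category.assoc, h]

theorem SemisimpleBasis.hom_ext_right (hV : SemisimpleBasis k V) {X Y : D} {f g : X ⟶ Y}
    (h : ∀ i (b : Y ⟶ V i), f ≫ b = g ≫ b) : f = g := by
  obtain ⟨K, _, b, a, h1, _⟩ := hV.decomp Y
  rw [← Category.comp_id f, ← Category.comp_id g, ← h1]
  simp only [Preadditive.comp_sum, ← Category.assoc, h]

end Basis

/-! ### Universal families and free half-braidings -/

section Universal

variable {k : Type w} [Field k] {D : Type u} [Category.{v} D] [Preadditive D] [Linear k D]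
  [MonoidalCategory D] [MonoidalPreadditive D] [MonoidalLinear k D]
  {ι : Type} [Fintype ι] {V : ι → D}

/-- A family `τ_U : Z ⊗ U ⟶ U ⊗ X` is universal (with respect to `V`) if `W ⊗ Z` represents the
families `B ⊗ V i ⟶ W ⊗ V i ⊗ X`, for each `W`. -/
def IsUniversal (V : ι → D) {X Z : D} (τ : ∀ U, Z ⊗ U ⟶ U ⊗ X) : Prop :=
  ∀ (B W : D) (g : ∀ i, B ⊗ V i ⟶ W ⊗ V i ⊗ X),
    ∃! h : B ⟶ W ⊗ Z, ∀ i, h ▷ V i ≫ (α_ W Z (V i)).hom ≫ W ◁ τ (V i) = g i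

omit [Preadditive D] [MonoidalPreadditive D] [Fintype ι] in
theorem IsUniversal.hom_ext {X Z : D} {τ : ∀ U, Z ⊗ U ⟶ U ⊗ X} (h : IsUniversal V τ)
    {B W : D} {f g : B ⟶ W ⊗ Z}
    (hfg : ∀ i, f ▷ V i ≫ (α_ W Z (V i)).hom ≫ W ◁ τ (V i) =
      g ▷ V i ≫ (α_ W Z (V i)).hom ≫ W ◁ τ (V i)) : f = g :=
  (h B W fun i => g ▷ V i ≫ (α_ W Z (V i)).hom ≫ W ◁ τ (V i)).unique hfg fun _ => rfl

/-- The end ∫ U ⊗ X ⊗ U* is realized as the finite sum of the V i ⊗ X ⊗ (V i)*. Tensoring with W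
preserves this sum, which gives the version with parameter W needed to construct the half-braiding.
-/
theorem SemisimpleBasis.exists_isUniversal [HasFiniteBiproducts D] [RightRigidCategory D]
    (hV : SemisimpleBasis k V) (X : D) :
    ∃ (Z : D) (τ : ∀ U, Z ⊗ U ⟶ U ⊗ X),
      (∀ {U U' : D} (t : U ⟶ U'), Z ◁ t ≫ τ U' = τ U ≫ t ▷ X) ∧ IsUniversal V τ := by
  obtain ⟨Z, p, q, hpq, hpq', hqp⟩ : ∃ (Z : D) (p : ∀ i, Z ⟶ (V i ⊗ X) ⊗ (V i)ᘁ)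
      (q : ∀ i, (V i ⊗ X) ⊗ (V i)ᘁ ⟶ Z), (∀ i, q i ≫ p i = 𝟙 _) ∧
      (∀ i j, i ≠ j → q i ≫ p j = 0) ∧ ∑ i, p i ≫ q i = 𝟙 Z :=
    ⟨⨁ fun i => (V i ⊗ X) ⊗ (V i)ᘁ, biproduct.π _, biproduct.ι _, biproduct.ι_π_self _,
      fun i j h => biproduct.ι_π_ne _ h, biproduct.total⟩
  obtain ⟨τ, hτ⟩ := hV.exists_natTrans (tensorLeft Z) (tensorRight X)
    fun i => (tensorRightHomEquiv Z (V i) ((V i)ᘁ) (V i ⊗ X)).symm (p i)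
  refine ⟨Z, fun U => τ.app U, fun t => τ.naturality t, fun B W g => ?_⟩
  -- Since τ at V i is the transpose of p i, the universal property just prescribes the components
  -- of h in the direct sum.
  have key : ∀ (h : B ⟶ W ⊗ Z) (i : ι),
      h ▷ V i ≫ (α_ W Z (V i)).hom ≫ W ◁ τ.app (V i) =
        (tensorRightHomEquiv B (V i) ((V i)ᘁ) (W ⊗ V i ⊗ X)).symm
          (h ≫ W ◁ p i ≫ (α_ W (V i ⊗ X) ((V i)ᘁ)).inv) := by
    intro h i
    rw [hτ]
    simp [tensorRightHomEquiv]
  simp only [key, Equiv.symm_apply_eq]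
  refine ⟨∑ i, (tensorRightHomEquiv B (V i) ((V i)ᘁ) (W ⊗ V i ⊗ X)) (g i) ≫
    (α_ W (V i ⊗ X) ((V i)ᘁ)).hom ≫ W ◁ q i, fun j => ?_, fun h hh => ?_⟩
  · rw [Preadditive.sum_comp, Finset.sum_eq_single j]
    · simp only [Category.assoc, ← MonoidalCategory.whiskerLeft_comp_assoc, hpq]
      simp
    · intro i _ hij
      simp only [Category.assoc, ← MonoidalCategory.whiskerLeft_comp_assoc, hpq' i j hij]
      simp
    · simp
  · simp only [← hh, Category.assoc, Iso.inv_hom_id_assoc, ← MonoidalCategory.whiskerLeft_comp]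
    rw [← Preadditive.comp_sum, ← whiskerLeft_sum, hqp]
    simp

end Universal

/-! ### Half-braidings: invertibility, the unit condition and twisted families -/

section HalfBraidings

variable {D : Type u} [Category.{v} D] [MonoidalCategory D]

/-- In a category with left duals, a lax half-braiding is invertible. -/
theorem isIso_of_laxHalfBraiding [LeftRigidCategory D] {Z : D} (β : ∀ U, Z ⊗ U ⟶ U ⊗ Z)
    (hnat : ∀ {U U' : D} (f : U ⟶ U'), Z ◁ f ≫ β U' = β U ≫ f ▷ Z)
    (hmon : ∀ U U', β (U ⊗ U') = (α_ _ _ _).inv ≫ β U ▷ U' ≫ (α_ _ _ _).hom ≫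
      U ◁ β U' ≫ (α_ _ _ _).inv)
    (hunit : β (𝟙_ D) = (ρ_ Z).hom ≫ (λ_ Z).inv) (W : D) : IsIso (β W) := by
  have hmon' : ∀ U U', β U ▷ U' ⊗≫ U ◁ β U' = 𝟙 _ ⊗≫ β (U ⊗ U') ⊗≫ 𝟙 _ := by
    intro U U'
    rw [hmon]
    monoidal
  -- The inverse is the half-braiding at the left dual, bent around. Multiplicativity merges it with
  -- β W, naturality moves ev or coev across, β is trivial at 𝟙, and a zigzag remains.
  refine ⟨𝟙 _ ⊗≫ (W ⊗ Z) ◁ η_ (ᘁW : D) W ⊗≫ W ◁ β (ᘁW : D) ▷ W ⊗≫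
    ε_ (ᘁW : D) W ▷ (Z ⊗ W) ⊗≫ 𝟙 _, ?_, ?_⟩
  · calc _ = 𝟙 _ ⊗≫ (β W ▷ 𝟙_ D ≫ (W ⊗ Z) ◁ η_ (ᘁW : D) W) ⊗≫ W ◁ β (ᘁW : D) ▷ W ⊗≫
          ε_ (ᘁW : D) W ▷ (Z ⊗ W) ⊗≫ 𝟙 _ := by monoidal
      _ = 𝟙 _ ⊗≫ (Z ⊗ W) ◁ η_ (ᘁW : D) W ⊗≫ (β W ▷ (ᘁW : D) ⊗≫ W ◁ β (ᘁW : D)) ▷ W ⊗≫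
          ε_ (ᘁW : D) W ▷ (Z ⊗ W) ⊗≫ 𝟙 _ := by rw [← whisker_exchange]; monoidal
      _ = 𝟙 _ ⊗≫ (Z ⊗ W) ◁ η_ (ᘁW : D) W ⊗≫ (β (W ⊗ (ᘁW : D)) ≫
          ε_ (ᘁW : D) W ▷ Z) ▷ W ⊗≫ 𝟙 _ := by rw [hmon']; monoidal
      _ = 𝟙 _ ⊗≫ Z ◁ (W ◁ η_ (ᘁW : D) W ⊗≫ ε_ (ᘁW : D) W ▷ W) ⊗≫ 𝟙 _ := by
        rw [← hnat, hunit]; monoidal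
      _ = 𝟙 _ := by rw [ExactPairing.coevaluation_evaluation'']; monoidal
  · calc _ = 𝟙 _ ⊗≫ (W ⊗ Z) ◁ η_ (ᘁW : D) W ⊗≫ W ◁ β (ᘁW : D) ▷ W ⊗≫
          (ε_ (ᘁW : D) W ▷ (Z ⊗ W) ≫ 𝟙_ D ◁ β W) ⊗≫ 𝟙 _ := by monoidal
      _ = 𝟙 _ ⊗≫ (W ⊗ Z) ◁ η_ (ᘁW : D) W ⊗≫ W ◁ (β (ᘁW : D) ▷ W ⊗≫ (ᘁW : D) ◁ β W) ⊗≫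
          ε_ (ᘁW : D) W ▷ (W ⊗ Z) ⊗≫ 𝟙 _ := by rw [← whisker_exchange]; monoidal
      _ = 𝟙 _ ⊗≫ W ◁ (Z ◁ η_ (ᘁW : D) W ≫ β ((ᘁW : D) ⊗ W)) ⊗≫
          ε_ (ᘁW : D) W ▷ (W ⊗ Z) ⊗≫ 𝟙 _ := by rw [hmon']; monoidal
      _ = 𝟙 _ ⊗≫ (W ◁ η_ (ᘁW : D) W ⊗≫ ε_ (ᘁW : D) W ▷ W) ▷ Z ⊗≫ 𝟙 _ := by
        rw [hnat, hunit]; monoidal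
      _ = 𝟙 _ := by rw [ExactPairing.coevaluation_evaluation'']; monoidal

/-- The morphism `B ⊗ U ⟶ U ⊗ B` given by the half-braiding. -/
def hb (B : Center D) (U : D) : B.1 ⊗ U ⟶ U ⊗ B.1 := (B.2.β U).hom

instance (B : Center D) (U : D) : IsIso (hb B U) := inferInstanceAs (IsIso (B.2.β U).hom)

theorem hb_naturality (B : Center D) {U U' : D} (f : U ⟶ U') :
    B.1 ◁ f ≫ hb B U' = hb B U ≫ f ▷ B.1 := B.2.naturality f

theorem hb_naturality_assoc (B : Center D) {U U' Z : D} (f : U ⟶ U') (h : U' ⊗ B.1 ⟶ Z) :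
    B.1 ◁ f ≫ hb B U' ≫ h = hb B U ≫ f ▷ B.1 ≫ h := by
  rw [← Category.assoc, hb_naturality, Category.assoc]

theorem hb_tensor (B : Center D) (U U' : D) : hb B (U ⊗ U') =
    (α_ B.1 U U').inv ≫ hb B U ▷ U' ≫ (α_ U B.1 U').hom ≫ U ◁ hb B U' ≫ (α_ U U' B.1).inv :=
  B.2.monoidal U U'

theorem hb_comm {B B' : Center D} (f : B ⟶ B') (U : D) :
    f.f ▷ U ≫ hb B' U = hb B U ≫ U ◁ f.f := f.comm U

/-- Multiplicativity at 𝟙 ⊗ 𝟙 makes the half-braiding at 𝟙 idempotent up to unitors; being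
invertible, it is trivial. -/
theorem hb_unit (B : Center D) : hb B (𝟙_ D) = (ρ_ B.1).hom ≫ (λ_ B.1).inv := by
  have h : hb B (𝟙_ D) = 𝟙 _ ⊗≫ hb B (𝟙_ D) ▷ 𝟙_ D ⊗≫ 𝟙_ D ◁ hb B (𝟙_ D) ⊗≫ 𝟙 _ := by
    have h1 := hb_naturality B (λ_ (𝟙_ D)).hom
    rw [hb_tensor] at h1
    rw [← cancel_epi (B.1 ◁ (λ_ (𝟙_ D)).hom), h1]
    monoidal
  have h2 : hb B (𝟙_ D) ≫ (λ_ B.1).hom ≫ (ρ_ B.1).inv ≫ hb B (𝟙_ D) = hb B (𝟙_ D) := by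
    conv_rhs => rw [h]
    monoidal
  have h3 : (λ_ B.1).hom ≫ (ρ_ B.1).inv ≫ hb B (𝟙_ D) = 𝟙 _ := by
    rw [← cancel_epi (hb B (𝟙_ D)), h2, Category.comp_id]
  rw [← cancel_epi ((λ_ B.1).hom ≫ (ρ_ B.1).inv), Category.assoc, h3]
  simp

/-- The morphism `B ⊗ U ⟶ U ⊗ B ⟶ U ⊗ X` given by a half-braiding and `f : B ⟶ X`. -/
def twist (B : Center D) {X : D} (f : B.1 ⟶ X) (U : D) : B.1 ⊗ U ⟶ U ⊗ X :=
  hb B U ≫ U ◁ f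

theorem twist_unit (B : Center D) {X : D} (f : B.1 ⟶ X) :
    twist B f (𝟙_ D) = (ρ_ B.1).hom ≫ f ≫ (λ_ X).inv := by
  rw [twist, hb_unit]
  simp

theorem twist_naturality (B : Center D) {X : D} (f : B.1 ⟶ X) {U U' : D} (t : U ⟶ U') :
    B.1 ◁ t ≫ twist B f U' = twist B f U ≫ t ▷ X := by
  rw [twist, twist, hb_naturality_assoc, Category.assoc, whisker_exchange]

theorem twist_naturality_assoc (B : Center D) {X : D} (f : B.1 ⟶ X) {U U' Z : D} (t : U ⟶ U')
    (h : U' ⊗ X ⟶ Z) : B.1 ◁ t ≫ twist B f U' ≫ h = twist B f U ≫ t ▷ X ≫ h := by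
  rw [← Category.assoc, twist_naturality, Category.assoc]

theorem twist_tensor (B : Center D) {X : D} (f : B.1 ⟶ X) (U U' : D) : twist B f (U ⊗ U') =
    (α_ B.1 U U').inv ≫ hb B U ▷ U' ≫ (α_ U B.1 U').hom ≫ U ◁ twist B f U' ≫
      (α_ U U' X).inv := by
  rw [twist, twist, hb_tensor]
  simp

theorem hom_whiskerRight_twist {B B' : Center D} (g : B ⟶ B') {X : D} (f : B'.1 ⟶ X) (U : D) :
    g.f ▷ U ≫ twist B' f U = twist B (g.f ≫ f) U := by
  rw [twist, reassoc_of% (hb_comm g U), twist, MonoidalCategory.whiskerLeft_comp]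

theorem IsUniversal.hom_ext' {ι : Type} {V : ι → D} {X Z : D} {τ : ∀ U, Z ⊗ U ⟶ U ⊗ X}
    (h : IsUniversal V τ)
    {B : D} {f g : B ⟶ Z} (hfg : ∀ i, f ▷ V i ≫ τ (V i) = g ▷ V i ≫ τ (V i)) : f = g := by
  have : f ≫ (λ_ Z).inv = g ≫ (λ_ Z).inv := by
    apply h.hom_ext
    intro i
    have := congrArg (fun t => t ≫ (λ_ _).inv) (hfg i)
    simpa using this
  simpa using this

end HalfBraidings

/-! ### Cofree objects of the center and the right adjoint of the forgetful functor -/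

section Cofree

variable {k : Type w} [Field k] {D : Type u} [Category.{v} D] [Preadditive D] [Linear k D]
  [MonoidalCategory D] [MonoidalPreadditive D] [MonoidalLinear k D]
  {ι : Type} [Fintype ι] {V : ι → D}

omit [MonoidalLinear k D] in
/-- The universal property of a universal family, for natural transformations. -/
theorem IsUniversal.exists_hom (hV : SemisimpleBasis k V) {X Z : D}
    {τ : ∀ U, Z ⊗ U ⟶ U ⊗ X} (hτ : ∀ {U U' : D} (t : U ⟶ U'), Z ◁ t ≫ τ U' = τ U ≫ t ▷ X)
    (h : IsUniversal V τ) {B W : D} (g : ∀ U, B ⊗ U ⟶ W ⊗ U ⊗ X)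
    (hg : ∀ {U U' : D} (t : U ⟶ U'), B ◁ t ≫ g U' = g U ≫ W ◁ t ▷ X) :
    ∃ f : B ⟶ W ⊗ Z, ∀ U, f ▷ U ≫ (α_ W Z U).hom ≫ W ◁ τ U = g U := by
  obtain ⟨f, hf, -⟩ := h B W fun i => g (V i)
  let γ : tensorLeft B ⟶ tensorRight X ⋙ tensorLeft W := { app := g, naturality := fun _ _ => hg }
  let σ : tensorLeft B ⟶ tensorRight X ⋙ tensorLeft W :=
    { app := fun U => f ▷ U ≫ (α_ W Z U).hom ≫ W ◁ τ U
      naturality := fun U U' t => by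
        dsimp
        rw [whisker_exchange_assoc, associator_naturality_right_assoc,
          ← MonoidalCategory.whiskerLeft_comp, hτ]
        simp }
  have : σ = γ := hV.natTrans_ext hf
  exact ⟨f, fun U => congrArg (fun s => s.app U) this⟩

omit [MonoidalLinear k D] in
/-- A universal family comes from a half-braiding. -/
theorem IsUniversal.exists_center [LeftRigidCategory D] (hV : SemisimpleBasis k V) {X Z : D}
    {τ : ∀ U, Z ⊗ U ⟶ U ⊗ X} (hτ : ∀ {U U' : D} (t : U ⟶ U'), Z ◁ t ≫ τ U' = τ U ≫ t ▷ X)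
    (h : IsUniversal V τ) : ∃ (Zc : Center D) (e : Zc.1 ⟶ X), IsUniversal V (twist Zc e) := by
  -- The half-braiding at W is the morphism classified by the family U ↦ τ at W ⊗ U. Its axioms are
  -- then checked after composing with τ.
  have hex : ∀ W : D, ∃ f : Z ⊗ W ⟶ W ⊗ Z, ∀ U, f ▷ U ≫ (α_ W Z U).hom ≫ W ◁ τ U =
      (α_ Z W U).hom ≫ τ (W ⊗ U) ≫ (α_ W U X).hom := fun W =>
    h.exists_hom hV hτ _ fun {U U'} t => by
      rw [associator_naturality_right_assoc, reassoc_of% (hτ (W ◁ t))]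
      simp
  choose β hβ using hex
  have hnat : ∀ {U U' : D} (f : U ⟶ U'), Z ◁ f ≫ β U' = β U ≫ f ▷ Z := by
    intro U U' f
    apply h.hom_ext
    intro i
    simp only [comp_whiskerRight, Category.assoc, hβ]
    rw [associator_naturality_middle_assoc, reassoc_of% hτ, associator_naturality_left_assoc,
      ← whisker_exchange, reassoc_of% (hβ U (V i)), associator_naturality_left]
  have hunit : β (𝟙_ D) = (ρ_ Z).hom ≫ (λ_ Z).inv := by
    apply h.hom_ext
    intro i
    have := hτ (λ_ (V i)).inv
    rw [hβ]
    calc _ = 𝟙 _ ⊗≫ Z ◁ (λ_ (V i)).hom ≫ (Z ◁ (λ_ (V i)).inv ≫ τ (𝟙_ D ⊗ V i)) ⊗≫ 𝟙 _ := by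
          monoidal
      _ = _ := by rw [hτ]; monoidal
  have hmon : ∀ U U', β (U ⊗ U') = (α_ _ _ _).inv ≫ β U ▷ U' ≫ (α_ _ _ _).hom ≫
      U ◁ β U' ≫ (α_ _ _ _).inv := by
    intro U U'
    apply h.hom_ext
    intro i
    rw [hβ]
    symm
    calc _ = 𝟙 _ ⊗≫ β U ▷ U' ▷ V i ⊗≫ U ◁ (β U' ▷ V i ≫ (α_ U' Z (V i)).hom ≫
          U' ◁ τ (V i)) ⊗≫ 𝟙 _ := by monoidal
      _ = 𝟙 _ ⊗≫ (β U ▷ (U' ⊗ V i) ≫ (α_ U Z (U' ⊗ V i)).hom ≫ U ◁ τ (U' ⊗ V i)) ⊗≫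
          𝟙 _ := by
        rw [hβ]; monoidal
      _ = 𝟙 _ ⊗≫ (Z ◁ (α_ U U' (V i)).hom ≫ τ (U ⊗ U' ⊗ V i)) ⊗≫ 𝟙 _ := by
        rw [hβ]; monoidal
      _ = _ := by rw [hτ]; monoidal
  have hiso := isIso_of_laxHalfBraiding β hnat hmon hunit
  -- The counit is τ at the unit object; specializing the defining equation of β to U ⊗ 𝟙 recovers τ
  -- from it.
  refine ⟨⟨Z, { β := fun U => asIso (β U), monoidal := hmon, naturality := hnat }⟩,
    (ρ_ Z).inv ≫ τ (𝟙_ D) ≫ (λ_ X).hom, ?_⟩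
  convert h using 1
  funext U
  have := hβ U (𝟙_ D)
  change β U ≫ U ◁ _ = _
  calc _ = 𝟙 _ ⊗≫ (β U ▷ 𝟙_ D ≫ (α_ U Z (𝟙_ D)).hom ≫ U ◁ τ (𝟙_ D)) ⊗≫ 𝟙 _ := by monoidal
    _ = 𝟙 _ ⊗≫ (Z ◁ (ρ_ U).inv ≫ τ (U ⊗ 𝟙_ D)) ⊗≫ 𝟙 _ := by rw [hβ]; monoidal
    _ = _ := by rw [hτ]; monoidal

omit [MonoidalLinear k D] in
/-- Universality implies the universal property of the cofree object of the center. -/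
theorem IsUniversal.existsUnique_center_hom (hV : SemisimpleBasis k V) {X : D} {Z : Center D}
    {e : Z.1 ⟶ X} (h : IsUniversal V (twist Z e)) (B : Center D) (f : B.1 ⟶ X) :
    ∃! g : B ⟶ Z, g.f ≫ e = f := by
  obtain ⟨g, hg⟩ := h.exists_hom hV (twist_naturality Z e) (B := B.1) (W := 𝟙_ D)
    (fun U => twist B f U ≫ (λ_ _).inv) fun {U U'} t => by
      rw [twist_naturality_assoc]
      simp
  obtain ⟨g, rfl⟩ : ∃ g', g = g' ≫ (λ_ Z.1).inv := ⟨g ≫ (λ_ _).hom, by simp⟩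
  have hg' : ∀ U, g ▷ U ≫ twist Z e U = twist B f U := by
    intro U
    have := hg U
    rw [← cancel_mono (λ_ (U ⊗ X)).inv, ← this]
    monoidal
  have hcomm : ∀ U, g ▷ U ≫ hb Z U = hb B U ≫ U ◁ g := by
    intro U
    apply h.hom_ext
    intro i
    calc _ = 𝟙 _ ⊗≫ (g ▷ (U ⊗ V i) ≫ ((α_ Z.1 U (V i)).inv ≫ hb Z U ▷ V i ≫
          (α_ U Z.1 (V i)).hom ≫ U ◁ twist Z e (V i) ≫ (α_ U (V i) X).inv)) ⊗≫ 𝟙 _ := by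
          monoidal
      _ = 𝟙 _ ⊗≫ ((α_ B.1 U (V i)).inv ≫ hb B U ▷ V i ≫
          (α_ U B.1 (V i)).hom ≫ U ◁ twist B f (V i) ≫ (α_ U (V i) X).inv) ⊗≫ 𝟙 _ := by
          rw [← twist_tensor, hg', twist_tensor]
      _ = _ := by
          rw [← hg']
          monoidal
  refine ⟨⟨g, hcomm⟩, ?_, fun g' hg'' => ?_⟩
  · have := hg' (𝟙_ D)
    rwa [twist_unit, twist_unit, rightUnitor_naturality_assoc, cancel_epi, ← Category.assoc,
      cancel_mono] at this
  · ext
    apply h.hom_ext'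
    intro i
    rw [hg', hom_whiskerRight_twist, hg'']

omit [Preadditive D] [MonoidalPreadditive D] [Fintype ι] in
theorem IsUniversal.of_iso {X Z Z' : D} {τ : ∀ U, Z ⊗ U ⟶ U ⊗ X} (h : IsUniversal V τ)
    (φ : Z' ≅ Z) {τ' : ∀ U, Z' ⊗ U ⟶ U ⊗ X} (hτ : ∀ U, τ' U = φ.hom ▷ U ≫ τ U) :
    IsUniversal V τ' := by
  have key : ∀ {B W : D} (f : B ⟶ W ⊗ Z') (i : ι), f ▷ V i ≫ (α_ W Z' (V i)).hom ≫ W ◁ τ' (V i) =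
      (f ≫ W ◁ φ.hom) ▷ V i ≫ (α_ W Z (V i)).hom ≫ W ◁ τ (V i) := by
    intro B W f i
    rw [hτ]
    simp
  intro B W g
  obtain ⟨f, hf, hf'⟩ := h B W g
  refine ⟨f ≫ W ◁ φ.inv, fun i => ?_, fun f' hf'' => ?_⟩
  · rw [key, Category.assoc, ← MonoidalCategory.whiskerLeft_comp, Iso.inv_hom_id]
    simpa using hf i
  · rw [← hf' (f' ≫ W ◁ φ.hom) fun i => by rw [← key, hf'' i], Category.assoc,
      ← MonoidalCategory.whiskerLeft_comp, Iso.hom_inv_id]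
    simp

theorem SemisimpleBasis.exists_cofree [HasFiniteBiproducts D] [RigidCategory D]
    (hV : SemisimpleBasis k V) (X : D) :
    ∃ (Z : Center D) (e : Z.1 ⟶ X), IsUniversal V (twist Z e) := by
  obtain ⟨Z, τ, hτ, h⟩ := hV.exists_isUniversal X
  exact h.exists_center hV hτ

/-- The cofree object on X is terminal among objects of the center with a morphism from their
underlying object to X. -/
theorem SemisimpleBasis.isLeftAdjoint_forget [HasFiniteBiproducts D] [RigidCategory D]
    (hV : SemisimpleBasis k V) : (Center.forget D).IsLeftAdjoint := by
  have : ∀ X : D, HasTerminal (CostructuredArrow (Center.forget D) X) := by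
    intro X
    obtain ⟨Z, e, h⟩ := hV.exists_cofree X
    have hu := h.existsUnique_center_hom hV
    refine IsTerminal.hasTerminal (X := CostructuredArrow.mk (S := Center.forget D) (Y := Z) e)
      (IsTerminal.ofUniqueHom (fun B => CostructuredArrow.homMk (hu B.left B.hom).choose
        (hu B.left B.hom).choose_spec.1) fun B g => ?_)
    ext
    exact congrArg Center.Hom.f ((hu B.left B.hom).choose_spec.2 g.left (CostructuredArrow.w g))
  exact isLeftAdjoint_of_costructuredArrowTerminals _

/-- The half-braiding of `R(X)` and the counit give a universal family. -/
theorem SemisimpleBasis.isUniversal_counit [HasFiniteBiproducts D] [RigidCategory D]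
    (hV : SemisimpleBasis k V) {R : D ⥤ Center D} (adj : Center.forget D ⊣ R) (X : D) :
    IsUniversal V (twist (R.obj X) (adj.counit.app X)) := by
  obtain ⟨Z, e, h⟩ := hV.exists_cofree X
  have hu := h.existsUnique_center_hom hV
  -- For an arbitrary right adjoint R, both R(X) and the constructed Z are cofree on X, so they are
  -- isomorphic and universality is transported.
  obtain ⟨a, ha, -⟩ := hu (R.obj X) (adj.counit.app X)
  have hb : (adj.homEquiv Z X e).f ≫ adj.counit.app X = e :=
    (adj.homEquiv_counit (g := adj.homEquiv Z X e)).symm.trans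
      ((adj.homEquiv Z X).symm_apply_apply e)
  have hab : a ≫ adj.homEquiv Z X e = 𝟙 _ := by
    apply (adj.homEquiv (R.obj X) X).symm.injective
    rw [adj.homEquiv_counit, adj.homEquiv_counit]
    change (a.f ≫ (adj.homEquiv Z X e).f) ≫ adj.counit.app X = 𝟙 _ ≫ adj.counit.app X
    exact (Category.assoc a.f _ _).trans ((congrArg (a.f ≫ ·) hb).trans
      (ha.trans (Category.id_comp _).symm))
  have hba : adj.homEquiv Z X e ≫ a = 𝟙 _ := by
    apply (hu Z e).unique
    · rw [Center.comp_f, Category.assoc, ha, hb]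
    · simp
  let φ : (R.obj X).1 ≅ Z.1 := ⟨a.f, (adj.homEquiv Z X e).f, congrArg Center.Hom.f hab,
    congrArg Center.Hom.f hba⟩
  refine h.of_iso φ fun U => ?_
  rw [← ha]
  exact (hom_whiskerRight_twist a e U).symm

end Cofree

/-! ### The adjoint algebra -/

section AdjointAlgebra

variable {D : Type u} [Category.{v} D] [MonoidalCategory D] {R : D ⥤ Center D}
  (adj : Center.forget D ⊣ R)

theorem action_eq_twist (X : D) :
    action adj X = twist (centralAlg adj) (counit adj) X ≫ (ρ_ X).hom := by
  rw [twist, Category.assoc]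
  rfl

theorem action_naturality {X Y : D} (f : X ⟶ Y) :
    adjAlg adj ◁ f ≫ action adj Y = action adj X ≫ f := by
  rw [action_eq_twist, action_eq_twist, twist_naturality_assoc, rightUnitor_naturality,
    Category.assoc]

theorem action_naturality_assoc {X Y Z : D} (f : X ⟶ Y) (h : Y ⟶ Z) :
    adjAlg adj ◁ f ≫ action adj Y ≫ h = action adj X ≫ f ≫ h := by
  rw [← Category.assoc, action_naturality, Category.assoc]

theorem action_tensor (X Y : D) : action adj (X ⊗ Y) =
    (α_ (adjAlg adj) X Y).inv ≫ hb (centralAlg adj) X ▷ Y ≫ (α_ X (adjAlg adj) Y).hom ≫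
      X ◁ action adj Y := by
  rw [action_eq_twist, action_eq_twist, twist_tensor]
  simp

theorem action_unit : action adj (𝟙_ D) = (ρ_ (adjAlg adj)).hom ≫ counit adj := by
  rw [action_eq_twist, twist_unit]
  simp [unitors_inv_equal]

theorem center_homEquiv_counit (B : Center D) (X : D) (f : B.1 ⟶ X) :
    (adj.homEquiv B X f).f ≫ adj.counit.app X = f :=
  (adj.homEquiv_counit (g := adj.homEquiv B X f)).symm.trans
    ((adj.homEquiv B X).symm_apply_apply f)

theorem toEnd_counit (f : CF adj) : (toEnd adj f).f ≫ counit adj = f :=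
  center_homEquiv_counit adj (centralAlg adj) (𝟙_ D) f

theorem hom_whiskerRight_action {B : Center D} (f : B ⟶ centralAlg adj) (X : D) :
    f.f ▷ X ≫ action adj X = twist B (f.f ≫ counit adj) X ≫ (ρ_ X).hom := by
  rw [action_eq_twist, ← Category.assoc, hom_whiskerRight_twist]

theorem toEnd_action (f : CF adj) (X : D) :
    (toEnd adj f).f ▷ X ≫ action adj X = twist (centralAlg adj) f X ≫ (ρ_ X).hom := by
  rw [hom_whiskerRight_action, toEnd_counit]

theorem algUnit_counit : algUnit adj ≫ counit adj = 𝟙 (𝟙_ D) :=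
  center_homEquiv_counit adj (𝟙_ (Center D)) (𝟙_ D) (𝟙 (𝟙_ D))

theorem algUnit_action (X : D) : algUnit adj ▷ X ≫ action adj X = (λ_ X).hom := by
  refine (hom_whiskerRight_action adj
    (adj.homEquiv (𝟙_ (Center D)) (𝟙_ D) (𝟙 (𝟙_ D))) X).trans ?_
  have h : (adj.homEquiv (𝟙_ (Center D)) (𝟙_ D) (𝟙 (𝟙_ D))).f ≫ counit adj = 𝟙 (𝟙_ D) :=
    algUnit_counit adj
  rw [h]
  change (((λ_ X).hom ≫ (ρ_ X).inv) ≫ X ◁ 𝟙 (𝟙_ D)) ≫ (ρ_ X).hom = (λ_ X).hom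
  simp

/-- With `algUnit_action`, this makes every object an A-module. The half-braiding of R(𝟙) ⊗ R(𝟙) is
composed of two half-braidings, and the interchange law lets each counit act right after its own. -/
theorem algMul_action (X : D) : algMul adj ▷ X ≫ action adj X =
    (α_ _ _ _).hom ≫ adjAlg adj ◁ action adj X ≫ action adj X := by
  refine (hom_whiskerRight_action adj (adj.homEquiv (centralAlg adj ⊗ centralAlg adj) (𝟙_ D)
    ((counit adj ⊗ₘ counit adj) ≫ (λ_ (𝟙_ D)).hom)) X).trans ?_
  have h : (adj.homEquiv (centralAlg adj ⊗ centralAlg adj) (𝟙_ D)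
      ((counit adj ⊗ₘ counit adj) ≫ (λ_ (𝟙_ D)).hom)).f ≫ counit adj =
      (counit adj ⊗ₘ counit adj) ≫ (λ_ (𝟙_ D)).hom :=
    center_homEquiv_counit adj _ _ _
  rw [h]
  change (((α_ _ _ _).hom ≫ adjAlg adj ◁ hb (centralAlg adj) X ≫ (α_ _ _ _).inv ≫
    hb (centralAlg adj) X ▷ adjAlg adj ≫ (α_ _ _ _).hom) ≫
    X ◁ ((counit adj ⊗ₘ counit adj) ≫ (λ_ (𝟙_ D)).hom)) ≫ (ρ_ X).hom = _
  rw [action_eq_twist, twist, tensorHom_def']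
  calc _ = 𝟙 _ ⊗≫ adjAlg adj ◁ hb (centralAlg adj) X ⊗≫ (hb (centralAlg adj) X ▷ adjAlg adj ≫
        (X ⊗ adjAlg adj) ◁ counit adj) ⊗≫ X ◁ counit adj ⊗≫ 𝟙 _ := by monoidal
    _ = 𝟙 _ ⊗≫ adjAlg adj ◁ hb (centralAlg adj) X ⊗≫ ((adjAlg adj ⊗ X) ◁ counit adj ≫
        hb (centralAlg adj) X ▷ 𝟙_ D) ⊗≫ X ◁ counit adj ⊗≫ 𝟙 _ := by
      rw [whisker_exchange]
    _ = 𝟙 _ ⊗≫ adjAlg adj ◁ hb (centralAlg adj) X ⊗≫ adjAlg adj ◁ X ◁ counit adj ⊗≫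
        hb (centralAlg adj) X ⊗≫ X ◁ counit adj ⊗≫ 𝟙 _ := by
      monoidal
    _ = _ := by monoidal

theorem psi_app (a : CE adj) (X : D) :
    (psi adj a).app X = (λ_ X).inv ≫ a ▷ X ≫ action adj X := rfl

section Universality

variable {ι : Type} {V : ι → D}

/-- Together with `exists_hom_adjAlg`: morphisms B ⟶ A are the same as families B ⊗ V i ⟶ V i. This
is the end property of A in terms of actions. -/
theorem adjAlg_hom_ext (hU : IsUniversal V (twist (centralAlg adj) (counit adj))) {B : D}
    {f g : B ⟶ adjAlg adj} (h : ∀ i, f ▷ V i ≫ action adj (V i) = g ▷ V i ≫ action adj (V i)) :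
    f = g := by
  apply hU.hom_ext'
  intro i
  have := h i
  rwa [action_eq_twist, ← Category.assoc, ← Category.assoc, cancel_mono] at this

theorem exists_hom_adjAlg (hU : IsUniversal V (twist (centralAlg adj) (counit adj))) {B : D}
    (g : ∀ i, B ⊗ V i ⟶ V i) : ∃ f : B ⟶ adjAlg adj, ∀ i, f ▷ V i ≫ action adj (V i) = g i := by
  obtain ⟨f, hf, -⟩ := hU B (𝟙_ D) fun i => g i ≫ (ρ_ _).inv ≫ (λ_ _).inv
  refine ⟨f ≫ (λ_ _).hom, fun i => ?_⟩
  rw [← cancel_mono ((ρ_ (V i)).inv ≫ (λ_ (V i ⊗ 𝟙_ D)).inv), ← hf i, action_eq_twist]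
  monoidal

/-- Cointegrals are the class functions which are morphisms of the center. -/
theorem isCointegral_iff (hU : IsUniversal V (twist (centralAlg adj) (counit adj))) (l : CF adj) :
    IsCointegral adj l ↔
      ∀ X, twist (centralAlg adj) l X ≫ (ρ_ X).hom = l ▷ X ≫ (λ_ X).hom := by
  constructor
  · intro h X
    rw [← toEnd_action, h, comp_whiskerRight, Category.assoc, algUnit_action]
  · intro h
    apply adjAlg_hom_ext adj hU
    intro i
    rw [toEnd_action, h, comp_whiskerRight, Category.assoc, algUnit_action]

end Universality

theorem mate_eq [RightRigidCategory D] {B X : D} (r : B ⊗ X ⟶ X) :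
    mate r = tensorRightHomEquiv B X Xᘁ X r := rfl

theorem comp_mate [RightRigidCategory D] {B B' X : D} (f : B' ⟶ B) (r : B ⊗ X ⟶ X) :
    f ≫ mate r = mate (f ▷ X ≫ r) := by
  rw [mate, mate, comp_whiskerRight, rightUnitor_inv_naturality_assoc, ← whisker_exchange_assoc,
    associator_inv_naturality_left_assoc]

theorem mate_injective [RightRigidCategory D] {B X : D} {r r' : B ⊗ X ⟶ X}
    (h : mate r = mate r') : r = r' :=
  (tensorRightHomEquiv B X Xᘁ X).injective h

theorem mate_comp [RightRigidCategory D] {B X : D} (r : B ⊗ X ⟶ X) (f : X ⟶ X) :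
    mate (r ≫ f) = mate r ≫ f ▷ Xᘁ := by
  simp [mate]

end AdjointAlgebra

section Preadditive

variable {D : Type u} [Category.{v} D] [Preadditive D] [MonoidalCategory D]
  [MonoidalPreadditive D]

theorem mate_sum [RightRigidCategory D] {B X : D} {J : Type*} (s : Finset J)
    (r : J → (B ⊗ X ⟶ X)) : mate (∑ j ∈ s, r j) = ∑ j ∈ s, mate (r j) := by
  simp only [mate, sum_whiskerRight, Preadditive.comp_sum]

theorem mate_zero [RightRigidCategory D] (B X : D) : mate (0 : B ⊗ X ⟶ X) = 0 := by
  simp [mate]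

variable {k : Type w} [Field k] [Linear k D] [MonoidalLinear k D] {ι : Type} [Fintype ι]
  {V : ι → D} {R : D ⥤ Center D} (adj : Center.forget D ⊣ R)

omit [MonoidalPreadditive D] [MonoidalLinear k D] in
theorem psi_bijective (hV : SemisimpleBasis k V)
    (hU : IsUniversal V (twist (centralAlg adj) (counit adj))) :
    Function.Bijective (psi adj) := by
  constructor
  · intro a b hab
    apply adjAlg_hom_ext adj hU
    intro i
    have := congrArg (fun t => t.app (V i)) hab
    simpa only [psi_app, cancel_epi] using this
  · intro ξ
    obtain ⟨a, ha⟩ := exists_hom_adjAlg adj hU fun i => (λ_ (V i)).hom ≫ ξ.app (V i)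
    refine ⟨a, hV.natTrans_ext fun i => ?_⟩
    rw [psi_app, ha, Iso.inv_hom_id_assoc]

omit [Fintype ι] in
-- In terms of actions, E_i acts as the identity on V i and as zero on the other simple objects.
theorem existsUnique_centralIdempotent [RigidCategory D]
    (hU : IsUniversal V (twist (centralAlg adj) (counit adj))) (i : ι) :
    ∃! e, IsCentralIdempotent adj V i e := by
  classical
  have key : ∀ e : CE adj, IsCentralIdempotent adj V i e ↔
      ∀ j, e ▷ V j ≫ action adj (V j) = if j = i then (λ_ (V j)).hom else 0 := by
    intro e
    have h1 : η_ (V i) ((V i)ᘁ) = mate (λ_ (V i)).hom := by simp [mate, unitors_equal]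
    simp only [IsCentralIdempotent, proj, comp_mate]
    constructor
    · rintro ⟨h2, h3⟩ j
      split_ifs with h
      · subst h
        exact mate_injective (h2.trans h1)
      · exact mate_injective ((h3 j h).trans (mate_zero _ _).symm)
    · intro h
      refine ⟨by rw [h, if_pos rfl, h1], fun j hj => by rw [h, if_neg hj, mate_zero]⟩
  obtain ⟨e, he⟩ := exists_hom_adjAlg adj hU (B := 𝟙_ D)
    fun j => if j = i then (λ_ (V j)).hom else 0
  refine ⟨e, (key e).2 he, fun e' he' => adjAlg_hom_ext adj hU fun j => ?_⟩
  rw [he, (key e').1 he']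

omit [MonoidalPreadditive D] in
/-- The adjoint algebra is the direct sum of the objects `V i ⊗ (V i)*`, with projections
`proj adj (V i)`. -/
theorem exists_proj_splitting [RightRigidCategory D]
    (hU : IsUniversal V (twist (centralAlg adj) (counit adj))) :
    ∃ s : ∀ i, V i ⊗ (V i)ᘁ ⟶ adjAlg adj,
      (∀ i, s i ≫ mate (action adj (V i)) = 𝟙 _) ∧
      (∀ i j, i ≠ j → s i ≫ mate (action adj (V j)) = 0) ∧
      ∑ i, mate (action adj (V i)) ≫ s i = 𝟙 _ := by
  classical
  have hex : ∀ i, ∃ f : V i ⊗ (V i)ᘁ ⟶ adjAlg adj, ∀ j, f ▷ V j ≫ action adj (V j) =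
      (tensorRightHomEquiv _ (V j) ((V j)ᘁ) _).symm
        (if h : i = j then eqToHom (by rw [h]) else 0) := fun i =>
    exists_hom_adjAlg adj hU _
  choose s hs using hex
  have h1 : ∀ i, s i ≫ mate (action adj (V i)) = 𝟙 _ := by
    intro i
    rw [comp_mate, hs, mate_eq, Equiv.apply_symm_apply, dif_pos rfl, eqToHom_refl]
  have h2 : ∀ i j, i ≠ j → s i ≫ mate (action adj (V j)) = 0 := by
    intro i j hij
    rw [comp_mate, hs, mate_eq, Equiv.apply_symm_apply, dif_neg hij]
  refine ⟨s, h1, h2, adjAlg_hom_ext adj hU fun j => mate_injective ?_⟩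
  rw [← comp_mate, ← comp_mate, Preadditive.sum_comp, Finset.sum_eq_single j]
  · rw [Category.assoc, h1, Category.comp_id, Category.id_comp]
  · intro i _ hij
    rw [Category.assoc, h2 i j hij, comp_zero]
  · simp

end Preadditive

/-! ### Averaging of morphisms along a cointegral -/

section Average

variable {k : Type w} [Field k] {D : Type u} [Category.{v} D] [Preadditive D] [Linear k D]
  [MonoidalCategory D] [MonoidalPreadditive D] [MonoidalLinear k D] [HasFiniteBiproducts D]
  [RigidCategory D] {ι : Type} [Fintype ι] {V : ι → D}
  {R : D ⥤ Center D} (adj : Center.forget D ⊣ R)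

/-- The comparison morphism `Y ⊗ R(𝟙) ⟶ R(Y)`. -/
noncomputable def projectionMap {D : Type u} [Category.{v} D] [MonoidalCategory D]
    {R : D ⥤ Center D}
    (adj : Center.forget D ⊣ R) (Y : Center D) : Y ⊗ centralAlg adj ⟶ R.obj Y.1 :=
  adj.homEquiv (Y ⊗ centralAlg adj) Y.1 (Y.1 ◁ counit adj ≫ (ρ_ Y.1).hom)

theorem projectionMap_twist {D : Type u} [Category.{v} D] [MonoidalCategory D]
    {R : D ⥤ Center D} (adj : Center.forget D ⊣ R) (Y : Center D) (U : D) :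
    (projectionMap adj Y).f ▷ U ≫ twist (R.obj Y.1) (adj.counit.app Y.1) U =
      (α_ Y.1 (adjAlg adj) U).hom ≫ Y.1 ◁ action adj U ≫ hb Y U := by
  refine (hom_whiskerRight_twist (projectionMap adj Y) (adj.counit.app Y.1) U).trans ?_
  have h : (projectionMap adj Y).f ≫ adj.counit.app Y.1 = Y.1 ◁ counit adj ≫ (ρ_ Y.1).hom :=
    center_homEquiv_counit adj _ _ _
  refine (congrArg (fun t => twist (Y ⊗ centralAlg adj) t U) h).trans ?_
  change ((α_ _ _ _).hom ≫ Y.1 ◁ hb (centralAlg adj) U ≫ (α_ _ _ _).inv ≫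
    hb Y U ▷ adjAlg adj ≫ (α_ _ _ _).hom) ≫ U ◁ (Y.1 ◁ counit adj ≫ (ρ_ Y.1).hom) = _
  rw [action_eq_twist, twist]
  calc _ = 𝟙 _ ⊗≫ Y.1 ◁ hb (centralAlg adj) U ⊗≫ (hb Y U ▷ adjAlg adj ≫
        (U ⊗ Y.1) ◁ counit adj) ⊗≫ 𝟙 _ := by monoidal
    _ = 𝟙 _ ⊗≫ Y.1 ◁ hb (centralAlg adj) U ⊗≫ ((Y.1 ⊗ U) ◁ counit adj ≫
        hb Y U ▷ 𝟙_ D) ⊗≫ 𝟙 _ := by rw [whisker_exchange]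
    _ = _ := by monoidal

/-- Projection formula. Maps into Y ⊗ A are families B ⊗ V i ⟶ Y ⊗ V i, maps into R(Y) are families
B ⊗ V i ⟶ V i ⊗ Y, and the invertible half-braiding of Y exchanges the two. -/
theorem isIso_projectionMap (hV : SemisimpleBasis k V) (Y : Center D) :
    IsIso (projectionMap adj Y) := by
  have hU := hV.isUniversal_counit adj (𝟙_ D)
  have hU' := hV.isUniversal_counit adj Y.1
  obtain ⟨K, hK, hiso⟩ : ∃ K : Y.1 ⊗ adjAlg adj ⟶ (R.obj Y.1).1,
      (∀ U, K ▷ U ≫ twist (R.obj Y.1) (adj.counit.app Y.1) U =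
        (α_ Y.1 (adjAlg adj) U).hom ≫ Y.1 ◁ action adj U ≫ hb Y U) ∧
      (IsIso K → IsIso (projectionMap adj Y)) :=
    ⟨(projectionMap adj Y).f, projectionMap_twist adj Y, fun h =>
      @Center.isIso_of_f_isIso D _ _ _ _ (projectionMap adj Y) h⟩
  have key : ∀ {B : D} (h : B ⟶ Y.1 ⊗ adjAlg adj) (U : D),
      (h ≫ K) ▷ U ≫ twist (R.obj Y.1) (adj.counit.app Y.1) U =
      (h ▷ U ≫ (α_ Y.1 (adjAlg adj) U).hom ≫ Y.1 ◁ action adj U) ≫ hb Y U := by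
    intro B h U
    rw [comp_whiskerRight, Category.assoc, hK]
    simp only [Category.assoc]
  have htw : ∀ {B : D} (h : B ⟶ Y.1 ⊗ adjAlg adj) (U : D), h ▷ U ≫
      (α_ Y.1 (adjAlg adj) U).hom ≫ Y.1 ◁ twist (centralAlg adj) (counit adj) U =
      (h ▷ U ≫ (α_ Y.1 (adjAlg adj) U).hom ≫ Y.1 ◁ action adj U) ≫ Y.1 ◁ (ρ_ U).inv := by
    intro B h U
    rw [action_eq_twist]
    simp
  have hmono : Mono K := by
    refine ⟨fun {B} h h' e => hU.hom_ext fun i => ?_⟩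
    have e' := congrArg (fun t => t ▷ V i ≫ twist (R.obj Y.1) (adj.counit.app Y.1) (V i)) e
    have e'' := (key h (V i)).symm.trans (e'.trans (key h' (V i)))
    rw [cancel_mono] at e''
    refine (htw h (V i)).trans (Eq.trans ?_ (htw h' (V i)).symm)
    rw [e'']
  obtain ⟨s, hs, -⟩ := hU (R.obj Y.1).1 Y.1 fun i =>
    (twist (R.obj Y.1) (adj.counit.app Y.1) (V i) ≫ inv (hb Y (V i))) ≫ Y.1 ◁ (ρ_ (V i)).inv
  have hs' : s ≫ K = 𝟙 _ := by
    apply hU'.hom_ext'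
    intro i
    have h2 := (htw s (V i)).symm.trans (hs i)
    rw [cancel_mono] at h2
    rw [key s (V i), h2, Category.assoc, IsIso.inv_hom_id, Category.comp_id, id_whiskerRight,
      Category.id_comp]
  apply hiso
  have : IsSplitEpi K := IsSplitEpi.mk' ⟨s, hs'⟩
  exact isIso_of_mono_of_isSplitEpi _

/-- A cointegral as a morphism of the center. -/
theorem IsCointegral.exists_center_hom (hV : SemisimpleBasis k V) {l : CF adj}
    (hl : IsCointegral adj l) : ∃ l' : centralAlg adj ⟶ 𝟙_ (Center D), l'.f = l := by
  have h := (isCointegral_iff adj (hV.isUniversal_counit adj (𝟙_ D)) l).1 hl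
  refine ⟨⟨l, fun U => ?_⟩, rfl⟩
  have h' := h U
  change l ▷ U ≫ (λ_ U).hom ≫ (ρ_ U).inv = hb (centralAlg adj) U ≫ U ◁ l
  rw [← Category.assoc, ← h', Category.assoc, Iso.hom_inv_id, Category.comp_id]
  rfl

/-- Averaging along a normalized cointegral turns morphisms of `D` into morphisms of the center,
and is the identity on the latter. -/
theorem IsNormalizedCointegral.exists_average (hV : SemisimpleBasis k V) {l : CF adj}
    (hl : IsNormalizedCointegral adj l) :
    ∃ avg : ∀ {X Y : Center D}, (X.1 ⟶ Y.1) → (X ⟶ Y),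
      (∀ {X X' Y : Center D} (a : X' ⟶ X) (f : X.1 ⟶ Y.1), avg (a.f ≫ f) = a ≫ avg f) ∧
      (∀ {X Y Y' : Center D} (f : X.1 ⟶ Y.1) (b : Y ⟶ Y'), avg (f ≫ b.f) = avg f ≫ b) ∧
      ∀ Y : Center D, avg (𝟙 Y.1) = 𝟙 Y := by
  obtain ⟨l', hl'⟩ := hl.1.exists_center_hom adj hV
  have hiso : ∀ Y, IsIso (projectionMap adj Y) := isIso_projectionMap adj hV
  -- The average of f is X ⟶ R(Y) ≅ Y ⊗ R(𝟙) ⟶ Y: adjunction, projection formula, then the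
  -- cointegral.
  refine ⟨fun {X Y} f => adj.homEquiv X Y.1 f ≫ inv (projectionMap adj Y) ≫ Y ◁ l' ≫ (ρ_ Y).hom,
    fun {X X' Y} a f => ?_, fun {X Y Y'} f b => ?_, fun Y => ?_⟩
  · have h1 : adj.homEquiv X' Y.1 (a.f ≫ f) = a ≫ adj.homEquiv X Y.1 f :=
      adj.homEquiv_naturality_left a f
    exact (congrArg (· ≫ _) h1).trans (Category.assoc _ _ _)
  · have h1 : adj.homEquiv X Y'.1 (f ≫ b.f) = adj.homEquiv X Y.1 f ≫ R.map b.f :=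
      adj.homEquiv_naturality_right f b.f
    have h2 : projectionMap adj Y ≫ R.map b.f = b ▷ centralAlg adj ≫ projectionMap adj Y' := by
      refine (adj.homEquiv_naturality_right _ b.f).symm.trans ?_
      refine Eq.trans ?_ (adj.homEquiv_naturality_left (b ▷ centralAlg adj) _)
      congr 1
      change (Y.1 ◁ counit adj ≫ (ρ_ Y.1).hom) ≫ b.f =
        b.f ▷ adjAlg adj ≫ Y'.1 ◁ counit adj ≫ (ρ_ Y'.1).hom
      rw [← whisker_exchange_assoc, rightUnitor_naturality, Category.assoc]
    have h3 : R.map b.f ≫ inv (projectionMap adj Y') =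
        inv (projectionMap adj Y) ≫ b ▷ centralAlg adj := by
      rw [IsIso.comp_inv_eq, Category.assoc, ← h2, IsIso.inv_hom_id_assoc]
    refine (congrArg (· ≫ _) h1).trans ?_
    simp only [Category.assoc]
    rw [reassoc_of% h3, ← whisker_exchange_assoc, rightUnitor_naturality]
  -- Under the projection formula the unit Y ⟶ R(Y) becomes Y ⊗ u, so the normalization of the
  -- cointegral gives the identity.
  · let u' : 𝟙_ (Center D) ⟶ centralAlg adj := adj.homEquiv (𝟙_ (Center D)) (𝟙_ D) (𝟙 (𝟙_ D))
    have hu' : u'.f = algUnit adj := rfl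
    have h1 : adj.homEquiv Y Y.1 (𝟙 Y.1) = (ρ_ Y).inv ≫ Y ◁ u' ≫ projectionMap adj Y := by
      rw [← Category.assoc]
      refine Eq.trans ?_ (adj.homEquiv_naturality_left ((ρ_ Y).inv ≫ Y ◁ u') _)
      congr 1
      have h2 : ((ρ_ Y.1).inv ≫ Y.1 ◁ algUnit adj) ≫ Y.1 ◁ counit adj ≫ (ρ_ Y.1).hom =
          𝟙 Y.1 := by
        rw [Category.assoc, ← MonoidalCategory.whiskerLeft_comp_assoc, algUnit_counit]
        simp
      have h3 : ((ρ_ Y).inv ≫ Y ◁ u').f = (ρ_ Y.1).inv ≫ Y.1 ◁ algUnit adj := by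
        rw [Center.comp_f, Center.rightUnitor_inv_f]
        rfl
      exact (h2.symm.trans (congrArg (· ≫ _) h3.symm))
    have h4 : u' ≫ l' = 𝟙 _ := by
      ext
      rw [Center.comp_f, hl', hu']
      exact hl.2
    refine (congrArg (· ≫ _) h1).trans ?_
    simp only [Category.assoc, IsIso.hom_inv_id_assoc]
    rw [← MonoidalCategory.whiskerLeft_comp_assoc, h4]
    simp

omit [MonoidalCategory D] [MonoidalPreadditive D] [MonoidalLinear k D] [HasFiniteBiproducts D]
  [RigidCategory D] in
theorem SemisimpleBasis.exists_section (hV : SemisimpleBasis k V) {i₀ : ι} {X Y : D}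
    (e : V i₀ ≅ Y) {f : X ⟶ Y} (hf : f ≠ 0) : ∃ s : Y ⟶ X, s ≫ f = 𝟙 Y := by
  by_contra hcon
  push Not at hcon
  refine hf (hV.hom_ext_left fun i a => ?_)
  rw [comp_zero]
  by_cases hi : i = i₀
  · subst hi
    obtain ⟨c, hc⟩ := hV.exists_smul (a ≫ f ≫ e.inv)
    have hc' : a ≫ f = c • e.hom := by
      rw [← cancel_mono e.inv, Category.assoc, hc]
      simp
    by_cases h0 : c = 0
    · rw [hc', h0, zero_smul]
    · refine absurd ?_ (hcon (c⁻¹ • (e.inv ≫ a)))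
      rw [Linear.smul_comp, Category.assoc, hc', Linear.comp_smul, smul_smul, inv_mul_cancel₀ h0]
      simp
  · rw [← cancel_mono e.inv, Category.assoc, zero_comp]
    exact hV.eq_zero hi _

/-- A nonzero difference l - l' would be a morphism R(𝟙) ⟶ 𝟙 of the center with a section in D.
Averaging makes the section central, hence a multiple of u; but l - l' kills u. -/
theorem IsNormalizedCointegral.unique (hV : SemisimpleBasis k V) {i₀ : ι} (e : V i₀ ≅ 𝟙_ D)
    {l l' : CF adj} (hl : IsNormalizedCointegral adj l) (hl' : IsNormalizedCointegral adj l') :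
    l = l' := by
  have hU := hV.isUniversal_counit adj (𝟙_ D)
  obtain ⟨avg, -, h2, h3⟩ := hl.exists_average adj hV
  obtain ⟨m, hm⟩ := hl.1.exists_center_hom adj hV
  obtain ⟨m', hm'⟩ := hl'.1.exists_center_hom adj hV
  by_contra hne
  have hd : l - l' ≠ 0 := sub_ne_zero.2 hne
  obtain ⟨s, hs⟩ := hV.exists_section e hd
  have hmm : (m - m').f = l - l' := by
    rw [← hm, ← hm']
    rfl
  obtain ⟨t, ht, ht'⟩ : ∃ t : 𝟙_ D ⟶ adjAlg adj, t ≫ (l - l') = 𝟙 (𝟙_ D) ∧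
      ∀ X, t ▷ X ≫ action adj X = ((λ_ X).hom ≫ (ρ_ X).inv) ≫ X ◁ (t ≫ counit adj) ≫
        (ρ_ X).hom := by
    refine ⟨(avg (X := 𝟙_ (Center D)) s).f, ?_, fun X => ?_⟩
    · have h4 := congrArg Center.Hom.f (h2 (X := 𝟙_ (Center D)) s (m - m'))
      have h5 := congrArg Center.Hom.f (h3 (𝟙_ (Center D)))
      have h6 : s ≫ (m - m').f = 𝟙 (𝟙_ D) := (congrArg (s ≫ ·) hmm).trans hs
      replace h4 := (congrArg (fun t => (avg (X := 𝟙_ (Center D)) (Y := 𝟙_ (Center D)) t).f)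
        h6).symm.trans h4
      exact (congrArg ((avg (X := 𝟙_ (Center D)) s).f ≫ ·) hmm).symm.trans (h4.symm.trans h5)
    · exact (hom_whiskerRight_action adj (avg (X := 𝟙_ (Center D)) s) X).trans
        (Category.assoc _ _ _)
  obtain ⟨c, hc⟩ := hV.exists_smul (e.hom ≫ (t ≫ counit adj) ≫ e.inv)
  have hc' : t ≫ counit adj = c • 𝟙 (𝟙_ D) := by
    rw [← cancel_mono e.inv, ← cancel_epi e.hom, hc]
    simp
  have h5 : t = c • algUnit adj := by
    apply adjAlg_hom_ext adj hU
    intro i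
    rw [ht', hc', MonoidalLinear.smul_whiskerRight, Linear.smul_comp, algUnit_action]
    simp
  have h6 : algUnit adj ≫ (l - l') = 0 := by
    rw [Preadditive.comp_sub, hl.2, hl'.2, sub_self]
  rw [h5, Linear.smul_comp, h6, smul_zero] at ht
  exact hV.id_ne_zero i₀ (by rw [← e.hom_inv_id, ← Category.comp_id e.hom, ← ht]; simp)

/-- Maschke's argument: averaging a generalized inverse makes it a morphism of the center, and fixes
f, which is one already. -/
theorem IsNormalizedCointegral.exists_regular (hV : SemisimpleBasis k V) {l : CF adj}
    (hl : IsNormalizedCointegral adj l) {X Y : Center D} (f : X ⟶ Y)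
    (hf : ∃ s : Y.1 ⟶ X.1, f.f ≫ s ≫ f.f = f.f) : ∃ s : Y ⟶ X, f ≫ s ≫ f = f := by
  obtain ⟨avg, h1, h2, h3⟩ := hl.exists_average adj hV
  obtain ⟨s, hs⟩ := hf
  have h4 : ∀ {X Y : Center D} (f : X ⟶ Y), avg f.f = f := by
    intro X Y f
    rw [← Category.id_comp f.f, h2, h3, Category.id_comp]
  exact ⟨avg s, by rw [← h2, ← h1, hs, h4]⟩

end Average

/-! ### Traces in pivotal categories -/

section PivotalTrace

variable {C : Type u} [Category.{v} C] [MonoidalCategory C] [RightRigidCategory C]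
  (j : Pivotal C)

omit [RightRigidCategory C] in
theorem rightDualIso_hom_evaluation {X Y₁ Y₂ : C} (p₁ : ExactPairing X Y₁)
    (p₂ : ExactPairing X Y₂) : (rightDualIso p₁ p₂).hom ▷ X ≫ p₂.evaluation' = p₁.evaluation' := by
  have := @rightAdjointMate_comp_evaluation C _ _ X X ⟨Y₂⟩ ⟨Y₁⟩ (𝟙 X)
  exact this.trans (by rw [MonoidalCategory.whiskerLeft_id, Category.id_comp]; rfl)

omit [RightRigidCategory C] in
theorem coevaluation_rightDualIso_hom {X Y₁ Y₂ : C} (p₁ : ExactPairing X Y₁)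
    (p₂ : ExactPairing X Y₂) :
    p₁.coevaluation' ≫ X ◁ (rightDualIso p₁ p₂).hom = p₂.coevaluation' := by
  have := @coevaluation_comp_rightAdjointMate C _ _ X X ⟨Y₂⟩ ⟨Y₁⟩ (𝟙 X)
  exact this.trans (by rw [id_whiskerRight, Category.comp_id]; rfl)

theorem Pivotal.whiskerRight_ev {X Y : C} (g : Y ⟶ X) :
    g ▷ Xᘁ ≫ j.ev X = Y ◁ gᘁ ≫ j.ev Y := by
  rw [Pivotal.ev, Pivotal.ev, ← comp_whiskerRight_assoc, j.naturality, comp_whiskerRight_assoc,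
    rightAdjointMate_comp_evaluation, whisker_exchange_assoc]

theorem Pivotal.trace_comp_comm {X Y : C} (f : X ⟶ Y) (g : Y ⟶ X) :
    j.trace (f ≫ g) = j.trace (g ≫ f) := by
  rw [Pivotal.trace, Pivotal.trace, comp_whiskerRight_assoc, j.whiskerRight_ev,
    ← whisker_exchange_assoc, ← Category.assoc, coevaluation_comp_rightAdjointMate]
  simp

/-- The exact pairing between `X*` and `X` given by the pivotal structure. -/
@[reducible]
def Pivotal.exactPairing (X : C) : ExactPairing Xᘁ X := exactPairingCongrRight (j.iso X)

theorem Pivotal.exactPairing_evaluation (X : C) :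
    (j.exactPairing X).evaluation' = j.ev X := rfl

/-- The partial trace of `g : Z ⊗ Y ⟶ X ⊗ Y` with respect to `c : Y ⊗ Y* ⟶ 𝟙`. -/
def ptr {X Y Z : C} (c : Y ⊗ Yᘁ ⟶ 𝟙_ C) (g : Z ⊗ Y ⟶ X ⊗ Y) : Z ⟶ X :=
  (ρ_ Z).inv ≫ Z ◁ η_ Y Yᘁ ≫ (α_ _ _ _).inv ≫ g ▷ Yᘁ ≫ (α_ _ _ _).hom ≫ X ◁ c ≫ (ρ_ X).hom

theorem comp_ptr {X Y Z Z' : C} (c : Y ⊗ Yᘁ ⟶ 𝟙_ C) (h : Z' ⟶ Z) (g : Z ⊗ Y ⟶ X ⊗ Y) :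
    h ≫ ptr c g = ptr c (h ▷ Y ≫ g) := by
  rw [ptr, ptr]
  calc _ = 𝟙 _ ⊗≫ (h ▷ 𝟙_ C ≫ Z ◁ η_ Y Yᘁ) ⊗≫ g ▷ Yᘁ ⊗≫ X ◁ c ⊗≫ 𝟙 _ := by monoidal
    _ = _ := by rw [← whisker_exchange]; monoidal

theorem ptr_comp {X X' Y Z : C} (c : Y ⊗ Yᘁ ⟶ 𝟙_ C) (g : Z ⊗ Y ⟶ X ⊗ Y) (h : X ⟶ X') :
    ptr c g ≫ h = ptr c (g ≫ h ▷ Y) := by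
  rw [ptr, ptr]
  calc _ = 𝟙 _ ⊗≫ Z ◁ η_ Y Yᘁ ⊗≫ g ▷ Yᘁ ⊗≫ (X ◁ c ≫ h ▷ 𝟙_ C) ⊗≫ 𝟙 _ := by monoidal
    _ = _ := by rw [whisker_exchange]; monoidal

/-- Closing the U-strand of a composite through Y: the coevaluation is absorbed by h and the pivotal
evaluation by p, each becoming a transposition. -/
theorem ptr_comp_pairing {X Y Z U : C} (h : Z ⊗ U ⟶ Y) (p : Y ⟶ X ⊗ U) :
    ptr (j.ev U) (h ≫ p) = tensorRightHomEquiv Z U Uᘁ Y h ≫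
      (@tensorRightHomEquiv C _ _ Y Uᘁ U X (j.exactPairing U)).symm p := by
  rw [ptr, comp_whiskerRight]
  change _ = ((ρ_ _).inv ≫ Z ◁ η_ _ _ ≫ (α_ _ _ _).inv ≫ h ▷ _) ≫ p ▷ _ ≫ (α_ _ _ _).hom ≫
    X ◁ j.ev U ≫ (ρ_ _).hom
  simp only [Category.assoc]

theorem coevaluation_rightDualTensorIso (X Y : C) :
    η_ (X ⊗ Y) (X ⊗ Y)ᘁ ≫ (X ⊗ Y) ◁ (rightDualTensorIso X Y).hom =
      𝟙 _ ⊗≫ η_ X Xᘁ ⊗≫ X ◁ η_ Y Yᘁ ▷ Xᘁ ⊗≫ 𝟙 _ := by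
  refine (coevaluation_rightDualIso_hom HasRightDual.exact ExactPairing.tensor).trans ?_
  refine (ExactPairing.tensor_coevaluation).trans ?_
  monoidal

/-- The evaluation of a tensor product nests; this is where monoidality of the pivotal structure is
needed. -/
theorem Pivotal.ev_tensor (X Y : C) : (X ⊗ Y) ◁ (rightDualTensorIso X Y).inv ≫ j.ev (X ⊗ Y) =
    𝟙 _ ⊗≫ X ◁ j.ev Y ▷ Xᘁ ⊗≫ j.ev X := by
  rw [Pivotal.ev, whisker_exchange_assoc, ← rightAdjointMate_comp_evaluation]
  have h : (rightDualTensorIso (Yᘁ : C) (Xᘁ : C)).hom ▷ (Yᘁ ⊗ Xᘁ) ≫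
      (ExactPairing.tensor (X₁ := (Yᘁ : C)) (X₂ := (Xᘁ : C)) (Y₁ := ((Yᘁ : C)ᘁ : C))
        (Y₂ := ((Xᘁ : C)ᘁ : C))).evaluation' =
      ε_ ((Yᘁ : C) ⊗ (Xᘁ : C)) ((Yᘁ : C) ⊗ (Xᘁ : C))ᘁ := rightDualIso_hom_evaluation _ _
  rw [← h, ← comp_whiskerRight_assoc, ← comp_whiskerRight_assoc, Category.assoc, j.monoidal]
  refine (congrArg (_ ≫ ·) ExactPairing.tensor_evaluation).trans ?_
  rw [tensorHom_def', Pivotal.ev, Pivotal.ev]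
  calc _ = 𝟙 _ ⊗≫ X ◁ ((j.iso Y).hom ▷ Yᘁ) ▷ Xᘁ ⊗≫
        ((j.iso X).hom ▷ ((Yᘁ : C)ᘁ ⊗ Yᘁ) ≫ ((Xᘁ : C)ᘁ : C) ◁ ε_ Yᘁ (Yᘁ : C)ᘁ) ▷ Xᘁ ⊗≫
        ε_ Xᘁ (Xᘁ : C)ᘁ := by monoidal
    _ = _ := by rw [← whisker_exchange]; monoidal

theorem Pivotal.trace_tensor {X Y : C} (g : X ⊗ Y ⟶ X ⊗ Y) :
    j.trace g = j.trace (ptr (j.ev Y) g) := by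
  have h1 : j.trace g = (η_ (X ⊗ Y) (X ⊗ Y)ᘁ ≫ (X ⊗ Y) ◁ (rightDualTensorIso X Y).hom) ≫
      g ▷ (Yᘁ ⊗ Xᘁ) ≫ (X ⊗ Y) ◁ (rightDualTensorIso X Y).inv ≫ j.ev (X ⊗ Y) := by
    rw [Category.assoc, whisker_exchange_assoc, ← MonoidalCategory.whiskerLeft_comp_assoc,
      Iso.hom_inv_id, MonoidalCategory.whiskerLeft_id, Category.id_comp, Pivotal.trace]
  rw [h1, coevaluation_rightDualTensorIso, j.ev_tensor, Pivotal.trace, ptr]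
  monoidal

/-- Closing up `X* ⊗ Y` on the left and on the right. -/
theorem Pivotal.trace_leftPtr {X Y : C} (g : Xᘁ ⊗ Y ⟶ Xᘁ ⊗ Y) :
    j.trace ((λ_ Y).inv ≫ η_ X Xᘁ ▷ Y ≫ (α_ _ _ _).hom ≫ X ◁ g ≫ (α_ _ _ _).inv ≫ j.ev X ▷ Y ≫
      (λ_ Y).hom) = η_ X Xᘁ ≫ X ◁ ptr (j.ev Y) g ≫ j.ev X := by
  rw [Pivotal.trace, ptr]
  calc _ = 𝟙 _ ⊗≫ (𝟙_ C ◁ η_ Y Yᘁ ≫ η_ X Xᘁ ▷ (Y ⊗ Yᘁ)) ⊗≫ X ◁ g ▷ Yᘁ ⊗≫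
        (j.ev X ▷ (Y ⊗ Yᘁ) ≫ 𝟙_ C ◁ j.ev Y) ⊗≫ 𝟙 _ := by monoidal
    _ = _ := by rw [whisker_exchange, ← whisker_exchange (j.ev X)]; monoidal

end PivotalTrace

/-! ### Simple objects and their duals -/

section Duals

variable {k : Type w} [Field k] {D : Type u} [Category.{v} D] [Preadditive D] [Linear k D]
  [MonoidalCategory D] [MonoidalPreadditive D] [MonoidalLinear k D]

omit [Preadditive D] [MonoidalPreadditive D] in
theorem rightAdjointMate_injective {X Y : D} [HasRightDual X] [HasRightDual Y]
    {f g : X ⟶ Y} (h : fᘁ = gᘁ) : f = g := by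
  have h1 : η_ Y Yᘁ ≫ Y ◁ fᘁ = η_ Y Yᘁ ≫ Y ◁ gᘁ := by rw [h]
  rw [coevaluation_comp_rightAdjointMate, coevaluation_comp_rightAdjointMate] at h1
  have h2 : ∀ f : X ⟶ Y, η_ X Xᘁ ≫ f ▷ Xᘁ =
      tensorRightHomEquiv (𝟙_ D) X Xᘁ Y ((λ_ X).hom ≫ f) := by
    intro f
    simp [tensorRightHomEquiv, unitors_equal]
  rw [h2, h2, EmbeddingLike.apply_eq_iff_eq, cancel_epi] at h1
  exact h1

omit [Preadditive D] [MonoidalPreadditive D] in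
theorem rightAdjointMate_surjective {X Y : D} [HasRightDual X] [HasRightDual Y]
    (f : Yᘁ ⟶ Xᘁ) : ∃ g : X ⟶ Y, gᘁ = f := by
  obtain ⟨g, hg⟩ : ∃ g : X ⟶ Y, Yᘁ ◁ g ≫ ε_ Y Yᘁ = f ▷ X ≫ ε_ X Xᘁ := by
    have h : ∀ t : X ⟶ Y ⊗ 𝟙_ D, Yᘁ ◁ (t ≫ (ρ_ Y).hom) ≫ ε_ Y Yᘁ =
        (tensorLeftHomEquiv X Y Yᘁ (𝟙_ D)).symm t := by
      intro t
      change _ = Yᘁ ◁ t ≫ (α_ _ _ _).inv ≫ ε_ Y Yᘁ ▷ _ ≫ (λ_ _).hom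
      monoidal
    exact ⟨tensorLeftHomEquiv X Y Yᘁ (𝟙_ D) (f ▷ X ≫ ε_ X Xᘁ) ≫ (ρ_ Y).hom,
      (h _).trans (Equiv.symm_apply_apply _ _)⟩
  refine ⟨g, ?_⟩
  have h : ∀ t : Yᘁ ⟶ Xᘁ, t ▷ X ≫ ε_ X Xᘁ =
      (tensorRightHomEquiv Yᘁ X Xᘁ (𝟙_ D)).symm (t ≫ (λ_ _).inv) := by
    intro t
    change _ = (t ≫ (λ_ _).inv) ▷ _ ≫ (α_ _ _ _).hom ≫ _ ◁ ε_ X Xᘁ ≫ (ρ_ _).hom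
    monoidal
  rw [← rightAdjointMate_comp_evaluation, h, h, EmbeddingLike.apply_eq_iff_eq, cancel_mono] at hg
  exact hg

variable {ι : Type} [Fintype ι] {V : ι → D}

theorem rightAdjointMate_sum {X Y : D} [HasRightDual X] [HasRightDual Y] {J : Type*}
    (s : Finset J) (f : J → (X ⟶ Y)) : (∑ x ∈ s, f x)ᘁ = ∑ x ∈ s, (f x)ᘁ := by
  simp [rightAdjointMate, sum_whiskerRight, whiskerLeft_sum, Preadditive.sum_comp,
    Preadditive.comp_sum]

theorem rightAdjointMate_zero {X Y : D} [HasRightDual X] [HasRightDual Y] :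
    (0 : X ⟶ Y)ᘁ = 0 := by
  simp [rightAdjointMate]

theorem rightAdjointMate_smul {X Y : D} [HasRightDual X] [HasRightDual Y] (c : k) (f : X ⟶ Y) :
    (c • f)ᘁ = c • fᘁ := by
  simp [rightAdjointMate]

/-- Duality is contravariant and bijective on morphisms. A decomposition of X is obtained by
dualizing one of ᘁX, whose right dual is X itself. -/
theorem SemisimpleBasis.rightDual [RigidCategory D] (hV : SemisimpleBasis k V) :
    SemisimpleBasis k fun i => (V i)ᘁ where
  id_ne_zero i h := hV.id_ne_zero i (rightAdjointMate_injective (by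
    rw [rightAdjointMate_id, h, rightAdjointMate_zero]))
  exists_smul f := by
    obtain ⟨g, rfl⟩ := rightAdjointMate_surjective f
    obtain ⟨c, rfl⟩ := hV.exists_smul g
    exact ⟨c, by rw [rightAdjointMate_smul, rightAdjointMate_id]⟩
  eq_zero h f := by
    obtain ⟨g, rfl⟩ := rightAdjointMate_surjective f
    rw [hV.eq_zero (Ne.symm h) g, rightAdjointMate_zero]
  decomp X := by
    obtain ⟨K, _, b, a, h1, h2, h3⟩ := hV.decomp (ᘁX : D)
    let b' : ∀ i, K i → (X ⟶ (V i)ᘁ) := fun i x =>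
      @rightAdjointMate D _ _ (V i) (ᘁX : D) _ hasRightDualLeftDual (a i x)
    let a' : ∀ i, K i → ((V i)ᘁ ⟶ X) := fun i x =>
      @rightAdjointMate D _ _ (ᘁX : D) (V i) hasRightDualLeftDual _ (b i x)
    have hab : ∀ i x, b' i x ≫ a' i x = @rightAdjointMate D _ _ (ᘁX : D) (ᘁX : D)
        hasRightDualLeftDual hasRightDualLeftDual (b i x ≫ a i x) := fun i x =>
      (@comp_rightAdjointMate D _ _ (ᘁX : D) (V i) (ᘁX : D) hasRightDualLeftDual _
        hasRightDualLeftDual (b i x) (a i x)).symm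
    have hba : ∀ i x l y, a' i x ≫ b' l y = (a l y ≫ b i x)ᘁ := fun i x l y =>
      (@comp_rightAdjointMate D _ _ (V l) (ᘁX : D) (V i) _ hasRightDualLeftDual
        _ (a l y) (b i x)).symm
    refine ⟨K, inferInstance, b', a', ?_, fun i x => ?_, fun i x y h => ?_⟩
    · have h4 : @rightAdjointMate D _ _ (ᘁX : D) (ᘁX : D) hasRightDualLeftDual
          hasRightDualLeftDual (∑ i, ∑ x, b i x ≫ a i x) = 𝟙 X := by
        rw [h1]
        exact @rightAdjointMate_id D _ _ (ᘁX : D) hasRightDualLeftDual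
      refine Eq.trans ?_ h4
      refine (Eq.trans (@rightAdjointMate_sum D _ _ _ _ (ᘁX : D) (ᘁX : D) hasRightDualLeftDual
        hasRightDualLeftDual _ _ _) (Finset.sum_congr rfl fun i _ => ?_)).symm
      refine Eq.trans (@rightAdjointMate_sum D _ _ _ _ (ᘁX : D) (ᘁX : D) hasRightDualLeftDual
        hasRightDualLeftDual _ _ _) (Finset.sum_congr rfl fun x _ => (hab i x).symm)
    · rw [hba, h2, rightAdjointMate_id]
    · rw [hba, h3 i y x h.symm, rightAdjointMate_zero]

end Duals

/-! ### Simple objects and dimensions in a fusion category -/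

section Fusion

variable {k : Type w} [Field k]
    {C : Type u} [Category.{v} C] [Abelian C] [Linear k C] [MonoidalCategory C]
    [MonoidalPreadditive C] [MonoidalLinear k C] [RigidCategory C] [IsFusion k C]

/-- Schur's lemma; algebraic closedness of k enters here, making simple objects absolutely simple.
-/
theorem IsIrr.semisimpleBasis [IsAlgClosed k] {ι : Type} [Fintype ι] {V : ι → C} (hV : IsIrr V) :
    SemisimpleBasis k V where
  id_ne_zero i := haveI := hV.simple i; id_nonzero _
  exists_smul {i} f := by
    have := hV.simple i
    have := IsFusion.finite_hom (k := k) (V i) (V i)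
    obtain ⟨c, hc⟩ := endomorphism_simple_eq_smul_id k f
    exact ⟨c, hc.symm⟩
  eq_zero {i l} h f := by
    have := hV.simple i
    have := hV.simple l
    by_contra hf
    have := isIso_of_hom_simple hf
    exact h ((hV.existsUnique (V i) (hV.simple i)).unique ⟨Iso.refl _⟩ ⟨asIso f⟩)
  decomp X := by
    classical
    obtain ⟨n, S, hS, ⟨e⟩⟩ := IsFusion.semisimple (k := k) X
    choose idx hidx using fun m => (hV.existsUnique (S m) (hS m)).exists
    have φ : ∀ m, S m ≅ V (idx m) := fun m => (hidx m).some
    have h1 : ∀ m m', m ≠ m' → biproduct.ι S m ≫ biproduct.π S m' = 0 :=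
      fun m m' h => biproduct.ι_π_ne _ h
    refine ⟨fun i => {m // idx m = i}, fun i => inferInstance,
      fun i m => e.hom ≫ biproduct.π S m.1 ≫ (φ m.1).hom ≫ eqToHom (by rw [m.2]),
      fun i m => eqToHom (by rw [m.2]) ≫ (φ m.1).inv ≫ biproduct.ι S m.1 ≫ e.inv, ?_, ?_, ?_⟩
    · have h2 : ∀ i (m : {m // idx m = i}),
          (e.hom ≫ biproduct.π S m.1 ≫ (φ m.1).hom ≫ eqToHom (by rw [m.2] : V (idx m.1) = V i)) ≫
          eqToHom (by rw [m.2]) ≫ (φ m.1).inv ≫ biproduct.ι S m.1 ≫ e.inv =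
          e.hom ≫ (biproduct.π S m.1 ≫ biproduct.ι S m.1) ≫ e.inv := by
        intro i m
        simp
      simp only [h2]
      rw [Fintype.sum_fiberwise idx fun m => e.hom ≫ (biproduct.π S m ≫ biproduct.ι S m) ≫ e.inv,
        ← Preadditive.comp_sum, ← Preadditive.sum_comp, biproduct.total]
      simp
    · rintro i ⟨m, rfl⟩
      simp
    · rintro i ⟨m, rfl⟩ ⟨m', hm'⟩ hne
      have : m ≠ m' := fun h => hne (Subtype.ext h)
      simp [reassoc_of% (h1 m m' this)]

/-- As End(𝟙) = k, the idempotent projecting 𝟙 onto a simple summand is a scalar, which must be 1.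
-/
theorem SemisimpleBasis.exists_unit_iso (k : Type w) [Field k] {C : Type u} [Category.{v} C]
    [Abelian C] [Linear k C] [MonoidalCategory C] [MonoidalPreadditive C] [MonoidalLinear k C]
    [RigidCategory C] [IsFusion k C] {ι : Type} [Fintype ι] {V : ι → C}
    (hV : SemisimpleBasis k V) : ∃ i, Nonempty (V i ≅ 𝟙_ C) := by
  obtain ⟨K, _, b, a, h1, h2, -⟩ := hV.decomp (𝟙_ C)
  have hne : 𝟙 (𝟙_ C) ≠ 0 := by
    intro h
    have := (IsFusion.unit_bijective (k := k) (C := C)).injective (a₁ := 1) (a₂ := 0)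
    simp [h] at this
  have : ∃ i, Nonempty (K i) := by
    by_contra hcon
    push Not at hcon
    refine hne (h1.symm.trans (Finset.sum_eq_zero fun i _ => ?_))
    simp
  obtain ⟨i, ⟨x⟩⟩ := this
  obtain ⟨c, hc⟩ := (IsFusion.unit_bijective (k := k) (C := C)).surjective (b i x ≫ a i x)
  rw [LinearMap.toSpanSingleton_apply] at hc
  have h3 : a i x = c • a i x := by
    have : a i x ≫ b i x ≫ a i x = a i x ≫ (c • 𝟙 (𝟙_ C)) := by rw [hc]
    rw [← Category.assoc, h2] at this
    simpa using this
  have h4 : (1 - c) • 𝟙 (V i) = 0 := by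
    rw [← h2 i x, sub_smul, one_smul, ← Linear.smul_comp, ← h3, sub_self]
  have h5 : c = 1 := by
    have := (smul_eq_zero.1 h4).resolve_right (hV.id_ne_zero i)
    exact (sub_eq_zero.1 this).symm
  exact ⟨i, ⟨⟨a i x, b i x, h2 i x, by rw [← hc, h5, one_smul]⟩⟩⟩

theorem scalar_smul_id (f : 𝟙_ C ⟶ 𝟙_ C) : scalar k f • 𝟙 (𝟙_ C) = f :=
  LinearEquiv.apply_symm_apply (LinearEquiv.ofBijective _
    (IsFusion.unit_bijective (k := k) (C := C))) f

theorem scalar_smul (c : k) : scalar k (c • 𝟙 (𝟙_ C)) = c :=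
  LinearEquiv.symm_apply_apply (LinearEquiv.ofBijective _
    (IsFusion.unit_bijective (k := k) (C := C))) c

variable (k) in
/-- The pivotal trace with values in `k`. -/
noncomputable def ktrace (j : Pivotal C) (X : C) : (X ⟶ X) →ₗ[k] k where
  toFun f := scalar k (j.trace f)
  map_add' f g := by
    simp [Pivotal.trace, MonoidalPreadditive.add_whiskerRight]
  map_smul' c f := by
    simp [Pivotal.trace, MonoidalLinear.smul_whiskerRight]

theorem ktrace_id (j : Pivotal C) (X : C) : ktrace k j X (𝟙 X) = pdim k j X := rfl

theorem ktrace_comp_comm (j : Pivotal C) {X Y : C} (f : X ⟶ Y) (g : Y ⟶ X) :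
    ktrace k j X (f ≫ g) = ktrace k j Y (g ≫ f) :=
  congrArg (scalar k) (j.trace_comp_comm f g)

theorem ktrace_tensor (j : Pivotal C) {X Y : C} (g : X ⊗ Y ⟶ X ⊗ Y) :
    ktrace k j (X ⊗ Y) g = ktrace k j X (ptr (j.ev Y) g) :=
  congrArg (scalar k) (j.trace_tensor g)

theorem coevaluation_ev (j : Pivotal C) (X : C) :
    η_ X Xᘁ ≫ j.ev X = pdim k j X • 𝟙 (𝟙_ C) := by
  rw [pdim, scalar_smul_id, Pivotal.trace, id_whiskerRight, Category.id_comp]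

theorem pdim_of_iso (j : Pivotal C) {X Y : C} (e : X ≅ Y) : pdim k j X = pdim k j Y := by
  rw [← ktrace_id, ← ktrace_id, ← e.hom_inv_id, ktrace_comp_comm, e.inv_hom_id]

theorem ptr_id (j : Pivotal C) (X Y : C) :
    ptr (j.ev Y) (𝟙 (X ⊗ Y)) = pdim k j Y • 𝟙 X := by
  have : ptr (j.ev Y) (𝟙 (X ⊗ Y)) = 𝟙 _ ⊗≫ X ◁ (η_ Y Yᘁ ≫ j.ev Y) ⊗≫ 𝟙 _ := by
    rw [ptr]; monoidal
  rw [this, coevaluation_ev (k := k)]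
  simp [monoidalComp, MonoidalLinear.whiskerLeft_smul]

theorem pdim_tensor (j : Pivotal C) (X Y : C) :
    pdim k j (X ⊗ Y) = pdim k j X * pdim k j Y := by
  rw [← ktrace_id, ktrace_tensor, ptr_id (k := k), map_smul, ktrace_id, smul_eq_mul, mul_comm]

theorem ev_ne_zero (j : Pivotal C) {X : C} (hX : 𝟙 X ≠ 0) : j.ev X ≠ 0 := by
  intro h
  have h1 := (j.exactPairing X).coevaluation_evaluation'
  rw [j.exactPairing_evaluation, h] at h1
  apply hX
  rw [← cancel_mono (λ_ X).inv, ← cancel_epi (ρ_ X).hom, Category.id_comp, ← h1]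
  simp

variable {ι : Type} [Fintype ι] {V : ι → C}

/-- The pivotal evaluation is nonzero, so it has a section, which is a multiple of the coevaluation
because Hom(𝟙, V i ⊗ (V i)*) is a line. Hence evaluation after coevaluation, which is the dimension,
is nonzero. -/
theorem SemisimpleBasis.pdim_ne_zero (hV : SemisimpleBasis k V) (j : Pivotal C) (i : ι) :
    pdim k j (V i) ≠ 0 := by
  obtain ⟨i₀, ⟨e⟩⟩ := hV.exists_unit_iso
  obtain ⟨s, hs⟩ := hV.exists_section e (ev_ne_zero j (hV.id_ne_zero i))
  obtain ⟨f, rfl⟩ := (tensorRightHomEquiv (𝟙_ C) (V i) ((V i)ᘁ) (V i)).surjective s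
  obtain ⟨c, hc⟩ := hV.exists_smul ((λ_ _).inv ≫ f)
  have hf : f = c • (λ_ (V i)).hom := by
    rw [← cancel_epi (λ_ (V i)).inv, hc]
    simp
  have h1 : tensorRightHomEquiv (𝟙_ C) (V i) ((V i)ᘁ) (V i) f = c • η_ (V i) (V i)ᘁ := by
    simp [hf, tensorRightHomEquiv, MonoidalLinear.smul_whiskerRight, unitors_equal]
  intro h0
  rw [h1, Linear.smul_comp, coevaluation_ev (k := k), h0, zero_smul, smul_zero] at hs
  exact hV.id_ne_zero i₀ (by rw [← e.hom_inv_id, ← Category.comp_id e.hom, ← hs]; simp)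

theorem SemisimpleBasis.pdim_unit (hV : SemisimpleBasis k V) (j : Pivotal C) :
    pdim k j (𝟙_ C) = 1 := by
  obtain ⟨i₀, ⟨e⟩⟩ := hV.exists_unit_iso
  have h0 : pdim k j (𝟙_ C) ≠ 0 := by
    rw [← pdim_of_iso j e]
    exact hV.pdim_ne_zero j i₀
  have h1 := pdim_tensor (k := k) j (𝟙_ C) (𝟙_ C)
  rw [pdim_of_iso j (λ_ (𝟙_ C))] at h1
  exact (mul_eq_left₀ h0).1 h1.symm

end Fusion

/-! ### Sliding a handle along an object -/

section Bend

variable {C : Type u} [Category.{v} C] [MonoidalCategory C] [RightRigidCategory C]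
  (j : Pivotal C) {X Y U : C}

/-- The morphism `X ⊗ U ⟶ Y` corresponding to `b : Y* ⊗ X ⟶ U*`. -/
def bend (b : Yᘁ ⊗ X ⟶ Uᘁ) : X ⊗ U ⟶ Y :=
  (tensorRightHomEquiv X U Uᘁ Y).symm (tensorLeftHomEquiv X Y Yᘁ Uᘁ b)

/-- The morphism `Y ⊗ U* ⟶ X` corresponding to `a : U* ⟶ Y* ⊗ X`. -/
def halfCobend (a : Uᘁ ⟶ Yᘁ ⊗ X) : Y ⊗ Uᘁ ⟶ X :=
  (@tensorLeftHomEquiv C _ _ Uᘁ Yᘁ Y X (j.exactPairing Y)).symm a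

/-- The morphism `Y ⟶ X ⊗ U` corresponding to `a : U* ⟶ Y* ⊗ X`. -/
def cobend (a : Uᘁ ⟶ Yᘁ ⊗ X) : Y ⟶ X ⊗ U :=
  @tensorRightHomEquiv C _ _ Y Uᘁ U X (j.exactPairing U) (halfCobend j a)

/-- Closing the U-strand straightens it, leaving b ≫ a with its Y*-strand closed on the left.
`ptr_action_bend_cobend` is the same with an operator acting on Y in between. -/
theorem ptr_bend_cobend (b : Yᘁ ⊗ X ⟶ Uᘁ) (a : Uᘁ ⟶ Yᘁ ⊗ X) :
    ptr (j.ev U) (bend b ≫ cobend j a) =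
      (λ_ X).inv ≫ η_ Y Yᘁ ▷ X ≫ (α_ _ _ _).hom ≫ Y ◁ (b ≫ a) ≫ (α_ _ _ _).inv ≫ j.ev Y ▷ X ≫
      (λ_ X).hom := by
  rw [ptr_comp_pairing, bend, cobend, Equiv.apply_symm_apply, Equiv.symm_apply_apply]
  change ((λ_ _).inv ≫ η_ Y Yᘁ ▷ _ ≫ (α_ _ _ _).hom ≫ Y ◁ b) ≫
    Y ◁ a ≫ (α_ _ _ _).inv ≫ j.ev Y ▷ _ ≫ (λ_ _).hom = _
  simp

theorem ptr_action_bend_cobend {A : C} (r : A ⊗ Y ⟶ Y) (b : Yᘁ ⊗ X ⟶ Uᘁ) (a : Uᘁ ⟶ Yᘁ ⊗ X) :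
    ptr (j.ev U) (((α_ A X U).hom ≫ A ◁ bend b ≫ r) ≫ cobend j a) =
      (mate r ▷ X ≫ (α_ _ _ _).hom ≫ Y ◁ (b ≫ a) ≫ (α_ _ _ _).inv) ≫ j.ev Y ▷ X ≫
      (λ_ X).hom := by
  have h : tensorRightHomEquiv (A ⊗ X) U Uᘁ Y ((α_ A X U).hom ≫ A ◁ bend b ≫ r) =
      A ◁ tensorRightHomEquiv X U Uᘁ Y (bend b) ≫ (α_ _ _ _).inv ≫ r ▷ Uᘁ := by
    simp only [tensorRightHomEquiv, Equiv.coe_fn_mk]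
    monoidal
  rw [ptr_comp_pairing, h, bend, cobend, Equiv.apply_symm_apply, Equiv.symm_apply_apply]
  change (A ◁ ((λ_ _).inv ≫ η_ Y Yᘁ ▷ _ ≫ (α_ _ _ _).hom ≫ Y ◁ b) ≫ _) ≫
    Y ◁ a ≫ (α_ _ _ _).inv ≫ j.ev Y ▷ _ ≫ (λ_ _).hom = _
  rw [mate]
  calc _ = 𝟙 _ ⊗≫ A ◁ η_ Y Yᘁ ▷ X ⊗≫ ((A ⊗ Y) ◁ b ≫ r ▷ Uᘁ) ⊗≫ Y ◁ a ⊗≫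
        j.ev Y ▷ X ⊗≫ 𝟙 _ := by monoidal
    _ = _ := by rw [whisker_exchange]; monoidal

end Bend

section HandleSlide

variable {k : Type w} [Field k]
  {C : Type u} [Category.{v} C] [Abelian C] [Linear k C] [MonoidalCategory C]
  [MonoidalPreadditive C] [MonoidalLinear k C] [RigidCategory C] [IsFusion k C]
  {ι : Type} [Fintype ι] {V : ι → C} (j : Pivotal C)

theorem mem_irrIn {C : Type u} [Category.{v} C] {ι : Type} [Fintype ι] {V : ι → C}
    {P : ObjectProperty C} {i : ι} : i ∈ irrIn V P ↔ P (V i) := by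
  simp [irrIn]

theorem irrIn_top {C : Type u} [Category.{v} C] {ι : Type} [Fintype ι] (V : ι → C) :
    irrIn V ⊤ = Finset.univ := by
  ext i
  simp [mem_irrIn]

theorem bend_sum {X Y U : C} {J : Type*} (s : Finset J) (b : J → (Yᘁ ⊗ X ⟶ Uᘁ)) :
    bend (∑ x ∈ s, b x) = ∑ x ∈ s, bend (b x) := by
  simp [bend, tensorLeftHomEquiv, tensorRightHomEquiv, whiskerLeft_sum, sum_whiskerRight,
    Preadditive.comp_sum, Preadditive.sum_comp]

omit [IsFusion k C] in
theorem bend_smul {X Y U : C} (c : k) (b : Yᘁ ⊗ X ⟶ Uᘁ) : bend (c • b) = c • bend b := by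
  simp [bend, tensorLeftHomEquiv, tensorRightHomEquiv]

omit [Abelian C] [MonoidalPreadditive C] in
theorem bend_surjective {X Y U : C} (f : X ⊗ U ⟶ Y) : ∃ b : Yᘁ ⊗ X ⟶ Uᘁ, bend b = f :=
  ((tensorLeftHomEquiv X Y Yᘁ Uᘁ).trans (tensorRightHomEquiv X U Uᘁ Y).symm).surjective f

/-- Both sides close up b ≫ a. Tracing out X first leaves a scalar on the simple object (V l)*,
closed on the left in one case and on the right in the other; sphericality equates the two. -/
theorem ktrace_bend_cobend (hV : SemisimpleBasis k V) (hj : j.IsSpherical) {X U : C} {l : ι}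
    (b : (V l)ᘁ ⊗ X ⟶ Uᘁ) (a : Uᘁ ⟶ (V l)ᘁ ⊗ X) :
    ktrace k j (X ⊗ U) (bend b ≫ cobend j a) = ktrace k j Uᘁ (a ≫ b) := by
  obtain ⟨c, hc⟩ := hV.rightDual.exists_smul (ptr (j.ev X) (b ≫ a))
  have h : pdim k j (V l)ᘁ = pdim k j (V l) := congrArg (scalar k) (hj (V l)).symm
  rw [ktrace_tensor, ptr_bend_cobend, ktrace_comp_comm j a b, ktrace_tensor, hc, map_smul,
    ktrace_id, h]
  refine (congrArg (scalar k) (j.trace_leftPtr (b ≫ a))).trans ?_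
  rw [hc, MonoidalLinear.whiskerLeft_smul, Linear.smul_comp, Linear.comp_smul,
    MonoidalCategory.whiskerLeft_id, Category.id_comp, coevaluation_ev (k := k), map_smul,
    scalar_smul]

variable {P : ObjectProperty C} [IsFusionSubcategory P]

omit [MonoidalPreadditive C] in
theorem prop_of_retract {X Y : C} (s : X ⟶ Y) (r : Y ⟶ X) (h : s ≫ r = 𝟙 X) (hY : P Y) : P X :=
  haveI : IsSplitMono s := IsSplitMono.mk' ⟨r, h⟩
  IsFusionSubcategory.prop_of_mono s hY

omit [MonoidalPreadditive C] in
theorem prop_of_prop_dual (j : Pivotal C) {X : C} (h : P Xᘁ) : P X :=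
  IsFusionSubcategory.prop_of_mono (j.iso X).hom (IsFusionSubcategory.prop_dual h)

omit [MonoidalPreadditive C] [MonoidalLinear k C] [IsFusion k C] in
theorem prop_simple_of_ne_zero (hV : SemisimpleBasis k V) {X : C} {l : ι} {f : X ⟶ V l}
    (hf : f ≠ 0) (hX : P X) : P (V l) := by
  obtain ⟨s, hs⟩ := hV.exists_section (Iso.refl (V l)) hf
  exact prop_of_retract s f hs hX

/-- Dual bases for V l in V l* ⊗ X → V i* bend to dual bases for X ⊗ V i → V l, up to the factor dim
V i / dim V l found by comparing traces (`key`). Only simple objects of P occur in X ⊗ V i, so the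
sum over P resolves the identity. -/
theorem sum_bend_cobend (hV : SemisimpleBasis k V) (hj : j.IsSpherical) {X : C} (hX : P X) {i : ι}
    (hi : P (V i)) {K : ι → Type} [∀ l, Fintype (K l)]
    (b : ∀ l, K l → ((V l)ᘁ ⊗ X ⟶ (V i)ᘁ)) (a : ∀ l, K l → ((V i)ᘁ ⟶ (V l)ᘁ ⊗ X))
    (h1 : ∀ l (f : (V l)ᘁ ⊗ X ⟶ (V i)ᘁ), ∑ x, b l x ≫ a l x ≫ f = f)
    (h2 : ∀ l x, a l x ≫ b l x = 𝟙 _) (h3 : ∀ l x y, x ≠ y → a l x ≫ b l y = 0) :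
    ∑ l ∈ irrIn V P, ∑ x, pdim k j (V l) • (bend (b l x) ≫ cobend j (a l x)) =
      pdim k j (V i) • 𝟙 (X ⊗ V i) := by
  classical
  have hd : pdim k j (V i)ᘁ = pdim k j (V i) := congrArg (scalar k) (hj (V i)).symm
  have key : ∀ l x y, pdim k j (V l) • (cobend j (a l x) ≫ bend (b l y)) =
      if x = y then pdim k j (V i) • 𝟙 (V l) else 0 := by
    intro l x y
    obtain ⟨c, hc⟩ := hV.exists_smul (cobend j (a l x) ≫ bend (b l y))
    have h4 := ktrace_bend_cobend j hV hj (b l y) (a l x)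
    rw [ktrace_comp_comm, hc, map_smul, ktrace_id, smul_eq_mul] at h4
    rw [hc, smul_smul, mul_comm, h4]
    split_ifs with h
    · subst h
      rw [h2, ktrace_id, hd]
    · rw [h3 l x y h, map_zero, zero_smul]
  refine hV.hom_ext_right fun l f => ?_
  by_cases hl : P (V l)
  · obtain ⟨t, rfl⟩ := bend_surjective f
    have ht : bend t = ∑ y, bend (b l y ≫ a l y ≫ t) := by rw [← bend_sum, h1]
    choose c hc using fun y => hV.rightDual.exists_smul (a l y ≫ t)
    simp only [hc, Linear.comp_smul, Category.comp_id, bend_smul] at ht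
    have h5 : ∀ y, (∑ l ∈ irrIn V P, ∑ x, pdim k j (V l) • (bend (b l x) ≫ cobend j (a l x))) ≫
        bend (b l y) = pdim k j (V i) • bend (b l y) := by
      intro y
      rw [Preadditive.sum_comp, Finset.sum_eq_single l]
      · simp only [Preadditive.sum_comp, Linear.smul_comp, Category.assoc, ← Linear.comp_smul,
          key]
        rw [Finset.sum_eq_single y]
        · simp
        · intro x _ hxy
          simp [hxy]
        · simp
      · intro l' _ hl'
        simp [Preadditive.sum_comp, hV.eq_zero hl']
      · intro h
        exact absurd (mem_irrIn.2 hl) h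
    rw [ht, Preadditive.comp_sum, Preadditive.comp_sum]
    refine Finset.sum_congr rfl fun y _ => ?_
    rw [Linear.comp_smul, h5]
    rw [Linear.smul_comp, Category.id_comp, smul_comm]
  · have : f = 0 := by
      by_contra hf
      exact hl (prop_simple_of_ne_zero hV hf (ObjectProperty.prop_tensor hX hi))
    rw [this, comp_zero, comp_zero]

/-- Handle slide: the regular element of the subcategory `P`, placed to the left of an object of
`P`, may be slid to the right. -/
theorem handle_slide (hV : SemisimpleBasis k V) (hj : j.IsSpherical) {X : C} (hX : P X) {A : C}
    (r : ∀ U, A ⊗ U ⟶ U) (hr : ∀ {U U' : C} (f : U ⟶ U'), A ◁ f ≫ r U' = r U ≫ f) :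
    ∑ i ∈ irrIn V P, pdim k j (V i) • ptr (j.ev (V i)) ((α_ A X (V i)).hom ≫ r (X ⊗ V i)) =
      (∑ l ∈ irrIn V P, pdim k j (V l) • (mate (r (V l)) ≫ j.ev (V l))) ▷ X ≫ (λ_ X).hom := by
  have hW := hV.rightDual
  choose K hK b a h1 h2 h3 using fun l => hW.decomp ((V l)ᘁ ⊗ X)
  have hempty : ∀ l ∈ irrIn V P, ∀ i ∉ irrIn V P, IsEmpty (K l i) := by
    intro l hl i hi
    refine ⟨fun x => hi (mem_irrIn.2 (prop_of_prop_dual j ?_))⟩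
    exact prop_of_retract _ _ (h2 l i x)
      (ObjectProperty.prop_tensor (IsFusionSubcategory.prop_dual (mem_irrIn.1 hl)) hX)
  -- On this side the identity of (V l)* ⊗ X is decomposed into simple objects.
  have hright : ∀ l ∈ irrIn V P, (mate (r (V l)) ≫ j.ev (V l)) ▷ X ≫ (λ_ X).hom =
      ∑ i ∈ irrIn V P, ∑ x, ptr (j.ev (V i)) (((α_ A X (V i)).hom ≫ A ◁ bend (b l i x) ≫
        r (V l)) ≫ cobend j (a l i x)) := by
    intro l hl
    simp only [ptr_action_bend_cobend]
    rw [Finset.sum_subset (Finset.subset_univ _)]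
    · simp only [← Preadditive.comp_sum, ← Preadditive.sum_comp, ← whiskerLeft_sum, h1]
      simp
    · intro i _ hi
      have := hempty l hl i hi
      simp
  -- On this side the identity of X ⊗ V i is decomposed with the bent bases. Both sides become the
  -- same double sum over i and l, with weight dim V l.
  have hleft : ∀ i ∈ irrIn V P,
      pdim k j (V i) • ptr (j.ev (V i)) ((α_ A X (V i)).hom ≫ r (X ⊗ V i)) =
      ∑ l ∈ irrIn V P, ∑ x, pdim k j (V l) • ptr (j.ev (V i)) (((α_ A X (V i)).hom ≫
        A ◁ bend (b l i x) ≫ r (V l)) ≫ cobend j (a l i x)) := by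
    intro i hi
    have h4 := sum_bend_cobend j hV hj hX (mem_irrIn.1 hi) (fun l => b l i) (fun l => a l i)
      ?_ (fun l => h2 l i) (fun l => h3 l i)
    · have h5 : ∀ (c : k) (g : X ⊗ V i ⟶ X ⊗ V i), ptr (j.ev (V i)) ((α_ A X (V i)).hom ≫
          r (X ⊗ V i) ≫ (c • g)) = c • ptr (j.ev (V i)) ((α_ A X (V i)).hom ≫
          r (X ⊗ V i) ≫ g) := by
        intro c g
        simp [ptr]
      have h6 : ∀ l x, ptr (j.ev (V i)) (((α_ A X (V i)).hom ≫
          A ◁ bend (b l i x) ≫ r (V l)) ≫ cobend j (a l i x)) =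
          ptr (j.ev (V i)) ((α_ A X (V i)).hom ≫ r (X ⊗ V i) ≫ bend (b l i x) ≫
          cobend j (a l i x)) := by
        intro l x
        rw [hr]
        simp only [Category.assoc]
      have h7 := h5 (pdim k j (V i)) (𝟙 _)
      rw [← h4, Category.comp_id] at h7
      rw [← h7]
      simp only [h6, ← h5]
      simp only [ptr, Preadditive.comp_sum, Preadditive.sum_comp, sum_whiskerRight]
    · intro l f
      have h8 : ∑ i', ∑ x, (b l i' x ≫ a l i' x) ≫ f = f := by
        simp only [← Preadditive.sum_comp, h1, Category.id_comp]
      conv_rhs => rw [← h8]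
      rw [Finset.sum_eq_single i]
      · simp
      · intro i' _ hi'
        refine Finset.sum_eq_zero fun x _ => ?_
        rw [Category.assoc, hW.eq_zero hi' (a l i' x ≫ f), comp_zero]
      · simp
  rw [Finset.sum_congr rfl hleft, sum_whiskerRight, Preadditive.sum_comp, Finset.sum_comm]
  refine Finset.sum_congr rfl fun l hl => ?_
  rw [MonoidalLinear.smul_whiskerRight, Linear.smul_comp, hright l hl, Finset.smul_sum]
  simp only [Finset.smul_sum]

end HandleSlide

/-! ### Characters -/

section Character

variable {D : Type u} [Category.{v} D] [MonoidalCategory D] [RightRigidCategory D]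
  {R : D ⥤ Center D} (adj : Center.forget D ⊣ R)

/-- The class function `A ⟶ Y ⊗ Y* ⟶ 𝟙` given by `c : Y ⊗ Y* ⟶ 𝟙`. -/
def character {Y : D} (c : Y ⊗ Yᘁ ⟶ 𝟙_ D) : CF adj := mate (action adj Y) ≫ c

/-- The action on X ⊗ Y first braids A past X and then acts on Y. This puts the condition on
cointegrals into the form treated by `handle_slide`. -/
theorem twist_character {Y : D} (c : Y ⊗ Yᘁ ⟶ 𝟙_ D) (X : D) :
    twist (centralAlg adj) (character adj c) X ≫ (ρ_ X).hom =
      ptr c ((α_ (adjAlg adj) X Y).hom ≫ action adj (X ⊗ Y)) := by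
  rw [action_tensor, ptr, twist, character, mate]
  calc _ = 𝟙 _ ⊗≫ (hb (centralAlg adj) X ▷ 𝟙_ D ≫ (X ⊗ adjAlg adj) ◁ η_ Y Yᘁ) ⊗≫
        X ◁ action adj Y ▷ Yᘁ ⊗≫ X ◁ c ⊗≫ 𝟙 _ := by monoidal
    _ = _ := by rw [← whisker_exchange]; monoidal

theorem mate_whiskerRight_leftUnitor {A X : D} (f : A ⟶ 𝟙_ D) :
    mate (f ▷ X ≫ (λ_ X).hom) = f ≫ η_ X Xᘁ := by
  rw [← comp_mate]
  simp [mate, unitors_equal]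

theorem algUnit_character {Y : D} (c : Y ⊗ Yᘁ ⟶ 𝟙_ D) :
    algUnit adj ≫ character adj c = η_ Y Yᘁ ≫ c := by
  rw [character, ← Category.assoc, comp_mate, algUnit_action]
  simp [mate, unitors_equal]

theorem toEnd_mate (f : CF adj) (Y : D) : (toEnd adj f).f ≫ mate (action adj Y) =
    mate (twist (centralAlg adj) f Y ≫ (ρ_ Y).hom) := by
  rw [comp_mate, toEnd_action]

omit [RightRigidCategory D] in
theorem toEnd_comp (f g : CF adj) :
    toEnd adj f ≫ toEnd adj g = toEnd adj ((toEnd adj f).f ≫ g) :=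
  (adj.homEquiv_naturality_left (toEnd adj f) g).symm

omit [RightRigidCategory D] in
theorem toEnd_eq_of_f_comp {g : centralAlg adj ⟶ centralAlg adj} {f : CF adj}
    (h : g.f ≫ counit adj = f) : toEnd adj f = g := by
  apply (toEnd adj).symm.injective
  rw [Equiv.symm_apply_apply, ← h]
  exact (adj.homEquiv_counit (g := g)).symm

omit [RightRigidCategory D] in
theorem toEnd_counit_eq_id : toEnd adj (counit adj) = 𝟙 _ :=
  toEnd_eq_of_f_comp adj (Category.id_comp _)

end Character

section Linear

variable {k : Type w} [Field k] {D : Type u} [Category.{v} D] [Preadditive D] [Linear k D]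
  [MonoidalCategory D] [MonoidalPreadditive D] [MonoidalLinear k D]
  {R : D ⥤ Center D} (adj : Center.forget D ⊣ R)

theorem twist_add (B : Center D) {X : D} (f g : B.1 ⟶ X) (U : D) :
    twist B (f + g) U = twist B f U + twist B g U := by
  simp [twist]

theorem twist_smul (B : Center D) {X : D} (c : k) (f : B.1 ⟶ X) (U : D) :
    twist B (c • f) U = c • twist B f U := by
  simp [twist]

theorem twist_sum (B : Center D) {X : D} {J : Type*} (s : Finset J) (f : J → (B.1 ⟶ X)) (U : D) :
    twist B (∑ x ∈ s, f x) U = ∑ x ∈ s, twist B (f x) U := by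
  simp [twist, whiskerLeft_sum, Preadditive.comp_sum]

/-- `f ↦ FR(f) ∘ δ` as a linear map. -/
def toEndLinear [HasFiniteBiproducts D] [RigidCategory D] {ι : Type} [Fintype ι] {V : ι → D}
    (hV : SemisimpleBasis k V) : CF adj →ₗ[k] (adjAlg adj ⟶ adjAlg adj) where
  toFun f := (toEnd adj f).f
  map_add' f g := by
    apply adjAlg_hom_ext adj (hV.isUniversal_counit adj (𝟙_ D))
    intro i
    rw [MonoidalPreadditive.add_whiskerRight, Preadditive.add_comp]
    simp only [toEnd_action, twist_add, Preadditive.add_comp]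
  map_smul' c f := by
    apply adjAlg_hom_ext adj (hV.isUniversal_counit adj (𝟙_ D))
    intro i
    rw [RingHom.id_apply, MonoidalLinear.smul_whiskerRight, Linear.smul_comp]
    simp only [toEnd_action, twist_smul, Linear.smul_comp]

end Linear

/-! ### The regular character of a fusion subcategory and its trace -/

section RegularCharacter

variable {k : Type w} [Field k]
  {C : Type u} [Category.{v} C] [Abelian C] [Linear k C] [MonoidalCategory C]
  [MonoidalPreadditive C] [MonoidalLinear k C] [RigidCategory C] [IsFusion k C]
  {ι : Type} [Fintype ι] {V : ι → C} (j : Pivotal C) {R : C ⥤ Center C}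
  (adj : Center.forget C ⊣ R) {P : ObjectProperty C}

variable (k V P) in
/-- The class function `∑ dim (V i) χ_i`, the sum over the simple objects in `P`. -/
noncomputable def regularChar : CF adj :=
  ∑ i ∈ irrIn V P, pdim k j (V i) • character adj (j.ev (V i))

theorem globalDim_eq (hj : j.IsSpherical) :
    globalDim k j V P = ∑ i ∈ irrIn V P, pdim k j (V i) * pdim k j (V i) :=
  Finset.sum_congr rfl fun i _ => congrArg (_ * ·) (congrArg (scalar k) (hj (V i)).symm)

theorem algUnit_regularChar (hj : j.IsSpherical) :
    algUnit adj ≫ regularChar k V j adj P = globalDim k j V P • 𝟙 (𝟙_ C) := by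
  rw [globalDim_eq j hj, regularChar, Preadditive.comp_sum, Finset.sum_smul]
  refine Finset.sum_congr rfl fun i _ => ?_
  rw [Linear.comp_smul, algUnit_character, coevaluation_ev (k := k), smul_smul]

variable (hV : SemisimpleBasis k V)

include hV in
theorem twist_regularChar [IsFusionSubcategory P] (hj : j.IsSpherical) {X : C} (hX : P X) :
    twist (centralAlg adj) (regularChar k V j adj P) X ≫ (ρ_ X).hom =
      regularChar k V j adj P ▷ X ≫ (λ_ X).hom := by
  refine Eq.trans ?_ (handle_slide j hV hj hX (action adj) (action_naturality adj))
  simp only [regularChar, twist_sum, twist_smul, Preadditive.sum_comp, Linear.smul_comp,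
    twist_character]

include hV in
-- The regular character absorbs the character of any object of P, up to its dimension, as the
-- regular representation of a group does.
theorem toEnd_regularChar_character [IsFusionSubcategory P] (hj : j.IsSpherical) {X : C}
    (hX : P X) : (toEnd adj (regularChar k V j adj P)).f ≫ character adj (j.ev X) =
      pdim k j X • regularChar k V j adj P := by
  rw [character, ← Category.assoc, toEnd_mate, twist_regularChar j adj hV hj hX,
    mate_whiskerRight_leftUnitor, Category.assoc, coevaluation_ev (k := k), Linear.comp_smul,
    Category.comp_id]

include hV in
theorem toEnd_regularChar_comp [IsFusionSubcategory P] (hj : j.IsSpherical) :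
    (toEnd adj (regularChar k V j adj P)).f ≫ regularChar k V j adj P =
      globalDim k j V P • regularChar k V j adj P := by
  conv_lhs => rhs; rw [regularChar]
  rw [Preadditive.comp_sum, globalDim_eq j hj, Finset.sum_smul]
  refine Finset.sum_congr rfl fun i hi => ?_
  rw [Linear.comp_smul, toEnd_regularChar_character j adj hV hj (mem_irrIn.1 hi), smul_smul]

/-- Factor f through its image and rotate the trace: the two factors compose to zero in the other
order. -/
theorem ktrace_eq_zero_of_comp_self {X : C} {f : X ⟶ X} (h : f ≫ f = 0) :
    ktrace k j X f = 0 := by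
  have h1 : image.ι f ≫ factorThruImage f = 0 := by
    rw [← cancel_epi (factorThruImage f), ← cancel_mono (image.ι f)]
    simpa using h
  conv_lhs => rw [← image.fac f]
  rw [ktrace_comp_comm, h1, map_zero]

theorem character_of_iso_unit {X : C} (e : X ≅ 𝟙_ C) :
    character adj (j.ev X) = pdim k j X • counit adj := by
  have h1 : action adj X = counit adj ▷ X ≫ (λ_ X).hom := by
    rw [← cancel_mono e.hom, ← action_naturality, action_unit, Category.assoc,
      ← leftUnitor_naturality, ← whisker_exchange_assoc, unitors_equal, rightUnitor_naturality]
  rw [character, h1, mate_whiskerRight_leftUnitor, Category.assoc, coevaluation_ev (k := k),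
    Linear.comp_smul, Category.comp_id]

theorem hom_dual_eq_zero {X Y : C} (h : ∀ f : Y ⟶ X, f = 0) (f : 𝟙_ C ⟶ Yᘁ) (e : X ≅ 𝟙_ C) :
    f = 0 := by
  obtain ⟨g, hg⟩ := (tensorRightHomEquiv (𝟙_ C) Y Yᘁ (𝟙_ C)).surjective (f ≫ (λ_ _).inv)
  have h1 : g = 0 := by
    rw [← cancel_epi (λ_ Y).inv, ← cancel_mono e.inv, Category.assoc, h ((λ_ Y).inv ≫ g ≫ e.inv)]
    simp
  rw [← cancel_mono (λ_ _).inv, ← hg, h1]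
  simp [tensorRightHomEquiv]

/-- The endomorphism factors through κ : X* ⟶ Y* ⊗ X*. Tracing out X* turns κ into a morphism 𝟙 ⟶
Y*, which vanishes. -/
theorem ktrace_mate_ptr_eq_zero {X Y : C} (h : ∀ f : 𝟙_ C ⟶ Yᘁ, f = 0) (b : X ⊗ Y ⟶ X)
    (a : X ⟶ X ⊗ Y) : ktrace k j (X ⊗ Xᘁ) (mate (ptr (j.ev Y) ((α_ (X ⊗ Xᘁ) X Y).hom ≫
      (X ⊗ Xᘁ) ◁ b ≫ ((α_ X Xᘁ X).hom ≫ X ◁ ε_ X Xᘁ ≫ (ρ_ X).hom) ≫ a))) = 0 := by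
  obtain ⟨κ, hκ⟩ : ∃ κ : Xᘁ ⟶ Yᘁ ⊗ Xᘁ, κ = 𝟙 (Xᘁ : C) ⊗≫ (Xᘁ : C) ◁ η_ X Xᘁ ⊗≫
    (Xᘁ : C) ◁ X ◁ η_ Y Yᘁ ▷ (Xᘁ : C) ⊗≫
    (Xᘁ : C) ◁ b ▷ ((Yᘁ : C) ⊗ (Xᘁ : C)) ⊗≫ ε_ X Xᘁ ▷ ((Yᘁ : C) ⊗ (Xᘁ : C)) ⊗≫ 𝟙 _ := ⟨_, rfl⟩
  have h1 : mate (ptr (j.ev Y) ((α_ (X ⊗ Xᘁ) X Y).hom ≫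
      (X ⊗ Xᘁ) ◁ b ≫ ((α_ X Xᘁ X).hom ≫ X ◁ ε_ X Xᘁ ≫ (ρ_ X).hom) ≫ a)) =
      (X ◁ κ ≫ (α_ _ _ _).inv) ≫ (a ▷ Yᘁ ≫ (α_ _ _ _).hom ≫ X ◁ j.ev Y ≫ (ρ_ X).hom) ▷ Xᘁ := by
    rw [hκ, mate, ptr]
    monoidal
  have h2 : ptr (j.ev (Xᘁ : C)) (X ◁ κ ≫ (α_ X Yᘁ Xᘁ).inv) =
      (ρ_ X).inv ≫ X ◁ ptr (j.ev (Xᘁ : C)) ((λ_ _).hom ≫ κ) := by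
    rw [ptr, ptr]
    monoidal
  rw [h1, ktrace_tensor, ← ptr_comp, h2, h (ptr (j.ev (Xᘁ : C)) ((λ_ _).hom ≫ κ))]
  simp

include hV in
-- The trace is computed on each summand V i ⊗ (V i)* of A. That summand acts only on the V
-- i-isotypic part of V i ⊗ Y, by evaluation, and each copy of V i contributes a term of the form in
-- `ktrace_mate_ptr_eq_zero`.
theorem ktrace_toEnd_character {Y : C} (h : ∀ f : 𝟙_ C ⟶ Yᘁ, f = 0) :
    ktrace k j (adjAlg adj) (toEnd adj (character adj (j.ev Y))).f = 0 := by
  obtain ⟨s, hs1, hs2, hs3⟩ := exists_proj_splitting adj (hV.isUniversal_counit adj (𝟙_ C))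
  obtain ⟨f, hf⟩ : ∃ f : adjAlg adj ⟶ adjAlg adj, f = (toEnd adj (character adj (j.ev Y))).f :=
    ⟨_, rfl⟩
  have hfm : ∀ X, f ≫ mate (action adj X) =
      mate (ptr (j.ev Y) ((α_ (adjAlg adj) X Y).hom ≫ action adj (X ⊗ Y))) := by
    intro X
    rw [← twist_character, hf, toEnd_mate]
  rw [← hf]
  have h1 : f = ∑ i, f ≫ mate (action adj (V i)) ≫ s i := by
    rw [← Preadditive.comp_sum, hs3, Category.comp_id]
  rw [h1, map_sum]
  refine Finset.sum_eq_zero fun i _ => ?_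
  have hr : ∀ l, l ≠ i → s i ▷ V l ≫ action adj (V l) = 0 := by
    intro l hl
    apply mate_injective
    rw [← comp_mate, hs2 i l hl.symm, mate_zero]
  have hr' : s i ▷ V i ≫ action adj (V i) =
      (α_ _ _ _).hom ≫ V i ◁ ε_ (V i) (V i)ᘁ ≫ (ρ_ _).hom := by
    apply (tensorRightHomEquiv _ (V i) (V i)ᘁ (V i)).injective
    refine Eq.trans ((comp_mate _ _).symm.trans (hs1 i)) ?_
    rw [← Equiv.symm_apply_eq]
    simp [tensorRightHomEquiv]
  obtain ⟨K, _, b, a, hba, -, -⟩ := hV.decomp (V i ⊗ Y)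
  have h2 : s i ▷ (V i ⊗ Y) ≫ action adj (V i ⊗ Y) =
      ∑ x, (V i ⊗ (V i)ᘁ) ◁ b i x ≫ ((α_ _ _ _).hom ≫ V i ◁ ε_ (V i) (V i)ᘁ ≫ (ρ_ _).hom) ≫
        a i x := by
    have h3 : ∀ l x, (s i ▷ (V i ⊗ Y) ≫ action adj (V i ⊗ Y)) ≫ b l x ≫ a l x =
        (V i ⊗ (V i)ᘁ) ◁ b l x ≫ (s i ▷ V l ≫ action adj (V l)) ≫ a l x := by
      intro l x
      rw [Category.assoc, ← action_naturality_assoc, Category.assoc, whisker_exchange_assoc]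
    rw [← Category.comp_id (s i ▷ (V i ⊗ Y) ≫ action adj (V i ⊗ Y)), ← hba]
    simp only [Preadditive.comp_sum, h3]
    rw [Finset.sum_eq_single i]
    · simp only [hr']
    · intro l _ hl
      simp [hr l hl]
    · simp
  rw [← Category.assoc, ktrace_comp_comm, hfm, comp_mate, comp_ptr]
  have h4 : s i ▷ V i ▷ Y ≫ (α_ (adjAlg adj) (V i) Y).hom ≫ action adj (V i ⊗ Y) =
      ∑ x, (α_ (V i ⊗ (V i)ᘁ) (V i) Y).hom ≫ (V i ⊗ (V i)ᘁ) ◁ b i x ≫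
        ((α_ _ _ _).hom ≫ V i ◁ ε_ (V i) (V i)ᘁ ≫ (ρ_ _).hom) ≫ a i x := by
    rw [associator_naturality_left_assoc, h2, Preadditive.comp_sum]
  have h5 : ∀ g : K i → (((V i ⊗ (V i)ᘁ) ⊗ V i) ⊗ Y ⟶ V i ⊗ Y),
      ptr (j.ev Y) (∑ x, g x) = ∑ x, ptr (j.ev Y) (g x) := by
    intro g
    simp only [ptr, sum_whiskerRight, Preadditive.comp_sum, Preadditive.sum_comp]
  rw [h4, h5, mate_sum, map_sum]
  exact Finset.sum_eq_zero fun x _ => ktrace_mate_ptr_eq_zero j h _ _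

include hV in
theorem pdim_adjAlg : pdim k j (adjAlg adj) = globalDim k j V ⊤ := by
  obtain ⟨s, hs1, hs2, hs3⟩ := exists_proj_splitting adj (hV.isUniversal_counit adj (𝟙_ C))
  rw [← ktrace_id, ← hs3, map_sum, globalDim, irrIn_top]
  refine Finset.sum_congr rfl fun i _ => ?_
  rw [ktrace_comp_comm, hs1, ktrace_id, pdim_tensor]

include hV in
-- Only the unit object contributes; it gives the identity of A. The value therefore does not depend
-- on P.
theorem ktrace_toEnd_regularChar [IsFusionSubcategory P] :
    ktrace k j (adjAlg adj) (toEnd adj (regularChar k V j adj P)).f = globalDim k j V ⊤ := by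
  obtain ⟨i₀, ⟨e⟩⟩ := hV.exists_unit_iso
  have hi₀ : i₀ ∈ irrIn V P :=
    mem_irrIn.2 (IsFusionSubcategory.prop_of_mono e.hom P.prop_unit)
  have hd : pdim k j (V i₀) = 1 := (pdim_of_iso j e).trans (hV.pdim_unit j)
  change ktrace k j (adjAlg adj) (toEndLinear adj hV (regularChar k V j adj P)) = _
  rw [regularChar, map_sum, map_sum, Finset.sum_eq_single_of_mem i₀ hi₀]
  · rw [character_of_iso_unit (k := k) j adj e, hd, one_smul, one_smul, ← pdim_adjAlg j adj hV]
    change ktrace k j (adjAlg adj) (toEnd adj (counit adj)).f = _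
    rw [toEnd_counit_eq_id]
    rfl
  · intro i _ hi
    rw [map_smul, map_smul]
    refine (congrArg (_ • ·) (ktrace_toEnd_character j adj hV ?_)).trans (smul_zero _)
    exact fun f => hom_dual_eq_zero (fun g => hV.eq_zero hi g) f e

include hV in
/-- A fusion subcategory of a non-degenerate fusion category is non-degenerate. -/
theorem globalDim_ne_zero [IsFusionSubcategory P] (hj : j.IsSpherical)
    (hC : globalDim k j V ⊤ ≠ 0) : globalDim k j V P ≠ 0 := by
  have := hV.isLeftAdjoint_forget
  intro h0
  -- If dim P were 0, the regular character would give a square-zero endomorphism of A, although its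
  -- trace is dim C.
  have adj := Adjunction.ofIsLeftAdjoint (Center.forget C)
  have h1 := toEnd_regularChar_comp j adj (P := P) hV hj
  rw [h0, zero_smul] at h1
  have h2 := congrArg Center.Hom.f (toEnd_comp adj (regularChar k V j adj P)
    (regularChar k V j adj P))
  rw [h1] at h2
  have h3 : (toEnd adj (0 : CF adj)).f = 0 := (toEndLinear adj hV).map_zero
  exact hC ((ktrace_toEnd_regularChar j adj hV).symm.trans
    (ktrace_eq_zero_of_comp_self j (h2.trans h3)))

end RegularCharacter

/-! ### Fusion subcategories -/

section FusionSubcategory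

variable {C : Type u} [Category.{v} C] [Abelian C] [MonoidalCategory C] [RigidCategory C]
  {P : ObjectProperty C}

instance : IsFusionSubcategory (⊤ : ObjectProperty C) where
  prop_unit := trivial
  prop_tensor _ _ _ _ := trivial
  prop_of_mono _ _ _ := trivial
  prop_biprod _ _ := trivial
  prop_dual _ := trivial

variable [IsFusionSubcategory P]

instance : RightRigidCategory P.FullSubcategory where
  rightDual X :=
    { rightDual := ⟨X.objᘁ, IsFusionSubcategory.prop_dual X.property⟩
      exact :=
        { coevaluation' := ObjectProperty.homMk (η_ X.obj X.objᘁ)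
          evaluation' := ObjectProperty.homMk (ε_ X.obj X.objᘁ)
          coevaluation_evaluation' := by
            ext
            exact ExactPairing.coevaluation_evaluation X.obj X.objᘁ
          evaluation_coevaluation' := by
            ext
            exact ExactPairing.evaluation_coevaluation X.obj X.objᘁ } }

/-- P is closed under right duals by definition; the pivotal isomorphism of ᘁX with its double right
dual gives the left duals. -/
theorem prop_leftDual (j : Pivotal C) {X : C} (hX : P X) : P (ᘁX : C) := by
  have e : (RightRigidCategory.rightDual (ᘁX : C)).rightDual ≅ X :=
    rightDualIso (RightRigidCategory.rightDual (ᘁX : C)).exact HasLeftDual.exact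
  exact prop_of_prop_dual j (X := (ᘁX : C)) (IsFusionSubcategory.prop_of_mono e.hom hX)

/-- A fusion subcategory of a pivotal category is rigid. -/
@[reducible]
def rigidFullSubcategory (P : ObjectProperty C) [IsFusionSubcategory P] (j : Pivotal C) :
    RigidCategory P.FullSubcategory where
  leftDual X :=
    { leftDual := ⟨(ᘁX.obj : C), prop_leftDual j X.property⟩
      exact :=
        { coevaluation' := ObjectProperty.homMk (η_ (ᘁX.obj : C) X.obj)
          evaluation' := ObjectProperty.homMk (ε_ (ᘁX.obj : C) X.obj)
          coevaluation_evaluation' := by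
            ext
            exact ExactPairing.coevaluation_evaluation (ᘁX.obj : C) X.obj
          evaluation_coevaluation' := by
            ext
            exact ExactPairing.evaluation_coevaluation (ᘁX.obj : C) X.obj } }

open ZeroObject in
instance : HasFiniteBiproducts P.FullSubcategory := by
  have h0 : P (0 : C) := IsFusionSubcategory.prop_of_mono (0 : (0 : C) ⟶ 𝟙_ C) P.prop_unit
  have : HasZeroObject P.FullSubcategory := by
    refine ⟨⟨⟨0, h0⟩, ?_⟩⟩
    rw [IsZero.iff_id_eq_zero]
    exact ObjectProperty.hom_ext P ((isZero_zero C).eq_of_src _ _)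
  have : HasBinaryBiproducts P.FullSubcategory := by
    refine ⟨fun X Y => ?_⟩
    refine hasBinaryBiproduct_of_total
      { pt := ⟨X.obj ⊞ Y.obj, IsFusionSubcategory.prop_biprod X.property Y.property⟩
        fst := ObjectProperty.homMk biprod.fst
        snd := ObjectProperty.homMk biprod.snd
        inl := ObjectProperty.homMk biprod.inl
        inr := ObjectProperty.homMk biprod.inr
        inl_fst := by ext; exact biprod.inl_fst
        inl_snd := by ext; exact biprod.inl_snd
        inr_fst := by ext; exact biprod.inr_fst
        inr_snd := by ext; exact biprod.inr_snd } ?_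
    exact ObjectProperty.hom_ext P biprod.total
  have : HasFiniteProducts P.FullSubcategory := hasFiniteProducts_of_has_binary_and_terminal
  exact HasFiniteBiproducts.of_hasFiniteProducts

end FusionSubcategory

/-! ### Comparison of the adjoint algebras of C and of the subcategory -/

section Restriction

variable {k : Type w} [Field k]
  {C : Type u} [Category.{v} C] [Abelian C] [Linear k C] [MonoidalCategory C]
  [MonoidalPreadditive C] [MonoidalLinear k C] [RigidCategory C]
  {ι : Type} [Fintype ι] {V : ι → C} (j : Pivotal C)
  {P : ObjectProperty C} [IsFusionSubcategory P]

variable (V P) in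
/-- The simple objects of the subcategory `P`. -/
abbrev subFamily : {i // P (V i)} → P.FullSubcategory := fun i => ⟨V i.1, i.2⟩

variable (P) in
omit [MonoidalPreadditive C] [MonoidalLinear k C] in
open scoped Classical in
theorem SemisimpleBasis.fullSubcategory (hV : SemisimpleBasis k V) :
    SemisimpleBasis k (subFamily V P) where
  id_ne_zero i h := hV.id_ne_zero i.1
    (congrArg (fun t : subFamily V P i ⟶ subFamily V P i => t.hom) h)
  exists_smul f := by
    obtain ⟨c, hc⟩ := hV.exists_smul f.hom
    exact ⟨c, ObjectProperty.hom_ext P hc⟩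
  eq_zero h f := ObjectProperty.hom_ext P (hV.eq_zero (fun h' => h (Subtype.ext h')) f.hom)
  decomp X := by
    obtain ⟨K, _, b, a, h1, h2, h3⟩ := hV.decomp X.obj
    refine ⟨fun i => K i.1, fun i => inferInstance, fun i x => ObjectProperty.homMk (b i.1 x),
      fun i x => ObjectProperty.homMk (a i.1 x), ?_, fun i x => ObjectProperty.hom_ext P (h2 i.1 x),
      fun i x y h => ObjectProperty.hom_ext P (h3 i.1 x y h)⟩
    apply P.ι.map_injective
    simp only [Functor.map_sum]
    refine Eq.trans ?_ h1
    change ∑ i : {i // P (V i)}, ∑ x, b i.1 x ≫ a i.1 x = _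
    -- A simple object outside P is not a summand of X, because P is closed under retracts; its
    -- terms form an empty sum.
    rw [← Finset.sum_subtype (irrIn V P) (fun i => mem_irrIn) fun i => ∑ x, b i x ≫ a i x]
    refine Finset.sum_subset (Finset.subset_univ _) fun i _ hi => ?_
    have : IsEmpty (K i) :=
      ⟨fun x => hi (mem_irrIn.2 (prop_of_retract _ _ (h2 i x) X.property))⟩
    simp

variable {R : C ⥤ Center C} (adj : Center.forget C ⊣ R)
  {RD : P.FullSubcategory ⥤ Center P.FullSubcategory}
  (adjD : Center.forget P.FullSubcategory ⊣ RD)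

omit [MonoidalPreadditive C] in
theorem isRestriction_iff (q : adjAlg adj ⟶ (adjAlg adjD).obj) :
    IsRestriction adj adjD q ↔
      ∀ X : P.FullSubcategory, q ▷ X.obj ≫ (action adjD X).hom = action adj X.obj := by
  refine forall_congr' fun X => ?_
  have h : q ≫ projSub adjD X = mate (q ▷ X.obj ≫ (action adjD X).hom) := comp_mate q _
  rw [h, proj]
  exact ⟨fun h => mate_injective h, fun h => congrArg mate h⟩

omit [MonoidalCategory C] [MonoidalPreadditive C] [RigidCategory C] [IsFusionSubcategory P] in
theorem hom_sum {X Y : P.FullSubcategory} {J : Type*} (s : Finset J) (f : J → (X ⟶ Y)) :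
    (∑ x ∈ s, f x).hom = ∑ x ∈ s, (f x).hom :=
  P.ι.map_sum f s

include j in
-- A_D is the sum of the V i ⊗ (V i)* with V i in P, so q is determined by its components there;
-- decomposing X extends the defining equation to every object of P.
theorem existsUnique_isRestriction (hV : SemisimpleBasis k V) :
    ∃! q, IsRestriction adj adjD q := by
  classical
  let := rigidFullSubcategory P j
  have hVD := hV.fullSubcategory P
  have hUD := hVD.isUniversal_counit adjD (𝟙_ _)
  obtain ⟨s, hs1, hs2, hs3⟩ := exists_proj_splitting adjD hUD
  have hs1' : ∀ i, (s i).hom ≫ projSub adjD (subFamily V P i) = 𝟙 _ := fun i =>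
    congrArg (fun t : subFamily V P i ⊗ (subFamily V P i)ᘁ ⟶ _ => t.hom) (hs1 i)
  have hs2' : ∀ i l, i ≠ l → (s i).hom ≫ projSub adjD (subFamily V P l) = 0 := fun i l h =>
    congrArg (fun t : subFamily V P i ⊗ (subFamily V P i)ᘁ ⟶
      subFamily V P l ⊗ (subFamily V P l)ᘁ => t.hom) (hs2 i l h)
  have hs3' : ∑ i, projSub adjD (subFamily V P i) ≫ (s i).hom = 𝟙 (adjAlg adjD).obj := by
    have := congrArg (fun t : adjAlg adjD ⟶ adjAlg adjD => t.hom) hs3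
    exact (hom_sum _ _).symm.trans this
  refine ⟨∑ i, proj adj (V i.1) ≫ (s i).hom, ?_, fun q hq => ?_⟩
  · have h1 : ∀ l, (∑ i, proj adj (V i.1) ≫ (s i).hom) ≫ projSub adjD (subFamily V P l) =
        proj adj (V l.1) := by
      intro l
      rw [Preadditive.sum_comp, Finset.sum_eq_single l]
      · rw [Category.assoc, hs1']
        exact Category.comp_id _
      · intro i _ hi
        rw [Category.assoc, hs2' i l hi, comp_zero]
      · simp
    obtain ⟨q, hq⟩ : ∃ q, q = ∑ i, proj adj (V i.1) ≫ (s i).hom := ⟨_, rfl⟩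
    rw [← hq] at h1 ⊢
    refine (isRestriction_iff adj adjD q).2 ?_
    have h2 : ∀ l : {i // P (V i)}, q ▷ V l.1 ≫ (action adjD (subFamily V P l)).hom =
        action adj (V l.1) := fun l =>
      mate_injective ((comp_mate q (action adjD (subFamily V P l)).hom).symm.trans (h1 l))
    intro X
    obtain ⟨K, _, b, a, hba, -, -⟩ := hVD.decomp X
    have h3 : ∑ i, ∑ x, (b i x).hom ≫ (a i x).hom = 𝟙 X.obj := by
      have := congrArg (fun t : X ⟶ X => t.hom) hba
      refine Eq.trans ?_ this
      simp only [hom_sum]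
      rfl
    have h4 : ∀ i x, (q ▷ X.obj ≫ (action adjD X).hom) ≫ (b i x).hom ≫ (a i x).hom =
        action adj X.obj ≫ (b i x).hom ≫ (a i x).hom := by
      intro i x
      have h5 : (adjAlg adjD).obj ◁ (b i x).hom ≫ (action adjD (subFamily V P i)).hom =
          (action adjD X).hom ≫ (b i x).hom :=
        congrArg (fun t : adjAlg adjD ⊗ X ⟶ subFamily V P i => t.hom)
          (action_naturality adjD (b i x))
      rw [Category.assoc, ← reassoc_of% h5, ← whisker_exchange_assoc, reassoc_of% h2 i,
        action_naturality_assoc]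
    rw [← Category.comp_id (q ▷ X.obj ≫ (action adjD X).hom),
      ← Category.comp_id (action adj X.obj), ← h3]
    simp only [Preadditive.comp_sum, h4]
  · rw [← Category.comp_id q, ← hs3', Preadditive.comp_sum]
    refine Finset.sum_congr rfl fun i _ => ?_
    rw [← Category.assoc, hq]

include j in
-- A_D is a direct summand of A. Identities about A_D can thus be checked after composing with q.
theorem isSplitEpi_of_isRestriction (hV : SemisimpleBasis k V)
    {q : adjAlg adj ⟶ (adjAlg adjD).obj} (hq : IsRestriction adj adjD q) : IsSplitEpi q := by
  classical
  let := rigidFullSubcategory P j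
  have hVD := hV.fullSubcategory P
  obtain ⟨s, hs1, hs2, -⟩ := exists_proj_splitting adj (hV.isUniversal_counit adj (𝟙_ _))
  obtain ⟨sD, -, -, hs3⟩ := exists_proj_splitting adjD (hVD.isUniversal_counit adjD (𝟙_ _))
  have hs3' : ∑ i, projSub adjD (subFamily V P i) ≫ (sD i).hom = 𝟙 (adjAlg adjD).obj := by
    have := congrArg (fun t : adjAlg adjD ⟶ adjAlg adjD => t.hom) hs3
    exact (hom_sum _ _).symm.trans this
  obtain ⟨p, hp⟩ : ∃ p : (adjAlg adjD).obj ⟶ adjAlg adj,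
    p = ∑ i : {i // P (V i)}, projSub adjD (subFamily V P i) ≫ s i.1 := ⟨_, rfl⟩
  have h1 : ∀ l : {i // P (V i)}, p ≫ proj adj (V l.1) = projSub adjD (subFamily V P l) := by
    intro l
    rw [hp, Preadditive.sum_comp, Finset.sum_eq_single l]
    · rw [Category.assoc, proj, hs1]
      exact Category.comp_id _
    · intro i _ hi
      rw [Category.assoc, proj, hs2 _ _ fun h => hi (Subtype.ext h)]
      exact comp_zero
    · simp
  refine IsSplitEpi.mk' ⟨p, ?_⟩
  rw [← Category.comp_id (p ≫ q), ← hs3', Preadditive.comp_sum]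
  refine Finset.sum_congr rfl fun i _ => ?_
  have h2 : (p ≫ q) ≫ projSub adjD (subFamily V P i) = projSub adjD (subFamily V P i) := by
    rw [Category.assoc, hq, h1]
  exact (Category.assoc _ _ _).symm.trans (congrArg (· ≫ (sD i).hom) h2)

variable (k V) in
open scoped Classical in
/-- The class function `∑ dim (V i) χ_i` of the subcategory `P`. -/
noncomputable def subRegularChar [IsFusion k C] : CF adjD :=
  ∑ i : {i // P (V i)}, pdim k j (V i.1) • character adjD (Y := subFamily V P i)
    (ObjectProperty.homMk (j.ev (V i.1)))

omit [MonoidalCategory C] [MonoidalPreadditive C] [MonoidalLinear k C] [RigidCategory C]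
  [IsFusionSubcategory P] in
theorem smul_hom {X Y : P.FullSubcategory} (c : k) (f : X ⟶ Y) : (c • f).hom = c • f.hom := rfl

variable [IsFusion k C]

theorem restrict_subRegularChar {q : adjAlg adj ⟶ (adjAlg adjD).obj}
    (hq : IsRestriction adj adjD q) :
    restrict adj adjD q (subRegularChar k V j adjD) = regularChar k V j adj P := by
  classical
  rw [restrict, subRegularChar, hom_sum, Preadditive.comp_sum, regularChar,
    Finset.sum_subtype (irrIn V P) fun i => mem_irrIn]
  refine Finset.sum_congr rfl fun i _ => ?_
  rw [smul_hom, Linear.comp_smul]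
  congr 1
  change q ≫ projSub adjD (subFamily V P i) ≫ j.ev (V i.1) = _
  rw [← Category.assoc, hq]
  rfl

theorem algUnit_subRegularChar (hj : j.IsSpherical) :
    algUnit adjD ≫ subRegularChar k V j adjD = globalDim k j V P • 𝟙 (𝟙_ P.FullSubcategory) := by
  classical
  rw [globalDim_eq j hj, subRegularChar, Preadditive.comp_sum, Finset.sum_smul,
    Finset.sum_subtype (irrIn V P) fun i => mem_irrIn]
  refine Finset.sum_congr rfl fun i _ => ?_
  rw [Linear.comp_smul, algUnit_character, ← smul_smul]
  congr 1
  exact ObjectProperty.hom_ext P (coevaluation_ev (k := k) j (V i.1))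

/-- Composed with the split epimorphism q ▷ X, the cointegral equation of the subcategory becomes
`twist_regularChar` in C, so the handle slide is needed only there. -/
theorem isCointegral_subRegularChar (hV : SemisimpleBasis k V) (hj : j.IsSpherical) :
    IsCointegral adjD (subRegularChar k V j adjD) := by
  classical
  let := rigidFullSubcategory P j
  have hVD := hV.fullSubcategory P
  have := hV.isLeftAdjoint_forget
  have adj := Adjunction.ofIsLeftAdjoint (Center.forget C)
  obtain ⟨q, hq, -⟩ := existsUnique_isRestriction j adj adjD hV
  have hepi := isSplitEpi_of_isRestriction j adj adjD hV hq
  have hqf := restrict_subRegularChar (k := k) (V := V) j adj adjD hq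
  have hq' := (isRestriction_iff adj adjD q).1 hq
  rw [isCointegral_iff adjD (hVD.isUniversal_counit adjD (𝟙_ _))]
  intro X
  have h1 : ∀ i : {i // P (V i)}, q ▷ X.obj ≫ (twist (centralAlg adjD)
      (character adjD (Y := subFamily V P i) (ObjectProperty.homMk (j.ev (V i.1)))) X ≫
      (ρ_ X).hom).hom = twist (centralAlg adj) (character adj (j.ev (V i.1))) X.obj ≫
      (ρ_ X.obj).hom := by
    intro i
    rw [twist_character, twist_character]
    change q ▷ X.obj ≫ ptr (j.ev (V i.1)) ((α_ (adjAlg adjD).obj X.obj (V i.1)).hom ≫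
      (action adjD (X ⊗ subFamily V P i)).hom) = _
    rw [comp_ptr, associator_naturality_left_assoc]
    exact congrArg (fun t => ptr (j.ev (V i.1)) ((α_ _ _ _).hom ≫ t))
      (hq' (X ⊗ subFamily V P i))
  have h2 : q ▷ X.obj ≫ (twist (centralAlg adjD) (subRegularChar k V j adjD) X ≫
      (ρ_ X).hom).hom = twist (centralAlg adj) (regularChar k V j adj P) X.obj ≫
      (ρ_ X.obj).hom := by
    have h0 : regularChar k V j adj P =
        ∑ i : {i // P (V i)}, pdim k j (V i.1) • character adj (j.ev (V i.1)) :=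
      Finset.sum_subtype (irrIn V P) (fun i => mem_irrIn) _
    rw [subRegularChar, h0]
    simp only [twist_sum, twist_smul, Preadditive.sum_comp, Linear.smul_comp, hom_sum,
      Preadditive.comp_sum, smul_hom, Linear.comp_smul, h1]
  have hepi' : IsSplitEpi (q ▷ X.obj) := IsSplitEpi.mk' ⟨section_ q ▷ X.obj, by
    rw [← comp_whiskerRight, IsSplitEpi.id, id_whiskerRight]⟩
  apply ObjectProperty.hom_ext
  rw [← cancel_epi (q ▷ X.obj), h2, twist_regularChar j adj hV hj X.property, ← hqf]
  change (q ≫ (subRegularChar k V j adjD).hom) ▷ X.obj ≫ _ =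
    q ▷ X.obj ≫ (subRegularChar k V j adjD).hom ▷ X.obj ≫ _
  rw [comp_whiskerRight, Category.assoc]
  rfl

end Restriction

/-! ### Normalization of cointegrals and their explicit form -/

section IdempotentCointegral

variable {k : Type w} [Field k] {D : Type u} [Category.{v} D] [Preadditive D] [Linear k D]
  [MonoidalCategory D] {ι : Type} [Fintype ι] {V : ι → D}
  {R : D ⥤ Center D} (adj : Center.forget D ⊣ R)

/-- A cointegral satisfies l ⋆ l = ⟨l, u⟩ l, so for nonzero l idempotency means ⟨l, u⟩ = 1. -/
theorem isIdempotentCointegral_iff (hV : SemisimpleBasis k V) {i : ι} (e : V i ≅ 𝟙_ D)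
    (l : CF adj) : IsIdempotentCointegral adj l ↔ IsNormalizedCointegral adj l := by
  have h1 : IsCointegral adj l → classMul adj l l = l ≫ algUnit adj ≫ l := fun h =>
    (congrArg (· ≫ l) h).trans (Category.assoc _ _ _)
  constructor
  · rintro ⟨h2, h3, h4⟩
    refine ⟨h2, ?_⟩
    obtain ⟨c, hc⟩ := hV.exists_smul (e.hom ≫ (algUnit adj ≫ l) ≫ e.inv)
    have h5 : algUnit adj ≫ l = c • 𝟙 (𝟙_ D) := by
      rw [← cancel_mono e.inv, ← cancel_epi e.hom, hc]
      simp
    rw [h1 h2, h5, Linear.comp_smul, Category.comp_id] at h3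
    have h6 : (c - 1) • l = 0 := by rw [sub_smul, one_smul, h3, sub_self]
    rw [h5, sub_eq_zero.1 ((smul_eq_zero.1 h6).resolve_right h4), one_smul]
  · rintro ⟨h2, h3⟩
    refine ⟨h2, by rw [h1 h2, h3, Category.comp_id], fun h4 => hV.id_ne_zero i ?_⟩
    rw [← e.hom_inv_id, ← Category.comp_id e.hom, ← h3, h4]
    simp

theorem isCointegral_smul [MonoidalPreadditive D] [MonoidalLinear k D] [HasFiniteBiproducts D]
    [RigidCategory D] (hV : SemisimpleBasis k V) (c : k) {l : CF adj} (hl : IsCointegral adj l) :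
    IsCointegral adj (c • l) := by
  rw [isCointegral_iff adj (hV.isUniversal_counit adj (𝟙_ D))] at hl ⊢
  intro X
  rw [twist_smul, Linear.smul_comp, hl, MonoidalLinear.smul_whiskerRight, Linear.smul_comp]

end IdempotentCointegral

section Cointegral

variable {k : Type w} [Field k]
  {C : Type u} [Category.{v} C] [Abelian C] [Linear k C] [MonoidalCategory C]
  [MonoidalPreadditive C] [MonoidalLinear k C] [RigidCategory C] [IsFusion k C]
  {ι : Type} [Fintype ι] {V : ι → C} (j : Pivotal C) {R : C ⥤ Center C}
  (adj : Center.forget C ⊣ R) {P : ObjectProperty C} [IsFusionSubcategory P]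
  {RD : P.FullSubcategory ⥤ Center P.FullSubcategory}
  (adjD : Center.forget P.FullSubcategory ⊣ RD)

theorem isNormalizedCointegral_regularChar (hV : SemisimpleBasis k V) (hj : j.IsSpherical)
    (hC : globalDim k j V ⊤ ≠ 0) : IsNormalizedCointegral adj
      ((globalDim k j V ⊤)⁻¹ • regularChar k V j adj ⊤) := by
  refine ⟨isCointegral_smul adj hV _ ?_, ?_⟩
  · rw [isCointegral_iff adj (hV.isUniversal_counit adj (𝟙_ C))]
    exact fun X => twist_regularChar j adj hV hj trivial
  · rw [Linear.comp_smul, algUnit_regularChar j adj hj, smul_smul, inv_mul_cancel₀ hC, one_smul]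

theorem isIdempotentCointegral_iff_eq (hV : SemisimpleBasis k V) (hj : j.IsSpherical)
    (hC : globalDim k j V ⊤ ≠ 0) (l : CF adjD) : IsIdempotentCointegral adjD l ↔
      l = (globalDim k j V P)⁻¹ • subRegularChar k V j adjD := by
  classical
  let := rigidFullSubcategory P j
  have hVD := hV.fullSubcategory P
  have hP := globalDim_ne_zero (P := P) j hV hj hC
  obtain ⟨i₀, ⟨e⟩⟩ := hV.exists_unit_iso
  have hi₀ : P (V i₀) := IsFusionSubcategory.prop_of_mono e.hom P.prop_unit
  let e' : subFamily V P ⟨i₀, hi₀⟩ ≅ 𝟙_ P.FullSubcategory := P.isoMk e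
  have h : IsNormalizedCointegral adjD
      ((globalDim k j V P)⁻¹ • subRegularChar k V j adjD) := by
    refine ⟨isCointegral_smul adjD hVD _ (isCointegral_subRegularChar j adjD hV hj), ?_⟩
    rw [Linear.comp_smul, algUnit_subRegularChar j adjD hj, smul_smul, inv_mul_cancel₀ hP,
      one_smul]
  rw [isIdempotentCointegral_iff adjD hVD e']
  exact ⟨fun hl => hl.unique adjD hVD e' h, fun hl => hl ▸ h⟩

theorem isNormalizedCointegral_iff_eq (hV : SemisimpleBasis k V) (hj : j.IsSpherical)
    (hC : globalDim k j V ⊤ ≠ 0) (l : CF adj) : IsNormalizedCointegral adj l ↔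
      l = (globalDim k j V ⊤)⁻¹ • regularChar k V j adj ⊤ := by
  obtain ⟨i₀, ⟨e⟩⟩ := hV.exists_unit_iso
  have h := isNormalizedCointegral_regularChar j adj hV hj hC
  exact ⟨fun hl => hl.unique adj hV e h, fun hl => hl ▸ h⟩

end Cointegral

/-! ### The Fourier transform -/

section BasisTransfer

variable {k : Type w} [Field k] {D : Type u} [Category.{v} D] [Preadditive D] [Linear k D]
  {ι : Type} [Fintype ι] {V W : ι → D}

theorem SemisimpleBasis.of_iso (hV : SemisimpleBasis k V) (e : ∀ i, W i ≅ V i) :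
    SemisimpleBasis k W where
  id_ne_zero i h := hV.id_ne_zero i (by
    rw [← (e i).inv_hom_id, ← Category.id_comp (e i).hom, h, zero_comp, comp_zero])
  exists_smul {i} f := by
    obtain ⟨c, hc⟩ := hV.exists_smul ((e i).inv ≫ f ≫ (e i).hom)
    refine ⟨c, ?_⟩
    rw [← cancel_mono (e i).hom, ← cancel_epi (e i).inv, hc]
    simp
  eq_zero {i l} h f := by
    have h1 := hV.eq_zero h ((e i).inv ≫ f ≫ (e l).hom)
    rw [← cancel_mono (e l).hom, ← cancel_epi (e i).inv, h1]
    simp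
  decomp X := by
    obtain ⟨K, _, b, a, h1, h2, h3⟩ := hV.decomp X
    refine ⟨K, inferInstance, fun i x => b i x ≫ (e i).inv, fun i x => (e i).hom ≫ a i x, ?_,
      fun i x => ?_, fun i x y h => ?_⟩
    · simpa using h1
    · rw [Category.assoc, ← Category.assoc (a i x), h2, Category.id_comp, Iso.hom_inv_id]
    · rw [Category.assoc, ← Category.assoc (a i x), h3 i x y h, zero_comp, comp_zero]

theorem SemisimpleBasis.exists_iso (hV : SemisimpleBasis k V) (hW : SemisimpleBasis k W) (l : ι) :
    ∃ i, Nonempty (V i ≅ W l) := by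
  obtain ⟨K, _, b, a, h1, h2, -⟩ := hV.decomp (W l)
  have : ∃ i x, b i x ≫ a i x ≠ 0 := by
    by_contra hcon
    push Not at hcon
    exact hW.id_ne_zero l (h1.symm.trans (Finset.sum_eq_zero fun i _ =>
      Finset.sum_eq_zero fun x _ => hcon i x))
  obtain ⟨i, x, hx⟩ := this
  obtain ⟨c, hc⟩ := hW.exists_smul (b i x ≫ a i x)
  have hc0 : c ≠ 0 := by
    rintro rfl
    exact hx (by rw [hc, zero_smul])
  have h3 : a i x = c • a i x := by
    have : a i x ≫ b i x ≫ a i x = c • a i x := by rw [hc, Linear.comp_smul, Category.comp_id]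
    rwa [← Category.assoc, h2, Category.id_comp] at this
  have h4 : (1 - c) • 𝟙 (V i) = 0 := by
    rw [← h2 i x, sub_smul, one_smul, ← Linear.smul_comp, ← h3, sub_self]
  have h5 : c = 1 := (sub_eq_zero.1 ((smul_eq_zero.1 h4).resolve_right (hV.id_ne_zero i))).symm
  exact ⟨i, ⟨⟨a i x, b i x, h2 i x, by rw [hc, h5, one_smul]⟩⟩⟩

/-- The pivotal structure identifies left duals with right duals. Left duals matter because the
antipode is defined through them. -/
theorem SemisimpleBasis.leftDual [MonoidalCategory D] [MonoidalPreadditive D]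
    [MonoidalLinear k D] [RigidCategory D] (j : Pivotal D) (hV : SemisimpleBasis k V) :
    SemisimpleBasis k fun i => (ᘁ(V i) : D) := by
  refine hV.rightDual.of_iso fun i => ?_
  let e : (RightRigidCategory.rightDual (ᘁ(V i) : D)).rightDual ≅ V i :=
    rightDualIso (RightRigidCategory.rightDual (ᘁ(V i) : D)).exact HasLeftDual.exact
  refine j.iso (ᘁ(V i) : D) ≪≫ ⟨e.invᘁ, e.homᘁ, ?_, ?_⟩
  · rw [← comp_rightAdjointMate, Iso.hom_inv_id, rightAdjointMate_id]
  · rw [← comp_rightAdjointMate, Iso.inv_hom_id, rightAdjointMate_id]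

end BasisTransfer

section Fourier

variable {k : Type w} [Field k]
  {C : Type u} [Category.{v} C] [Abelian C] [Linear k C] [MonoidalCategory C]
  [MonoidalPreadditive C] [MonoidalLinear k C] [RigidCategory C] [IsFusion k C]
  {ι : Type} [Fintype ι] {V : ι → C} (j : Pivotal C) {R : C ⥤ Center C}
  (adj : Center.forget C ⊣ R) {P : ObjectProperty C}

omit [IsFusion k C] in
theorem SemisimpleBasis.eq_smul_ev (hV : SemisimpleBasis k V) {i : ι}
    (f : V i ⊗ (V i)ᘁ ⟶ 𝟙_ C) : ∃ c : k, f = c • j.ev (V i) := by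
  let e := @tensorRightHomEquiv C _ _ (V i) (V i)ᘁ (V i) (𝟙_ C) (j.exactPairing (V i))
  obtain ⟨g, rfl⟩ := e.symm.surjective f
  obtain ⟨c, hc⟩ := hV.exists_smul (g ≫ (λ_ (V i)).hom)
  have hg : g = c • (λ_ (V i)).inv := by
    rw [← cancel_mono (λ_ (V i)).hom, hc]
    simp
  refine ⟨c, ?_⟩
  change g ▷ (V i)ᘁ ≫ (α_ _ _ _).hom ≫ (𝟙_ C) ◁ j.ev (V i) ≫ (ρ_ _).hom = _
  rw [hg]
  simp [MonoidalLinear.smul_whiskerRight, ← unitors_equal]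

omit [IsFusion k C] in
-- The χ_i span CF(C): A is the sum of the V i ⊗ (V i)*, and each Hom(V i ⊗ (V i)*, 𝟙) is the line
-- of the pivotal evaluation. Their independence is `sum_character_injective`.
theorem exists_eq_sum_character (hV : SemisimpleBasis k V) (f : CF adj) :
    ∃ c : ι → k, f = ∑ i, c i • character adj (j.ev (V i)) := by
  obtain ⟨s, -, -, hs⟩ := exists_proj_splitting adj (hV.isUniversal_counit adj (𝟙_ C))
  choose c hc using fun i => hV.eq_smul_ev j (s i ≫ f)
  refine ⟨c, ?_⟩
  rw [← Category.id_comp f, ← hs, Preadditive.sum_comp]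
  refine Finset.sum_congr rfl fun i _ => ?_
  rw [Category.assoc, hc, Linear.comp_smul, character]

omit [IsFusion k C] in
theorem sum_character_injective (hV : SemisimpleBasis k V) {c c' : ι → k}
    (h : ∑ i, c i • character adj (j.ev (V i)) = ∑ i, c' i • character adj (j.ev (V i))) :
    c = c' := by
  obtain ⟨s, hs1, hs2, -⟩ := exists_proj_splitting adj (hV.isUniversal_counit adj (𝟙_ C))
  have h1 : ∀ (c : ι → k) l,
      s l ≫ ∑ i, c i • character adj (j.ev (V i)) = c l • j.ev (V l) := by
    intro c l
    rw [Preadditive.comp_sum, Finset.sum_eq_single l]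
    · rw [Linear.comp_smul, character, ← Category.assoc, hs1, Category.id_comp]
    · intro i _ hi
      rw [Linear.comp_smul, character, ← Category.assoc, hs2 l i hi.symm, zero_comp, smul_zero]
    · simp
  funext l
  have h2 := congrArg (s l ≫ ·) h
  simp only [h1] at h2
  have h3 : (c l - c' l) • j.ev (V l) = 0 := by rw [sub_smul, h2, sub_self]
  exact sub_eq_zero.1 ((smul_eq_zero.1 h3).resolve_right (ev_ne_zero j (hV.id_ne_zero l)))

omit [IsFusion k C] in
/-- Left multiplication by a central element multiplies characters by scalars. -/
theorem algMul_character (b : CE adj) {X : C} {c : k} (h : (psi adj b).app X = c • 𝟙 X)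
    (t : X ⊗ Xᘁ ⟶ 𝟙_ C) : (λ_ (adjAlg adj)).inv ≫ b ▷ adjAlg adj ≫ algMul adj ≫
      character adj t = c • character adj t := by
  have h1 : ((λ_ (adjAlg adj)).inv ≫ b ▷ adjAlg adj ≫ algMul adj) ▷ X ≫ action adj X =
      action adj X ≫ (c • 𝟙 X) := by
    rw [← h, psi_app]
    simp only [comp_whiskerRight, Category.assoc]
    rw [algMul_action]
    calc _ = 𝟙 _ ⊗≫ (b ▷ (adjAlg adj ⊗ X) ≫ adjAlg adj ◁ action adj X) ≫ action adj X := by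
          monoidal
      _ = _ := by rw [← whisker_exchange]; monoidal
  have h2 : ((λ_ (adjAlg adj)).inv ≫ b ▷ adjAlg adj ≫ algMul adj) ≫ mate (action adj X) =
      c • mate (action adj X) := by
    rw [comp_mate, h1, mate_comp, MonoidalLinear.smul_whiskerRight, id_whiskerRight,
      Linear.comp_smul, Category.comp_id]
  have h3 := congrArg (· ≫ t) h2
  simpa [character] using h3

omit [IsFusion k C] in
theorem psi_antipode (hV : SemisimpleBasis k V) (a : CE adj) :
    psi adj (antipode adj a) = dualEnd (psi adj a) := by
  have : Nonempty (CE adj) := ⟨algUnit adj⟩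
  exact Function.rightInverse_invFun
    (psi_bijective adj hV (hV.isUniversal_counit adj (𝟙_ C))).surjective _

omit [IsFusion k C] in
theorem dualEnd_app_smul (ξ : End (𝟭 C)) {X : C} {c : k}
    (h : ξ.app (ᘁX : C) = c • 𝟙 (ᘁX : C)) : (dualEnd ξ).app X = c • 𝟙 X := by
  change @rightAdjointMate C _ _ (ᘁX : C) (ᘁX : C) hasRightDualLeftDual hasRightDualLeftDual
    (ξ.app (ᘁX : C)) = _
  rw [h]
  refine (@rightAdjointMate_smul k _ C _ _ _ _ _ _ (ᘁX : C) (ᘁX : C) hasRightDualLeftDual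
    hasRightDualLeftDual c (𝟙 _)).trans (congrArg (c • ·) ?_)
  exact @rightAdjointMate_id C _ _ (ᘁX : C) hasRightDualLeftDual

omit [IsFusion k C] in
-- Multiplication by S(a) rescales χ_i by the scalar of S(a) on V i, which is the scalar of a on ᘁ(V
-- i).
theorem fourier_sum_character (hV : SemisimpleBasis k V) (y c : ι → k) (a : CE adj)
    (h : ∀ i, (psi adj a).app (ᘁ(V i) : C) = c i • 𝟙 (ᘁ(V i) : C)) :
    fourier adj (∑ i, y i • character adj (j.ev (V i))) a =
      ∑ i, (c i * y i) • character adj (j.ev (V i)) := by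
  simp only [fourier, Preadditive.comp_sum, Linear.comp_smul]
  refine Finset.sum_congr rfl fun i _ => ?_
  rw [algMul_character adj (antipode adj a) (c := c i), smul_smul, mul_comm]
  rw [psi_antipode adj hV]
  exact dualEnd_app_smul _ (h i)

omit [IsFusion k C] in
theorem fourier_bijective (hV : SemisimpleBasis k V) {y : ι → k} (hy : ∀ i, y i ≠ 0) :
    Function.Bijective (fourier adj (∑ i, y i • character adj (j.ev (V i)))) := by
  have hL := hV.leftDual j
  have hpsi := psi_bijective adj hV (hV.isUniversal_counit adj (𝟙_ C))
  constructor
  · intro a b hab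
    choose c hc using fun i => hL.exists_smul ((psi adj a).app (ᘁ(V i) : C))
    choose c' hc' using fun i => hL.exists_smul ((psi adj b).app (ᘁ(V i) : C))
    rw [fourier_sum_character j adj hV y c a hc, fourier_sum_character j adj hV y c' b hc'] at hab
    have h1 := sum_character_injective j adj hV hab
    refine hpsi.injective (hL.natTrans_ext fun i => ?_)
    rw [hc, hc', mul_right_cancel₀ (hy i) (congrFun h1 i)]
  · intro f
    obtain ⟨c, rfl⟩ := exists_eq_sum_character j adj hV f
    obtain ⟨ξ, hξ⟩ := hL.exists_natTrans (𝟭 C) (𝟭 C) fun i => (c i / y i) • 𝟙 (ᘁ(V i) : C)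
    obtain ⟨a, rfl⟩ := hpsi.surjective ξ
    refine ⟨a, ?_⟩
    rw [fourier_sum_character j adj hV y _ a hξ]
    exact Finset.sum_congr rfl fun i _ => by rw [div_mul_cancel₀ _ (hy i)]

open scoped Classical in
omit [Abelian C] [Linear k C] [MonoidalLinear k C] [IsFusion k C] [Fintype ι] in
theorem psi_centralIdempotent [Preadditive C] [MonoidalPreadditive C] {i : ι} {e : CE adj}
    (he : IsCentralIdempotent adj V i e) (l : ι) :
    (psi adj e).app (V l) = if l = i then 𝟙 (V l) else 0 := by
  obtain ⟨h1, h2⟩ := he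
  rw [psi_app]
  have h3 : η_ (V i) ((V i)ᘁ) = mate (λ_ (V i)).hom := by simp [mate, unitors_equal]
  simp only [proj, comp_mate] at h1 h2
  split_ifs with h
  · subst h
    rw [mate_injective (h1.trans h3), Iso.inv_hom_id]
  · rw [mate_injective ((h2 l h).trans (mate_zero _ _).symm), comp_zero]

omit [IsFusion k C] in
omit [RigidCategory C] in
theorem psi_sum {J : Type*} (s : Finset J) (a : J → CE adj) (X : C) :
    (psi adj (∑ x ∈ s, a x)).app X = ∑ x ∈ s, (psi adj (a x)).app X := by
  simp only [psi_app, sum_whiskerRight, Preadditive.sum_comp, Preadditive.comp_sum]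

omit [IsFusion k C] in
omit [RigidCategory C] in
theorem psi_smul (c : k) (a : CE adj) (X : C) :
    (psi adj (c • a)).app X = c • (psi adj a).app X := by
  simp only [psi_app, MonoidalLinear.smul_whiskerRight, Linear.smul_comp, Linear.comp_smul]

open scoped Classical in
theorem psi_sum_centralIdempotent {E : ι → CE adj}
    (hE : ∀ i, IsCentralIdempotent adj V i (E i)) (l : ι) :
    (psi adj (∑ i ∈ irrIn V P, E i)).app (V l) = if P (V l) then 𝟙 (V l) else 0 := by
  rw [psi_sum]
  simp only [psi_centralIdempotent adj (hE _), Finset.sum_ite_eq, mem_irrIn]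

omit [IsFusion k C] in
omit [MonoidalCategory C] [MonoidalPreadditive C] [MonoidalLinear k C] [RigidCategory C] in
theorem psi_app_of_iso (ξ : End (𝟭 C)) {X Y : C} (e : X ≅ Y) {c : k} (h : ξ.app X = c • 𝟙 X) :
    ξ.app Y = c • 𝟙 Y := by
  have h1 := ξ.naturality e.hom
  dsimp only [Functor.id_obj, Functor.id_map] at h1
  rw [← cancel_epi e.hom, h1, h]
  simp

variable [IsFusionSubcategory P]

omit [MonoidalPreadditive C] in
theorem prop_of_prop_leftDual {X : C} (h : P (ᘁX : C)) : P X := by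
  have e : (RightRigidCategory.rightDual (ᘁX : C)).rightDual ≅ X :=
    rightDualIso (RightRigidCategory.rightDual (ᘁX : C)).exact HasLeftDual.exact
  exact IsFusionSubcategory.prop_of_mono e.inv (IsFusionSubcategory.prop_dual h)

include j in
open scoped Classical in
omit [IsFusion k C] in
-- Since P is closed under duals, the antipode leaves no trace: the sum of the E_i over P acts on
-- the left dual of V l by the same scalar as on V l.
theorem psi_sum_centralIdempotent_leftDual (hV : SemisimpleBasis k V) {E : ι → CE adj}
    (hE : ∀ i, IsCentralIdempotent adj V i (E i)) (l : ι) :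
    (psi adj (∑ i ∈ irrIn V P, E i)).app (ᘁ(V l) : C) =
      (if P (V l) then 1 else 0 : k) • 𝟙 (ᘁ(V l) : C) := by
  obtain ⟨i, ⟨e⟩⟩ := hV.exists_iso (hV.leftDual j) l
  have h1 : P (V i) ↔ P (V l) :=
    ⟨fun h => prop_of_prop_leftDual (IsFusionSubcategory.prop_of_mono e.inv h),
      fun h => IsFusionSubcategory.prop_of_mono e.hom (prop_leftDual j h)⟩
  refine psi_app_of_iso _ e ?_
  rw [psi_sum_centralIdempotent adj hE]
  simp only [h1, ite_smul, one_smul, zero_smul]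

omit [IsFusionSubcategory P] in
theorem smul_regularChar_top (c : k) : c • regularChar k V j adj ⊤ =
    ∑ i, (c * pdim k j (V i)) • character adj (j.ev (V i)) := by
  rw [regularChar, irrIn_top, Finset.smul_sum]
  simp only [smul_smul]

theorem fourier_sum_centralIdempotent (hV : SemisimpleBasis k V) {E : ι → CE adj}
    (hE : ∀ i, IsCentralIdempotent adj V i (E i)) (c c' : k) :
    fourier adj (c • regularChar k V j adj ⊤) (c' • ∑ i ∈ irrIn V P, E i) =
      (c * c') • regularChar k V j adj P := by
  classical
  rw [smul_regularChar_top, fourier_sum_character j adj hV _ (fun i => c' * if P (V i) then 1 else 0), regularChar,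
    Finset.smul_sum, ← Finset.sum_subset (Finset.subset_univ (irrIn V P))]
  · refine Finset.sum_congr rfl fun i hi => ?_
    rw [if_pos (mem_irrIn.1 hi), smul_smul]
    congr 1
    ring
  · intro i _ hi
    rw [if_neg (fun h => hi (mem_irrIn.2 h))]
    simp
  · intro i
    rw [psi_smul, psi_sum_centralIdempotent_leftDual j adj hV hE, smul_smul]

/-- Composing a central element with ε gives its action on 𝟙, and 𝟙 belongs to P. -/
theorem sum_centralIdempotent_counit (hV : SemisimpleBasis k V) {E : ι → CE adj}
    (hE : ∀ i, IsCentralIdempotent adj V i (E i)) :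
    (∑ i ∈ irrIn V P, E i) ≫ counit adj = 𝟙 (𝟙_ C) := by
  classical
  obtain ⟨i₀, ⟨e⟩⟩ := hV.exists_unit_iso
  have h1 : (psi adj (∑ i ∈ irrIn V P, E i)).app (V i₀) = (1 : k) • 𝟙 (V i₀) := by
    rw [psi_sum_centralIdempotent adj hE,
      if_pos (IsFusionSubcategory.prop_of_mono e.hom P.prop_unit), one_smul]
  have h2 := psi_app_of_iso _ e h1
  rw [psi_app, action_unit, rightUnitor_naturality_assoc] at h2
  simpa [← unitors_equal] using h2

end Fourier

/-! ### Semisimplicity of the center -/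

section Regular

variable {k : Type w} [Field k] {D : Type u} [Category.{v} D] [Preadditive D] [Linear k D]
  {ι : Type} [Fintype ι] {V : ι → D}

theorem exists_generalizedInverse {M N : Type*} [AddCommGroup M] [Module k M] [AddCommGroup N]
    [Module k N] (f : M →ₗ[k] N) : ∃ g : N →ₗ[k] M, ∀ x, f (g (f x)) = f x := by
  obtain ⟨g, hg⟩ := f.rangeRestrict.exists_rightInverse_of_surjective f.range_rangeRestrict
  obtain ⟨g', hg'⟩ := g.exists_extend
  refine ⟨g', fun x => ?_⟩
  have h1 : g' (f x) = g (f.rangeRestrict x) := LinearMap.congr_fun hg' (f.rangeRestrict x)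
  have h2 : f.rangeRestrict (g (f.rangeRestrict x)) = f.rangeRestrict x :=
    LinearMap.congr_fun hg _
  rw [h1]
  exact congrArg Subtype.val h2

/-- Morphisms of a semisimple category are von Neumann regular. -/
theorem SemisimpleBasis.exists_regular (hV : SemisimpleBasis k V) {X Y : D} (f : X ⟶ Y) :
    ∃ s : Y ⟶ X, f ≫ s ≫ f = f := by
  classical
  -- Generalized inverses are chosen on the multiplicity spaces Hom(V i, -) and assembled along a
  -- decomposition of Y.
  choose g hg using fun i => exists_generalizedInverse (Linear.rightComp k (V i) f)
  obtain ⟨K, _, b, a, h1, -, -⟩ := hV.decomp Y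
  have key : ∀ i (t : V i ⟶ Y), t ≫ (∑ l, ∑ x, b l x ≫ g l (a l x)) = g i t := by
    intro i t
    have h2 : ∀ l x, t ≫ b l x ≫ g l (a l x) = if h : l = i then
        g i (t ≫ b l x ≫ a l x) else 0 := by
      intro l x
      split_ifs with h
      · subst h
        obtain ⟨c, hc⟩ := hV.exists_smul (t ≫ b l x)
        rw [← Category.assoc, ← Category.assoc, hc]
        simp
      · rw [← Category.assoc, hV.eq_zero (Ne.symm h) (t ≫ b l x), zero_comp]
    have h3 : ∀ l, l ≠ i → ∀ x, t ≫ b l x ≫ a l x = 0 := by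
      intro l hl x
      rw [← Category.assoc, hV.eq_zero (Ne.symm hl) (t ≫ b l x), zero_comp]
    conv_rhs => rw [← Category.comp_id t, ← h1]
    simp only [Preadditive.comp_sum, map_sum]
    refine Finset.sum_congr rfl fun l _ => Finset.sum_congr rfl fun x _ => ?_
    rw [h2]
    split_ifs with h
    · rfl
    · rw [h3 l h, map_zero]
  refine ⟨∑ l, ∑ x, b l x ≫ g l (a l x), hV.hom_ext_left fun i t => ?_⟩
  rw [← Category.assoc f, ← Category.assoc t, ← Category.assoc t, key]
  exact hg i t

end Regular

section Splitting

variable {C : Type u} [Category.{v} C] [Abelian C] [MonoidalCategory C] [LeftRigidCategory C]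

/-- Idempotents split in the center of an abelian monoidal category with left duals. -/
theorem Center.exists_splitting {X : Center C} (e : X ⟶ X) (he : e ≫ e = e) :
    ∃ (Y : Center C) (p : X ⟶ Y) (i : Y ⟶ X), i ≫ p = 𝟙 Y ∧ p ≫ i = e := by
  obtain ⟨I, i, p, hip, hpi⟩ := IsIdempotentComplete.idempotents_split X.1 e.f
    (congrArg Center.Hom.f he)
  have hc : ∀ U, p ▷ U ≫ i ▷ U ≫ hb X U = hb X U ≫ U ◁ p ≫ U ◁ i := by
    intro U
    have := hb_comm e U
    rw [← hpi] at this
    simpa using this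
  have hpU : ∀ U, i ▷ U ≫ p ▷ U = 𝟙 _ := by
    intro U
    rw [← comp_whiskerRight, hip, id_whiskerRight]
  have hUp : ∀ U, U ◁ i ≫ U ◁ p = 𝟙 _ := by
    intro U
    rw [← MonoidalCategory.whiskerLeft_comp, hip, MonoidalCategory.whiskerLeft_id]
  have hp : ∀ U, p ▷ U ≫ (i ▷ U ≫ hb X U ≫ U ◁ p) = hb X U ≫ U ◁ p := by
    intro U
    rw [reassoc_of% (hc U), hUp, Category.comp_id]
  have hi : ∀ U, (i ▷ U ≫ hb X U ≫ U ◁ p) ≫ U ◁ i = i ▷ U ≫ hb X U := by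
    intro U
    rw [Category.assoc, Category.assoc, ← hc, reassoc_of% (hpU U)]
  -- The half-braiding of X is compressed to the image of e in C. Because e is central, p and i
  -- intertwine it; invertibility comes from left duals.
  obtain ⟨β, hβ⟩ : ∃ β : ∀ U, I ⊗ U ⟶ U ⊗ I, β = fun U => i ▷ U ≫ hb X U ≫ U ◁ p := ⟨_, rfl⟩
  have hp' : ∀ U, p ▷ U ≫ β U = hb X U ≫ U ◁ p := fun U => by rw [hβ]; exact hp U
  have hi' : ∀ U, β U ≫ U ◁ i = i ▷ U ≫ hb X U := fun U => by rw [hβ]; exact hi U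
  have hnat : ∀ {U U' : C} (f : U ⟶ U'), I ◁ f ≫ β U' = β U ≫ f ▷ I := by
    intro U U' f
    simp only [hβ, Category.assoc]
    rw [whisker_exchange_assoc, hb_naturality_assoc, whisker_exchange]
  have hmon : ∀ U U', β (U ⊗ U') = (α_ _ _ _).inv ≫ β U ▷ U' ≫ (α_ _ _ _).hom ≫
      U ◁ β U' ≫ (α_ _ _ _).inv := by
    intro U U'
    have h1 : β (U ⊗ U') = i ▷ (U ⊗ U') ≫ hb X (U ⊗ U') ≫ (U ⊗ U') ◁ p := by rw [hβ]
    rw [h1, hb_tensor]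
    symm
    calc _ = 𝟙 _ ⊗≫ β U ▷ U' ⊗≫ U ◁ (i ▷ U' ≫ hb X U' ≫ U' ◁ p) ⊗≫ 𝟙 _ := by
          rw [hβ]; monoidal
      _ = 𝟙 _ ⊗≫ (β U ≫ U ◁ i) ▷ U' ⊗≫ U ◁ (hb X U' ≫ U' ◁ p) ⊗≫ 𝟙 _ := by monoidal
      _ = _ := by rw [hi']; monoidal
  have hunit : β (𝟙_ C) = (ρ_ I).hom ≫ (λ_ I).inv := by
    rw [hβ]
    change i ▷ 𝟙_ C ≫ hb X (𝟙_ C) ≫ 𝟙_ C ◁ p = _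
    rw [hb_unit, Category.assoc, ← leftUnitor_inv_naturality, rightUnitor_naturality_assoc,
      reassoc_of% hip]
  have hiso := isIso_of_laxHalfBraiding β hnat hmon hunit
  let Y : Center C := ⟨I, { β := fun U => asIso (β U), monoidal := hmon, naturality := hnat }⟩
  exact ⟨Y, ⟨p, hp'⟩, ⟨i, fun U => (hi' U).symm⟩, Center.ext _ _ hip, Center.ext _ _ hpi⟩

end Splitting

/-! ### Decomposition into simple objects -/

section Decomposition

variable {Z : Type*} [Category* Z] [Preadditive Z]

/-- In a category with finite-dimensional morphism spaces and split idempotents in which every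
morphism is von Neumann regular, every object is a finite direct sum of simple objects. -/
theorem exists_simple_decomposition (k : Type*) [Field k] {D : Type*} [Category* D]
    [Preadditive D] [Linear k D] (hD : ∀ X Y : D, Module.Finite k (X ⟶ Y)) (F : Z ⥤ D)
    [F.Additive] [F.Faithful]
    (hsplit : ∀ {X : Z} (e : X ⟶ X), e ≫ e = e →
      ∃ (Y : Z) (p : X ⟶ Y) (i : Y ⟶ X), i ≫ p = 𝟙 Y ∧ p ≫ i = e)
    (hreg : ∀ {X Y : Z} (f : X ⟶ Y), ∃ s : Y ⟶ X, f ≫ s ≫ f = f) (X : Z) :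
    ∃ (K : Type) (_ : Fintype K) (S : K → Z) (b : ∀ x, X ⟶ S x) (a : ∀ x, S x ⟶ X),
      (∀ x, Simple (S x)) ∧ ∑ x, b x ≫ a x = 𝟙 X ∧ (∀ x, a x ≫ b x = 𝟙 (S x)) ∧
      ∀ x y, x ≠ y → a x ≫ b y = 0 := by
  -- Induction on the dimension of the endomorphism algebra of the image of X.
  obtain ⟨n, hn⟩ : ∃ n, n = Module.finrank k (F.obj X ⟶ F.obj X) := ⟨_, rfl⟩
  induction n using Nat.strong_induction_on generalizing X with
  | _ n ih =>
  have hzero : ∀ {Y : Z}, F.map (𝟙 Y) = 0 → 𝟙 Y = 0 := fun h =>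
    F.map_injective (h.trans (F.map_zero _ _).symm)
  by_cases hX : 𝟙 X = 0
  · exact ⟨Empty, inferInstance, Empty.elim, fun x => x.elim, fun x => x.elim, fun x => x.elim,
      by simp [hX], fun x => x.elim, fun x => x.elim⟩
  by_cases hs : Simple X
  · exact ⟨Unit, inferInstance, fun _ => X, fun _ => 𝟙 X, fun _ => 𝟙 X, fun _ => hs, by simp,
      by simp, fun x y h => (h (Subsingleton.elim _ _)).elim⟩
  -- A proper nonzero subobject splits off by regularity, and splitting the complementary idempotent
  -- gives X ≅ Y ⊕ W with both parts nonzero.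
  obtain ⟨Y, f, hf, hf0, hfi⟩ : ∃ (Y : Z) (f : Y ⟶ X), Mono f ∧ f ≠ 0 ∧ ¬ IsIso f := by
    by_contra hcon
    push Not at hcon
    exact hs ⟨fun {Y} f hf => ⟨fun hi h0 => hX (by
      rw [← IsIso.inv_hom_id f]
      exact (congrArg (inv f ≫ ·) h0).trans comp_zero), fun h0 => hcon Y f hf h0⟩⟩
  obtain ⟨s, hsf⟩ := hreg f
  have hfs : f ≫ s = 𝟙 Y := by
    rw [← cancel_mono f, Category.assoc, hsf, Category.id_comp]
  obtain ⟨W, p, i, hip, hpi⟩ := hsplit (𝟙 X - s ≫ f) (by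
    simp [Preadditive.sub_comp, Preadditive.comp_sub, hsf])
  have hfp : f ≫ p = 0 := by
    rw [← Category.comp_id p, ← hip, reassoc_of% hpi]
    simp [Preadditive.sub_comp, Preadditive.comp_sub, reassoc_of% hsf]
  have his : i ≫ s = 0 := by
    rw [← cancel_mono f, Category.assoc, zero_comp]
    have : s ≫ f = 𝟙 X - p ≫ i := by rw [hpi, sub_sub_cancel]
    rw [this, Preadditive.comp_sub, reassoc_of% hip, Category.comp_id, sub_self]
  have hsum : s ≫ f + p ≫ i = 𝟙 X := by rw [hpi, add_sub_cancel]
  have hY : 𝟙 Y ≠ 0 := fun h => hf0 (by rw [← Category.id_comp f, h, zero_comp])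
  have hW : 𝟙 W ≠ 0 := fun h => hfi (by
    have h1 : p = 0 := by rw [← Category.comp_id p, h, comp_zero]
    rw [h1, zero_comp, add_zero] at hsum
    exact ⟨s, hfs, hsum⟩)
  have hpos : ∀ {U : Z}, 𝟙 U ≠ 0 → 0 < Module.finrank k (F.obj U ⟶ F.obj U) := by
    intro U hU
    have := hD (F.obj U) (F.obj U)
    have : Nontrivial (F.obj U ⟶ F.obj U) := ⟨F.map (𝟙 U), 0, fun h => hU (hzero h)⟩
    exact Module.finrank_pos
  -- Block-diagonal endomorphisms embed in those of X; as both blocks have positive dimension, each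
  -- is strictly smaller.
  have hlt : Module.finrank k (F.obj Y ⟶ F.obj Y) + Module.finrank k (F.obj W ⟶ F.obj W) ≤
      Module.finrank k (F.obj X ⟶ F.obj X) := by
    have := hD (F.obj X) (F.obj X)
    have := hD (F.obj Y) (F.obj Y)
    have := hD (F.obj W) (F.obj W)
    rw [← Module.finrank_prod]
    refine LinearMap.finrank_le_finrank_of_injective
      (f := (Linear.rightComp k _ (F.map f) ∘ₗ Linear.leftComp k _ (F.map s)).coprod
        (Linear.rightComp k _ (F.map i) ∘ₗ Linear.leftComp k _ (F.map p))) ?_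
    have e1 : F.map f ≫ F.map s = 𝟙 _ := by rw [← F.map_comp, hfs, F.map_id]
    have e2 : F.map i ≫ F.map p = 𝟙 _ := by rw [← F.map_comp, hip, F.map_id]
    have e3 : F.map f ≫ F.map p = 0 := by rw [← F.map_comp, hfp, F.map_zero]
    have e4 : F.map i ≫ F.map s = 0 := by rw [← F.map_comp, his, F.map_zero]
    rw [← LinearMap.ker_eq_bot, LinearMap.ker_eq_bot']
    rintro ⟨y, w⟩ h
    have h' : (F.map s ≫ y) ≫ F.map f + (F.map p ≫ w) ≫ F.map i = 0 := h
    have h1 := congrArg (fun t => F.map f ≫ t ≫ F.map s) h'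
    have h2 := congrArg (fun t => F.map i ≫ t ≫ F.map p) h'
    simp only [Preadditive.add_comp, Category.assoc, e1, e2, e3, e4, reassoc_of% e1,
      reassoc_of% e2, Category.comp_id, zero_comp,
      comp_zero, add_zero, zero_add] at h1 h2
    rw [h1, h2, Prod.mk_zero_zero]
  have hY' := hpos hY
  have hW' := hpos hW
  obtain ⟨K, _, S, b, a, h1, h2, h3, h4⟩ := ih _ (by omega) Y rfl
  obtain ⟨K', _, S', b', a', h1', h2', h3', h4'⟩ := ih _ (by omega) W rfl
  have q1 : ∀ {A B : Z} (u : A ⟶ Y) (v : Y ⟶ B), (u ≫ f) ≫ s ≫ v = u ≫ v := by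
    intro A B u v
    rw [Category.assoc, reassoc_of% hfs]
  have q2 : ∀ {A B : Z} (u : A ⟶ W) (v : W ⟶ B), (u ≫ i) ≫ p ≫ v = u ≫ v := by
    intro A B u v
    rw [Category.assoc, reassoc_of% hip]
  have q3 : ∀ {A B : Z} (u : A ⟶ Y) (v : W ⟶ B), (u ≫ f) ≫ p ≫ v = 0 := by
    intro A B u v
    rw [Category.assoc, reassoc_of% hfp, zero_comp, comp_zero]
  have q4 : ∀ {A B : Z} (u : A ⟶ W) (v : Y ⟶ B), (u ≫ i) ≫ s ≫ v = 0 := by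
    intro A B u v
    rw [Category.assoc, reassoc_of% his, zero_comp, comp_zero]
  refine ⟨K ⊕ K', inferInstance, Sum.elim S S', Sum.rec (fun x => s ≫ b x) fun x => p ≫ b' x,
    Sum.rec (fun x => a x ≫ f) fun x => a' x ≫ i, Sum.rec h1 h1', ?_, ?_, ?_⟩
  · rw [Fintype.sum_sum_type, ← hsum]
    congr 1
    · trans s ≫ (∑ x, b x ≫ a x) ≫ f
      · simp [Preadditive.comp_sum, Preadditive.sum_comp]
      · rw [h2, Category.id_comp]
    · trans p ≫ (∑ x, b' x ≫ a' x) ≫ i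
      · simp [Preadditive.comp_sum, Preadditive.sum_comp]
      · rw [h2', Category.id_comp]
  · rintro (x | x)
    · exact (q1 _ _).trans (h3 x)
    · exact (q2 _ _).trans (h3' x)
  · rintro (x | x) (y | y) hxy
    · exact (q1 _ _).trans (h4 x y fun h => hxy (by rw [h]))
    · exact q3 _ _
    · exact q4 _ _
    · exact (q2 _ _).trans (h4' x y fun h => hxy (by rw [h]))

/-- The image of the idempotent is a subobject of a simple object, so no statement about its full
endomorphism ring is required. -/
theorem eq_zero_or_eq_id_of_simple
    (hsplit : ∀ {X : Z} (e : X ⟶ X), e ≫ e = e →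
      ∃ (Y : Z) (p : X ⟶ Y) (i : Y ⟶ X), i ≫ p = 𝟙 Y ∧ p ≫ i = e)
    {S : Z} [Simple S] {x : S ⟶ S} (hx : x ≫ x = x) : x = 0 ∨ x = 𝟙 S := by
  obtain ⟨Y, p, i, hip, rfl⟩ := hsplit x hx
  have : Mono i := SplitMono.mono ⟨p, hip⟩
  by_cases h : i = 0
  · exact Or.inl (by rw [h, comp_zero])
  · have := isIso_of_mono_of_nonzero h
    exact Or.inr (by rw [← cancel_epi i, reassoc_of% hip, Category.comp_id])

/-- An idempotent of a multiplicity-free object is a sum of projections to simple summands. -/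
theorem exists_eq_sum_of_commute
    (hsplit : ∀ {X : Z} (e : X ⟶ X), e ≫ e = e →
      ∃ (Y : Z) (p : X ⟶ Y) (i : Y ⟶ X), i ≫ p = 𝟙 Y ∧ p ≫ i = e)
    {X : Z} {K : Type*} [Fintype K] {S : K → Z} (b : ∀ x, X ⟶ S x) (a : ∀ x, S x ⟶ X)
    (hS : ∀ x, Simple (S x)) (h1 : ∑ x, b x ≫ a x = 𝟙 X) (h2 : ∀ x, a x ≫ b x = 𝟙 (S x))
    {e : X ⟶ X} (he : e ≫ e = e) (hcomm : ∀ f : X ⟶ X, e ≫ f = f ≫ e) :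
    ∃ L : Finset K, e = ∑ x ∈ L, b x ≫ a x := by
  classical
  have h3 : ∀ x, e ≫ b x ≫ a x = b x ≫ (a x ≫ e ≫ b x) ≫ a x := by
    intro x
    have := hcomm (b x ≫ a x)
    simp only [Category.assoc] at this ⊢
    rw [← reassoc_of% this, reassoc_of% (h2 x)]
  have h4 : ∀ x, a x ≫ e ≫ b x = 0 ∨ a x ≫ e ≫ b x = 𝟙 (S x) := by
    intro x
    refine eq_zero_or_eq_id_of_simple hsplit ?_
    have := hcomm (b x ≫ a x)
    simp only [Category.assoc] at this ⊢
    rw [← reassoc_of% this, reassoc_of% he, h2, Category.comp_id]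
  -- Commuting with the summand projections, e acts on each S x by an idempotent, hence by 0 or 1; L
  -- collects the summands where it is 1.
  refine ⟨Finset.univ.filter fun x => a x ≫ e ≫ b x = 𝟙 (S x), ?_⟩
  conv_lhs => rw [← Category.comp_id e, ← h1]
  rw [Preadditive.comp_sum, Finset.sum_filter]
  refine Finset.sum_congr rfl fun x _ => ?_
  rw [h3]
  split_ifs with h
  · rw [h, Category.id_comp]
  · rw [(h4 x).resolve_right h, zero_comp, comp_zero]

theorem eq_of_sum_eq_sum {X : Z} {K : Type*} {S : K → Z} (b : ∀ x, X ⟶ S x)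
    (a : ∀ x, S x ⟶ X) (hS : ∀ x, 𝟙 (S x) ≠ 0) (h2 : ∀ x, a x ≫ b x = 𝟙 (S x))
    (h3 : ∀ x y, x ≠ y → a x ≫ b y = 0) {L L' : Finset K}
    (h : ∑ x ∈ L, b x ≫ a x = ∑ x ∈ L', b x ≫ a x) : L = L' := by
  classical
  have key : ∀ (M : Finset K) x, a x ≫ (∑ y ∈ M, b y ≫ a y) ≫ b x =
      if x ∈ M then 𝟙 (S x) else 0 := by
    intro M x
    rw [Preadditive.sum_comp, Preadditive.comp_sum]
    rw [← Finset.sum_ite_eq M x fun _ => 𝟙 (S x)]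
    refine Finset.sum_congr rfl fun y _ => ?_
    rw [Category.assoc]
    split_ifs with hxy
    · subst hxy
      rw [h2, Category.comp_id, h2]
    · rw [reassoc_of% (h3 x y hxy), zero_comp]
  ext x
  have h4 := (key L x).symm.trans ((congrArg (fun t => a x ≫ t ≫ b x) h).trans (key L' x))
  have := hS x
  by_cases hx : x ∈ L <;> by_cases hx' : x ∈ L' <;> simp_all

end Decomposition

/-! ### Conjugacy classes -/

section ConjugacyClasses

instance {C : Type u} [Category.{v} C] [Preadditive C] [MonoidalCategory C]
    [MonoidalPreadditive C] : (Center.forget C).Additive where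
  map_add := rfl

instance {C : Type u} [Category.{v} C] [MonoidalCategory C] : (Center.forget C).Faithful where
  map_injective h := Center.ext _ _ h

variable {k : Type w} [Field k]
  {C : Type u} [Category.{v} C] [Abelian C] [Linear k C] [MonoidalCategory C]
  [MonoidalPreadditive C] [MonoidalLinear k C] [RigidCategory C] [IsFusion k C]
  {ι : Type} [Fintype ι] {V : ι → C} (j : Pivotal C) {R : C ⥤ Center C}
  (adj : Center.forget C ⊣ R)

include k in
-- Averaging makes all morphisms of the center regular, its idempotents split, and the forgetful
-- functor is faithful into a category with finite-dimensional morphism spaces.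
theorem exists_conjugacyDecomposition (hV : SemisimpleBasis k V) {l : CF adj}
    (hl : IsNormalizedCointegral adj l) : ∃ n, Nonempty (ConjugacyDecomposition adj n) := by
  obtain ⟨K, _, S, b, a, h1, h2, h3, h4⟩ := exists_simple_decomposition k
    (IsFusion.finite_hom (k := k) (C := C)) (Center.forget C) Center.exists_splitting
    (fun f => hl.exists_regular adj hV f (hV.exists_regular f.f)) (centralAlg adj)
  let e := Fintype.equivFin K
  let B : Bicone fun x => S (e.symm x) :=
    { pt := centralAlg adj
      π := fun x => b (e.symm x)
      ι := fun x => a (e.symm x)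
      ι_π := fun x y => by
        split_ifs with h
        · subst h
          exact h3 _
        · exact h4 _ _ fun h' => h (e.symm.injective h') }
  refine ⟨Fintype.card K, ⟨{
    cls := fun x => S (e.symm x)
    simple := fun x => h1 _
    bicone := B
    isBilimit := isBilimitOfTotal B ((e.symm.sum_comp fun x => b x ≫ a x).trans h2)
    iso := Iso.refl _ }⟩⟩

omit [IsFusion k C] in
theorem toEnd_sum (hV : SemisimpleBasis k V) {J : Type*} (s : Finset J) (f : J → CF adj) :
    toEnd adj (∑ x ∈ s, f x) = ∑ x ∈ s, toEnd adj (f x) := by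
  refine Center.ext _ _ ((map_sum (toEndLinear adj hV) f s).trans ?_)
  exact (map_sum (Center.forget C).mapAddHom (fun x => toEnd adj (f x)) s).symm

variable {adj} {n : ℕ} (d : ConjugacyDecomposition adj n)

namespace ConjugacyDecomposition

/-- The projection of `R(𝟙)` to a conjugacy class. -/
def projection (i : Fin n) : centralAlg adj ⟶ d.cls i := d.iso.inv ≫ d.bicone.π i

/-- The inclusion of a conjugacy class in `R(𝟙)`. -/
def inclusion (i : Fin n) : d.cls i ⟶ centralAlg adj := d.bicone.ι i ≫ d.iso.hom

omit [RigidCategory C] in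
theorem inclusion_projection (i : Fin n) : d.inclusion i ≫ d.projection i = 𝟙 _ := by
  simp [inclusion, projection]

omit [RigidCategory C] in
theorem inclusion_projection_of_ne {i i' : Fin n} (h : i ≠ i') :
    d.inclusion i ≫ d.projection i' = 0 := by
  simp [inclusion, projection, d.bicone.ι_π, h]

omit [RigidCategory C] in
theorem sum_projection_inclusion : ∑ i, d.projection i ≫ d.inclusion i = 𝟙 _ := by
  have h := IsBilimit.total d.isBilimit
  rw [← d.iso.inv_hom_id, ← Category.id_comp d.iso.hom, ← h, Preadditive.sum_comp,
    Preadditive.comp_sum]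
  simp only [projection, inclusion, Category.assoc]

omit [RigidCategory C] in
theorem toEnd_idem (i : Fin n) : toEnd adj (d.idem i) = d.projection i ≫ d.inclusion i := by
  simp [idem, projection, inclusion]

omit [IsFusion k C] in
theorem eq_sum_idem_iff (hV : SemisimpleBasis k V) {f : CF adj} {L : Finset (Fin n)} :
    f = ∑ i ∈ L, d.idem i ↔ toEnd adj f = ∑ i ∈ L, d.projection i ≫ d.inclusion i := by
  rw [← (toEnd adj).apply_eq_iff_eq, toEnd_sum adj hV]
  simp only [toEnd_idem]

omit [IsFusion k C] in
-- `toEnd` turns ⋆ into composition of endomorphisms of R(𝟙), so commutativity of class functions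
-- makes every idempotent central.
theorem existsUnique_eq_sum_idem (hV : SemisimpleBasis k V)
    (hcomm : ∀ f g : CF adj, classMul adj f g = classMul adj g f) {f : CF adj}
    (hf : classMul adj f f = f) : ∃! L : Finset (Fin n), f = ∑ i ∈ L, d.idem i := by
  have hmul : ∀ f g : CF adj, toEnd adj (classMul adj f g) = toEnd adj g ≫ toEnd adj f :=
    fun f g => (toEnd_comp adj g f).symm
  obtain ⟨L, hL⟩ := exists_eq_sum_of_commute Center.exists_splitting d.projection d.inclusion
    d.simple d.sum_projection_inclusion d.inclusion_projection
    (e := toEnd adj f) (by rw [← hmul, hf]) fun g => by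
      obtain ⟨g, rfl⟩ := (toEnd adj).surjective g
      rw [← hmul, hcomm, hmul]
  refine ⟨L, (d.eq_sum_idem_iff hV).2 hL, fun L' hL' => ?_⟩
  refine eq_of_sum_eq_sum d.projection d.inclusion (fun i => ?_) d.inclusion_projection
    (fun i i' => d.inclusion_projection_of_ne) (((d.eq_sum_idem_iff hV).1 hL').symm.trans hL)
  have := d.simple i
  exact id_nonzero _

theorem ktrace_toEnd_idem (i : Fin n) :
    ktrace k j (adjAlg adj) (toEnd adj (d.idem i)).f = pdim k j (d.cls i).1 := by
  rw [toEnd_idem]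
  refine (ktrace_comp_comm j (d.projection i).f (d.inclusion i).f).trans ?_
  rw [← ktrace_id]
  exact congrArg _ (congrArg Center.Hom.f (d.inclusion_projection i))

theorem ktrace_toEnd_sum_idem (hV : SemisimpleBasis k V) (L : Finset (Fin n)) :
    ktrace k j (adjAlg adj) (toEnd adj (∑ i ∈ L, d.idem i)).f =
      ∑ i ∈ L, pdim k j (d.cls i).1 := by
  change ktrace k j (adjAlg adj) (toEndLinear adj hV _) = _
  rw [map_sum, map_sum]
  exact Finset.sum_congr rfl fun i _ => d.ktrace_toEnd_idem j i

end ConjugacyDecomposition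

end ConjugacyClasses

/-! ### The Fourier preimage and the trace of the subcategory cointegral -/

section FusionSubcategory

variable {k : Type w} [Field k]
  {C : Type u} [Category.{v} C] [Abelian C] [Linear k C] [MonoidalCategory C]
  [MonoidalPreadditive C] [MonoidalLinear k C] [RigidCategory C] [IsFusion k C]
  {ι : Type} [Fintype ι] {V : ι → C} (j : Pivotal C) {R : C ⥤ Center C}
  (adj : Center.forget C ⊣ R) {P : ObjectProperty C} [IsFusionSubcategory P]

include j in
omit [IsFusion k C] in
theorem isLeftAdjoint_forget_fullSubcategory (hV : SemisimpleBasis k V) :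
    (Center.forget P.FullSubcategory).IsLeftAdjoint := by
  classical
  let := rigidFullSubcategory P j
  exact (hV.fullSubcategory P).isLeftAdjoint_forget

theorem fourier_regularChar_bijective (hV : SemisimpleBasis k V) {c : k} (hc : c ≠ 0) :
    Function.Bijective (fourier adj (c • regularChar k V j adj ⊤)) := by
  rw [smul_regularChar_top]
  exact fourier_bijective j adj hV fun i => mul_ne_zero hc (hV.pdim_ne_zero j i)

variable {adj} {l : CF adj} (hl : l = (globalDim k j V P)⁻¹ • regularChar k V j adj P)

include hl

theorem eq_of_fourier_eq (hV : SemisimpleBasis k V) (hC : globalDim k j V ⊤ ≠ 0)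
    {E : ι → CE adj} (hE : ∀ i, IsCentralIdempotent adj V i (E i)) {a : CE adj}
    (ha : fourier adj ((globalDim k j V ⊤)⁻¹ • regularChar k V j adj ⊤) a = l) :
    a = (globalDim k j V ⊤ / globalDim k j V P) • ∑ i ∈ irrIn V P, E i := by
  refine (fourier_regularChar_bijective j adj hV (inv_ne_zero hC)).injective ?_
  rw [ha, hl, fourier_sum_centralIdempotent j adj hV hE, div_eq_mul_inv, inv_mul_cancel_left₀ hC]

theorem classMul_self_of_eq (hV : SemisimpleBasis k V) (hj : j.IsSpherical)
    (hP : globalDim k j V P ≠ 0) : classMul adj l l = l := by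
  have h1 : (toEnd adj l).f =
      (globalDim k j V P)⁻¹ • (toEnd adj (regularChar k V j adj P)).f := by
    rw [hl]
    exact map_smul (toEndLinear adj hV) _ _
  change (toEnd adj l).f ≫ l = l
  rw [h1, hl, Linear.comp_smul, Linear.smul_comp, toEnd_regularChar_comp j adj hV hj, smul_smul,
    smul_smul, mul_assoc, inv_mul_cancel₀ hP, mul_one]

theorem ktrace_toEnd_of_eq (hV : SemisimpleBasis k V) :
    ktrace k j (adjAlg adj) (toEnd adj l).f = globalDim k j V ⊤ / globalDim k j V P := by
  change ktrace k j (adjAlg adj) (toEndLinear adj hV l) = _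
  rw [hl, map_smul, map_smul, smul_eq_mul, div_eq_inv_mul]
  exact congrArg _ (ktrace_toEnd_regularChar j adj hV)

end FusionSubcategory

end FusionCat

theorem proposition4p15 {k : Type w} [Field k] [IsAlgClosed k]
    {C : Type u} [Category.{v} C] [Abelian C] [Linear k C] [MonoidalCategory C]
    [MonoidalPreadditive C] [MonoidalLinear k C] [RigidCategory C] [FusionCat.IsFusion k C]
    (j : FusionCat.Pivotal C) (hj : j.IsSpherical)
    {ι : Type} [Fintype ι] (V : ι → C) (hV : FusionCat.IsIrr V)
    (hC : FusionCat.globalDim k j V ⊤ ≠ 0)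
    (P : ObjectProperty C) [FusionCat.IsFusionSubcategory P] :
    -- the forgetful functors have right adjoints, and the subcategory is non-degenerate
    (Center.forget C).IsLeftAdjoint ∧ (Center.forget P.FullSubcategory).IsLeftAdjoint ∧
    FusionCat.globalDim k j V P ≠ 0 ∧
    ∀ (R : C ⥤ Center C) (adj : Center.forget C ⊣ R)
      (RD : P.FullSubcategory ⥤ Center P.FullSubcategory)
      (adjD : Center.forget P.FullSubcategory ⊣ RD),
      -- the objects that occur below exist and are unique
      Function.Bijective (FusionCat.psi adj) ∧
      (∀ i, ∃! e, FusionCat.IsCentralIdempotent adj V i e) ∧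
      (∃! l, FusionCat.IsNormalizedCointegral adj l) ∧
      (∃! l, FusionCat.IsIdempotentCointegral adjD l) ∧
      (∃! q, FusionCat.IsRestriction adj adjD q) ∧
      (∃ n, Nonempty (FusionCat.ConjugacyDecomposition adj n)) ∧
      ∀ (E : ι → FusionCat.CE adj) (l : FusionCat.CF adj) (lD : FusionCat.CF adjD)
        (q : FusionCat.adjAlg adj ⟶ (FusionCat.adjAlg adjD).obj),
        (∀ i, FusionCat.IsCentralIdempotent adj V i (E i)) →
        FusionCat.IsNormalizedCointegral adj l →
        FusionCat.IsIdempotentCointegral adjD lD →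
        FusionCat.IsRestriction adj adjD q →
        Function.Bijective (FusionCat.fourier adj l) ∧
        ∀ ell : FusionCat.CE adj,
          FusionCat.fourier adj l ell = FusionCat.restrict adj adjD q lD →
          ell = (FusionCat.globalDim k j V ⊤ / FusionCat.globalDim k j V P) •
              ∑ i ∈ FusionCat.irrIn V P, E i ∧
          FusionCat.scalar k (ell ≫ FusionCat.counit adj) =
              FusionCat.globalDim k j V ⊤ / FusionCat.globalDim k j V P ∧
          ∀ (n : ℕ) (d : FusionCat.ConjugacyDecomposition adj n),
            ((∀ f g : FusionCat.CF adj,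
                FusionCat.classMul adj f g = FusionCat.classMul adj g f) →
              ∃! L : Finset (Fin n),
                FusionCat.restrict adj adjD q lD = ∑ i ∈ L, d.idem i) ∧
            ∀ L : Finset (Fin n), FusionCat.restrict adj adjD q lD = ∑ i ∈ L, d.idem i →
              FusionCat.globalDim k j V ⊤ / FusionCat.globalDim k j V P =
                ∑ i ∈ L, FusionCat.pdim k j (d.cls i).1 := by
  have hVb : FusionCat.SemisimpleBasis k V := hV.semisimpleBasis
  have : HasFiniteBiproducts C := Abelian.hasFiniteBiproducts
  have hP := FusionCat.globalDim_ne_zero (P := P) j hVb hj hC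
  refine ⟨hVb.isLeftAdjoint_forget, FusionCat.isLeftAdjoint_forget_fullSubcategory j hVb, hP, ?_⟩
  intro R adj RD adjD
  have hU := hVb.isUniversal_counit adj (𝟙_ C)
  have hN := FusionCat.isNormalizedCointegral_iff_eq j adj hVb hj hC
  have hI := FusionCat.isIdempotentCointegral_iff_eq j adjD hVb hj hC
  refine ⟨FusionCat.psi_bijective adj hVb hU, FusionCat.existsUnique_centralIdempotent adj hU,
    ⟨_, (hN _).2 rfl, fun l hl => (hN l).1 hl⟩, ⟨_, (hI _).2 rfl, fun l hl => (hI l).1 hl⟩,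
    FusionCat.existsUnique_isRestriction j adj adjD hVb,
    FusionCat.exists_conjugacyDecomposition adj hVb ((hN _).2 rfl), ?_⟩
  intro E l lD q hE hl hlD hq
  obtain rfl := (hN l).1 hl
  obtain rfl := (hI lD).1 hlD
  refine ⟨FusionCat.fourier_regularChar_bijective j adj hVb (inv_ne_zero hC), ?_⟩
  -- By uniqueness of both cointegrals, everything reduces to the explicit multiples of regular
  -- characters.
  have hr : FusionCat.restrict adj adjD q
      ((FusionCat.globalDim k j V P)⁻¹ • FusionCat.subRegularChar k V j adjD) =
      (FusionCat.globalDim k j V P)⁻¹ • FusionCat.regularChar k V j adj P := by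
    rw [← FusionCat.restrict_subRegularChar j adj adjD hq]
    exact Linear.comp_smul _ _ _ _ _ _
  intro ell h_ell
  have h1 := FusionCat.eq_of_fourier_eq j hr hVb hC hE h_ell
  refine ⟨h1, ?_, fun n d => ⟨fun hcomm => d.existsUnique_eq_sum_idem hVb hcomm
    (FusionCat.classMul_self_of_eq j hr hVb hj hP), fun L hL => ?_⟩⟩
  · rw [h1, Linear.smul_comp, FusionCat.sum_centralIdempotent_counit adj hVb hE,
      FusionCat.scalar_smul]
  -- The trace of the endomorphism of A given by λ_D, evaluated in two ways.
  · rw [← FusionCat.ktrace_toEnd_of_eq j hr hVb, hL, d.ktrace_toEnd_sum_idem j hVb]
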